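/- Let $d\in\{2,3\}$, $\kappa>0$, let $\mathbf e\in\mathbb R^d$ be a unit vector, and let $u_{\mathrm{inc}}(\mathbf x)=e^{i\kappa\langle\mathbf e,\mathbf x\rangle}$. Let $$\Phi(\mathbf x,\mathbf z)=\begin{cases}\frac i4H^{(1)}_0(\kappa\|\mathbf x-\mathbf z\|_2),&d=2,\\[1ex] \dfrac{e^{i\kappa\|\mathbf x-\mathbf z\|_2}}{4\pi\|\mathbf x-\mathbf z\|_2},&d=3,\end{cases}$$ be the fundamental solution of the Helmholtz equation. Let $(\Omega,\mathcal A,\mathbb P)$ be a probability space, $D_0\subset\mathbb R^d$ a bounded, simply connected domain with $C^1$ boundary, and let $\mathbf V(\cdot,\omega)\colon\overline{D_0}\to\mathbb R^d$, $\omega\in\Omega$, be a uniform $C^1$-diffeomorphism: for almost every $\omega$, $\mathbf V(\cdot,\omega)$ is a $C^1$-diffeomorphism onto its image, and its $C^1$-norm and that of its inverse are bounded by a constant independent of $\omega$. Put $D(\omega)=\mathbf V(D_0,\omega)$, and let $R>0$ be such that $\overline{D(\omega)}\subset B_R(\mathbf 0)=\{\|\mathbf x\|_2<R\}$ for almost every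 $\omega$. Let $\Sigma=\partial B_R(\mathbf 0)$, with surface measure $\sigma$ and outward unit normal $\mathbf n_{\mathbf z}=\mathbf z/\|\mathbf z\|_2$. For almost every $\omega$ let $u_{\mathrm s}(\cdot,\omega)$ be the scattered wave of the sound-soft obstacle $D(\omega)$: the total wave $u=u_{\mathrm{inc}}+u_{\mathrm s}$ is $C^2$ with $\Delta u+\kappa^2u=0$ in $\mathbb R^d\setminus\overline{D(\omega)}$, is continuous on $\mathbb R^d\setminus D(\omega)$, vanishes on $\partial D(\omega)$, and $r^{(d-1)/2}\big(\frac{\partial u_{\mathrm s}}{\partial r}-i\kappa u_{\mathrm s}\big)\to0$ as $r=\|\mathbf x\|_2\to\infty$, uniformly in all directions. Assume that the Cauchy data $u_{\mathrm s}|_\Sigma$ and $\frac{\partial u_{\mathrm s}}{\partial\mathbf n}|_\Sigma$ are random fields in $L^2_{\mathbb P}(\Omega;L^2(\Sigma))$. For random fields $v,w$ write $\mathbb E[v](\mathbf x)$ for the expectation, and $$\operatorname{Cor}[v,w](\mathbf x,\mathbf x')=\mathbb E\big[v(\mathbf x)\overline{w(\mathbf x')}\big],\qquad \operatorname{Cor}[v]=\operatorname{Cor}[v,v],$$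 $$\operatorname{Cov}[v](\mathbf x,\mathbf x')=\mathbb E\big[(v(\mathbf x)-\mathbb E[v](\mathbf x))\overline{(v(\mathbf x')-\mathbb E[v](\mathbf x'))}\big],\qquad \mathbb V[v](\mathbf x)=\mathbb E\big[|v(\mathbf x)-\mathbb E[v](\mathbf x)|^2\big].$$ Then $u_{\mathrm s}(\mathbf x)\in L^2_{\mathbb P}(\Omega)$ for every $\|\mathbf x\|_2>R$, and for all $\mathbf x,\mathbf x'$ with $\|\mathbf x\|_2>R$ and $\|\mathbf x'\|_2>R$ $$\begin{aligned}\operatorname{Cor}[u_{\mathrm s}](\mathbf x,\mathbf x')=\int_\Sigma\int_\Sigma\bigg\{&\Phi(\mathbf x,\mathbf z)\overline{\Phi(\mathbf x',\mathbf z')}\operatorname{Cor}\Big[\frac{\partial u_{\mathrm s}}{\partial\mathbf n}\Big](\mathbf z,\mathbf z')\\&-\Phi(\mathbf x,\mathbf z)\overline{\frac{\partial\Phi(\mathbf x',\mathbf z')}{\partial\mathbf n_{\mathbf z'}}}\operatorname{Cor}\Big[\frac{\partial u_{\mathrm s}}{\partial\mathbf n},u_{\mathrm s}\Big](\mathbf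 z,\mathbf z')\\&-\frac{\partial\Phi(\mathbf x,\mathbf z)}{\partial\mathbf n_{\mathbf z}}\overline{\Phi(\mathbf x',\mathbf z')}\operatorname{Cor}\Big[u_{\mathrm s},\frac{\partial u_{\mathrm s}}{\partial\mathbf n}\Big](\mathbf z,\mathbf z')\\&+\frac{\partial\Phi(\mathbf x,\mathbf z)}{\partial\mathbf n_{\mathbf z}}\overline{\frac{\partial\Phi(\mathbf x',\mathbf z')}{\partial\mathbf n_{\mathbf z'}}}\operatorname{Cor}[u_{\mathrm s}](\mathbf z,\mathbf z')\bigg\}\,d\sigma_{\mathbf z'}\,d\sigma_{\mathbf z},\end{aligned}$$ where the integrand is integrable on $\Sigma\times\Sigma$. Moreover $$\operatorname{Cov}[u_{\mathrm s}](\mathbf x,\mathbf x')=\operatorname{Cor}[u_{\mathrm s}](\mathbf x,\mathbf x')-\mathbb E[u_{\mathrm s}](\mathbf x)\overline{\mathbb E[u_{\mathrm s}](\mathbf x')},$$ $$\mathbb V[u_{\mathrm s}](\mathbf x)=\operatorname{Cov}[u_{\mathrm s}](\mathbf x,\mathbf x)=\operatorname{Cor}[u_{\mathrm s}](\mathbf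 x,\mathbf x)-|\mathbb E[u_{\mathrm s}](\mathbf x)|^2.$$ -/

import Mathlib

open Filter Topology MeasureTheory Metric Bornology Set
open scoped ComplexConjugate Nat Laplacian

noncomputable section

namespace RandomScattering

/-- Euclidean space `ℝ^d`. -/
abbrev Space (d : ℕ) : Type := EuclideanSpace ℝ (Fin d)

/-! ### The fundamental solution of the Helmholtz equation -/

/-- The Bessel function of the first kind of order zero,
`J₀(t) = ∑ₘ (-1)^m / (m!)² (t/2)^(2m)`. -/
def besselJ0 (t : ℝ) : ℝ :=
  ∑' m : ℕ, (-1 : ℝ) ^ m / ((m ! : ℝ)) ^ 2 * (t / 2) ^ (2 * m)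

/-- The Bessel function of the second kind of order zero, for `t > 0`,
`Y₀(t) = (2/π) ((log (t/2) + γ) J₀(t) - ∑ₘ (-1)^m hₘ / (m!)² (t/2)^(2m))`, with Euler's constant `γ`
and the harmonic numbers `hₘ = 1 + 1/2 + ⋯ + 1/m`. -/
def besselY0 (t : ℝ) : ℝ :=
  2 / Real.pi * ((Real.log (t / 2) + Real.eulerMascheroniConstant) * besselJ0 t
    - ∑' m : ℕ, (-1 : ℝ) ^ m * ((harmonic m : ℚ) : ℝ) / ((m ! : ℝ)) ^ 2 * (t / 2) ^ (2 * m))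

/-- The Hankel function of the first kind of order zero, `H₀⁽¹⁾ = J₀ + i Y₀`, on `(0, ∞)`. -/
def hankelH0 (t : ℝ) : ℂ := (besselJ0 t : ℂ) + Complex.I * (besselY0 t : ℂ)

/-- The fundamental solution `Φ(x, z)` of the Helmholtz equation with wavenumber `κ`, in the
dimensions `d = 2` and `d = 3` (the second branch is only meant for `d = 3`). -/
def Phi (d : ℕ) (κ : ℝ) (x z : Space d) : ℂ :=
  if d = 2 then Complex.I / 4 * hankelH0 (κ * ‖x - z‖)
  else Complex.exp (Complex.I * κ * ‖x - z‖) / (4 * Real.pi * ‖x - z‖)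

/-! ### The artificial interface `Σ`, the sphere of radius `R` around the origin -/

/-- The surface measure `σ` of the sphere `Σ = ∂B_R(0)`, as a measure on `ℝ^d` carried by `Σ`: the
standard surface measure of the unit sphere, transported by `s ↦ R s` and multiplied by
`R^(d-1)`. -/
def surfaceMeasure (d : ℕ) (R : ℝ) : Measure (Space d) :=
  ENNReal.ofReal (R ^ (d - 1)) •
    ((volume : Measure (Space d)).toSphere).map
      (fun s : sphere (0 : Space d) 1 => R • (s : Space d))

/-- The derivative of `f` at `z` in the radial direction `z / ‖z‖`. For `z ∈ Σ` this is the
derivative `∂f/∂n(z)` in the direction of the outward unit normal of `Σ`. -/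
def normalDeriv {d : ℕ} (f : Space d → ℂ) (z : Space d) : ℂ :=
  fderiv ℝ f z (‖z‖⁻¹ • z)

/-- The normal derivative `∂Φ(x, z)/∂n_z` of the fundamental solution in its second argument. -/
def dPhi (d : ℕ) (κ : ℝ) (x z : Space d) : ℂ := normalDeriv (Phi d κ x) z

/-! ### The scattering problem for a sound-soft obstacle -/

/-- The incident plane wave `x ↦ exp(i κ ⟨e, x⟩)` with direction `e`. -/
def incidentWave (d : ℕ) (κ : ℝ) (e x : Space d) : ℂ :=
  Complex.exp (Complex.I * κ * (inner ℝ e x : ℝ))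

/-- `us` is the scattered wave of the sound-soft obstacle `D` for the incident plane wave with
direction `e`: the total wave `u_inc + us` solves the Helmholtz equation in `ℝ^d ∖ closure D`
classically, is continuous up to the boundary of `D` and vanishes there, and `us` satisfies the
Sommerfeld radiation condition, uniformly in all directions. -/
structure IsScatteredWave (d : ℕ) (κ : ℝ) (e : Space d) (D : Set (Space d))
    (us : Space d → ℂ) : Prop where
  contDiffOn : ContDiffOn ℝ 2 (fun x => incidentWave d κ e x + us x) (closure D)ᶜ
  helmholtz : ∀ x ∈ (closure D)ᶜ,
    Δ (fun y => incidentWave d κ e y + us y) x + (κ : ℂ) ^ 2 * (incidentWave d κ e x + us x) = 0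
  continuousOn : ContinuousOn (fun x => incidentWave d κ e x + us x) Dᶜ
  dirichlet : ∀ x ∈ frontier D, incidentWave d κ e x + us x = 0
  sommerfeld : Tendsto
    (fun x : Space d => (((‖x‖ ^ (((d : ℝ) - 1) / 2) : ℝ)) : ℂ) *
      (normalDeriv us x - Complex.I * κ * us x)) (cobounded (Space d)) (𝓝 0)

/-! ### Random obstacles -/

/-- A nominal obstacle: a bounded, simply connected domain with a boundary of class `C¹`, that is,
near each boundary point the domain is the sublevel set of a `C¹` function whose derivative does
not vanish at that point. -/
structure IsNominalObstacle {d : ℕ} (D₀ : Set (Space d)) : Prop where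
  isOpen : IsOpen D₀
  isBounded : IsBounded D₀
  isSimplyConnected : IsSimplyConnected D₀
  boundary : ∀ p ∈ frontier D₀, ∃ U : Set (Space d), IsOpen U ∧ p ∈ U ∧
    ∃ f : Space d → ℝ, ContDiffOn ℝ 1 f U ∧ fderiv ℝ f p ≠ 0 ∧ D₀ ∩ U = {x ∈ U | f x < 0}

/-- `f` is of class `C¹` on `S`, and `f` and its derivative are bounded by `C` on `S`. -/
def C1BoundedOn {d : ℕ} (f : Space d → Space d) (S : Set (Space d)) (C : ℝ) : Prop :=
  ContDiffOn ℝ 1 f S ∧ ∀ x ∈ S, ‖f x‖ ≤ C ∧ ‖fderivWithin ℝ f S x‖ ≤ C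

/-- The random vector field `V` is a uniform `C¹`-diffeomorphism of `closure D₀`: for almost every
`ω` the map `V ω` is a `C¹`-diffeomorphism from `closure D₀` onto its image, and the `C¹`-norms of
`V ω` and of its inverse are bounded by a constant that does not depend on `ω`. -/
def IsUniformC1Diffeo {Ω : Type*} [MeasurableSpace Ω] (P : Measure Ω) {d : ℕ}
    (D₀ : Set (Space d)) (V : Ω → Space d → Space d) : Prop :=
  ∃ C : ℝ, ∀ᵐ ω ∂P, C1BoundedOn (V ω) (closure D₀) C ∧
    ∃ W : Space d → Space d, LeftInvOn W (V ω) (closure D₀) ∧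
      C1BoundedOn W (V ω '' closure D₀) C

/-! ### Random fields and their second order statistics -/

/-- `v` is a random field in `L²_P(Ω; L²(σ)) ≅ L²_P(Ω) ⊗ L²(σ)`. -/
def IsL2RandomField {Ω : Type*} [MeasurableSpace Ω] (P : Measure Ω) {d : ℕ}
    (σ : Measure (Space d)) (v : Ω → Space d → ℂ) : Prop :=
  MemLp (fun p : Ω × Space d => v p.1 p.2) 2 (P.prod σ)

/-- The expectation `E[v](x)`. -/
def expectation {Ω : Type*} [MeasurableSpace Ω] (P : Measure Ω) {d : ℕ}
    (v : Ω → Space d → ℂ) (x : Space d) : ℂ := ∫ ω, v ω x ∂P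

/-- The two-point correlation `Cor[v, w](x, x') = E[v(x) conj (w(x'))]`; `Cor[v]` is
`Cor[v, v]`. -/
def correlation {Ω : Type*} [MeasurableSpace Ω] (P : Measure Ω) {d : ℕ}
    (v w : Ω → Space d → ℂ) (x x' : Space d) : ℂ := ∫ ω, v ω x * conj (w ω x') ∂P

/-- The covariance `Cov[v](x, x') = E[(v(x) - E[v](x)) conj (v(x') - E[v](x'))]`. -/
def covariance {Ω : Type*} [MeasurableSpace Ω] (P : Measure Ω) {d : ℕ}
    (v : Ω → Space d → ℂ) (x x' : Space d) : ℂ :=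
  ∫ ω, (v ω x - expectation P v x) * conj (v ω x' - expectation P v x') ∂P

/-- The variance `V[v](x) = E[|v(x) - E[v](x)|²]`. -/
def variance {Ω : Type*} [MeasurableSpace Ω] (P : Measure Ω) {d : ℕ}
    (v : Ω → Space d → ℂ) (x : Space d) : ℝ := ∫ ω, ‖v ω x - expectation P v x‖ ^ 2 ∂P

/-- The integrand of the deterministic expression for the two-point correlation: the four second
moments of the Cauchy data `us`, `∂us/∂n` at `(z, z')`, paired with the kernels. -/
def corIntegrand {Ω : Type*} [MeasurableSpace Ω] (P : Measure Ω) {d : ℕ} (κ : ℝ)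
    (us : Ω → Space d → ℂ) (x x' z z' : Space d) : ℂ :=
  Phi d κ x z * conj (Phi d κ x' z') *
      correlation P (fun ω => normalDeriv (us ω)) (fun ω => normalDeriv (us ω)) z z'
    - Phi d κ x z * conj (dPhi d κ x' z') *
      correlation P (fun ω => normalDeriv (us ω)) us z z'
    - dPhi d κ x z * conj (Phi d κ x' z') *
      correlation P us (fun ω => normalDeriv (us ω)) z z'
    + dPhi d κ x z * conj (dPhi d κ x' z') * correlation P us us z z'

end RandomScattering

end

open RandomScattering

/-! Outside the ball, each realization of the scattered wave is given by Green's formula u_s(x) =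
∫_Σ (∂Φ/∂n u_s - Φ ∂u_s/∂n) dσ. Its kernels are deterministic, and bounded on Σ because x lies off
Σ. Multiplying the formula at x by the conjugate of the formula at x' and taking expectations
produces the four terms of the correlation. Fubini applies because the Cauchy data are square
integrable over Ω × Σ and σ is finite (`correlation_of_layer_representation`). Covariance and
variance are then algebra.

The analytic core is Green's formula, `exterior_representation`. Boundary integrals arise as limits:
a divergence-free field X satisfies ∫ ∇θ · X = 0 for every test function θ, and letting θ be a
combination of radial steps whose width shrinks to zero turns this into a linear relation between
fluxes through spheres (`sum_flux_eq_zero`). For X = u ∇Φ - Φ ∇u, the flux through Σ plus the flux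
through a small sphere around x equals the flux through a large sphere. The small flux tends to
-u(x). The large one tends to 0 by the radiation conditions, once u is known to be bounded in mean
square on large spheres (`exists_sphere_mean_square_bound`); that bound follows from the constancy
of the flux of u ∇ū - ū ∇u.

What Φ has to satisfy is collected in `IsOutgoingProfile`. For d = 3 it is an explicit computation.
For d = 2 the Hankel function is given by power series at the origin, where its decay is invisible.
The Laplace integral e^(it) ∫ e^(-tv) (v(v - 2i))^(-1/2) dv solves the same Bessel equation and
visibly radiates; comparing both functions at t → 0 and using Wronskians identifies them up to a
constant factor (`hankelH0_eq`). -/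

namespace RandomScattering

/-! ### Second moments of random fields integrated over a finite measure space -/

section SecondMoments

variable {Ω Z : Type*} [MeasurableSpace Ω] [MeasurableSpace Z] {P : Measure Ω}
  [IsFiniteMeasure P] {σ : Measure Z} [IsFiniteMeasure σ]

/-- Forgetting the second point pushes the product measure forward to `σ univ` times `P.prod σ`.
Finiteness of σ is what keeps the field square integrable after adding a variable. -/
lemma MemLp_comp_fst_snd {w : Ω × Z → ℂ} (hw : MemLp w 2 (P.prod σ)) :
    MemLp (fun q : Ω × (Z × Z) => w (q.1, q.2.1)) 2 (P.prod (σ.prod σ)) := by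
  have h : (P.prod (σ.prod σ)).map (Prod.map id Prod.fst) = P.prod (σ univ • σ) := by
    rw [← Measure.map_prod_map P (σ.prod σ) measurable_id measurable_fst, Measure.map_id,
      Measure.map_fst_prod]
  have h2 : MemLp w 2 ((P.prod (σ.prod σ)).map (Prod.map id Prod.fst)) := by
    rw [h, Measure.prod_smul_right]
    exact hw.smul_measure (measure_ne_top _ _)
  exact h2.comp_of_map (by fun_prop)

lemma MemLp_comp_snd_snd {w : Ω × Z → ℂ} (hw : MemLp w 2 (P.prod σ)) :
    MemLp (fun q : Ω × (Z × Z) => w (q.1, q.2.2)) 2 (P.prod (σ.prod σ)) := by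
  have h : (P.prod (σ.prod σ)).map (Prod.map id Prod.snd) = P.prod (σ univ • σ) := by
    rw [← Measure.map_prod_map P (σ.prod σ) measurable_id measurable_snd, Measure.map_id,
      Measure.map_snd_prod]
  have h2 : MemLp w 2 ((P.prod (σ.prod σ)).map (Prod.map id Prod.snd)) := by
    rw [h, Measure.prod_smul_right]
    exact hw.smul_measure (measure_ne_top _ _)
  exact h2.comp_of_map (by fun_prop)

lemma MemLp_conj {α : Type*} [MeasurableSpace α] {μ : Measure α} {f : α → ℂ}
    (hf : MemLp f 2 μ) : MemLp (fun x => conj (f x)) 2 μ :=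
  hf.star

/-- The product of two square integrable fields at two points is integrable. -/
lemma integrable_mul_conj {w w' : Ω × Z → ℂ} (hw : MemLp w 2 (P.prod σ))
    (hw' : MemLp w' 2 (P.prod σ)) :
    Integrable (fun q : Ω × (Z × Z) => w (q.1, q.2.1) * conj (w' (q.1, q.2.2)))
      (P.prod (σ.prod σ)) :=
  (MemLp_comp_fst_snd hw).integrable_mul (MemLp_conj (MemLp_comp_snd_snd hw'))

/-- No integrability is needed: if a factor fails to be integrable, both sides are zero. -/
lemma integral_mul_conj_integral (w w' : Z → ℂ) :
    (∫ z, w z ∂σ) * conj (∫ z, w' z ∂σ) = ∫ p : Z × Z, w p.1 * conj (w' p.2) ∂(σ.prod σ) := by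
  rw [integral_prod_mul w (fun z => conj (w' z)), integral_conj]

/-- The squared modulus of the inner integral is the integral over pairs (z, z') of a product of two
square integrable fields, so Fubini gives its integrability in ω. -/
lemma memLp_integral {w : Ω × Z → ℂ} (hw : MemLp w 2 (P.prod σ)) :
    MemLp (fun ω => ∫ z, w (ω, z) ∂σ) 2 P := by
  rw [memLp_two_iff_integrable_sq_norm hw.1.integral_prod_right']
  have h := (integrable_mul_conj hw hw).integral_prod_left.norm
  refine h.congr (Eventually.of_forall fun ω => ?_)
  simp only
  rw [← integral_mul_conj_integral (fun z => w (ω, z)) (fun z => w (ω, z)), Complex.mul_conj,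
    Complex.normSq_eq_norm_sq, Complex.norm_real, norm_pow, norm_norm]

lemma expectation_integral_mul_conj {w w' : Ω × Z → ℂ} (hw : MemLp w 2 (P.prod σ))
    (hw' : MemLp w' 2 (P.prod σ)) :
    ∫ ω, (∫ z, w (ω, z) ∂σ) * conj (∫ z, w' (ω, z) ∂σ) ∂P =
      ∫ p : Z × Z, ∫ ω, w (ω, p.1) * conj (w' (ω, p.2)) ∂P ∂(σ.prod σ) := by
  simp_rw [integral_mul_conj_integral (fun z => w (_, z)) (fun z => w' (_, z))]
  exact integral_integral_swap (integrable_mul_conj hw hw')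

lemma memLp_kernel_mul {k : Z → ℂ} (hk : MemLp k ⊤ σ) {a : Ω × Z → ℂ}
    (ha : MemLp a 2 (P.prod σ)) : MemLp (fun p : Ω × Z => k p.2 * a p) 2 (P.prod σ) :=
  ha.mul' (hk.comp_snd P)

/-- For fixed points the kernels are constants, and the expectation is expanded by linearity. This
is legitimate only where the four products are integrable in ω, which Fubini grants for almost every
pair of points; hence the equality is almost everywhere. -/
lemma ae_integral_layer_mul_conj {a b : Ω × Z → ℂ} (ha : MemLp a 2 (P.prod σ))
    (hb : MemLp b 2 (P.prod σ)) (k l k' l' : Z → ℂ) :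
    (fun p : Z × Z => ∫ ω, (l p.1 * b (ω, p.1) - k p.1 * a (ω, p.1)) *
        conj (l' p.2 * b (ω, p.2) - k' p.2 * a (ω, p.2)) ∂P) =ᵐ[σ.prod σ]
    fun p => k p.1 * conj (k' p.2) * (∫ ω, a (ω, p.1) * conj (a (ω, p.2)) ∂P)
      - k p.1 * conj (l' p.2) * (∫ ω, a (ω, p.1) * conj (b (ω, p.2)) ∂P)
      - l p.1 * conj (k' p.2) * (∫ ω, b (ω, p.1) * conj (a (ω, p.2)) ∂P)
      + l p.1 * conj (l' p.2) * (∫ ω, b (ω, p.1) * conj (b (ω, p.2)) ∂P) := by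
  filter_upwards [(integrable_mul_conj ha ha).prod_left_ae,
    (integrable_mul_conj ha hb).prod_left_ae, (integrable_mul_conj hb ha).prod_left_ae,
    (integrable_mul_conj hb hb).prod_left_ae] with p haa hab hba hbb
  simp only [← integral_const_mul]
  have h1 := (haa.const_mul (k p.1 * conj (k' p.2))).sub (hab.const_mul (k p.1 * conj (l' p.2)))
  have h2 := h1.sub (hba.const_mul (l p.1 * conj (k' p.2)))
  have h3 := hbb.const_mul (l p.1 * conj (l' p.2))
  refine Eq.trans ?_ ((integral_add h2 h3).trans ?_)
  · refine integral_congr_ae (Eventually.of_forall fun ω => ?_)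
    simp only [map_sub, map_mul, Pi.sub_apply]
    ring
  · rw [integral_sub' h1 (hba.const_mul _), integral_sub' (haa.const_mul _) (hab.const_mul _)]

end SecondMoments

/-! ### Covariance, variance, and the correlation of a field given by layer potentials -/

section Statistics

lemma variance_eq_covariance {d : ℕ} {Ω : Type*} [MeasurableSpace Ω] {P : Measure Ω}
    (v : Ω → Space d → ℂ) (x : Space d) :
    (variance P v x : ℂ) = covariance P v x x := by
  unfold variance covariance
  rw [← integral_complex_ofReal]
  refine integral_congr_ae (Eventually.of_forall fun ω => ?_)
  simp only [Complex.mul_conj, Complex.normSq_eq_norm_sq]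

variable {d : ℕ} {Ω : Type*} [MeasurableSpace Ω] {P : Measure Ω} [IsProbabilityMeasure P]

lemma covariance_eq {v : Ω → Space d → ℂ} {x x' : Space d} (hx : MemLp (fun ω => v ω x) 2 P)
    (hx' : MemLp (fun ω => v ω x') 2 P) :
    covariance P v x x' =
      correlation P v v x x' - expectation P v x * conj (expectation P v x') := by
  have h1 : Integrable (fun ω => v ω x * conj (v ω x')) P := hx.integrable_mul (MemLp_conj hx')
  have h2 : Integrable (fun ω => v ω x) P := hx.integrable (by norm_num)
  have h3 : Integrable (fun ω => conj (v ω x')) P := (MemLp_conj hx').integrable (by norm_num)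
  have key : ∀ ω, (v ω x - expectation P v x) * conj (v ω x' - expectation P v x') =
      v ω x * conj (v ω x') - v ω x * conj (expectation P v x')
        - (expectation P v x * conj (v ω x') - expectation P v x * conj (expectation P v x')) := by
    intro ω; rw [map_sub]; ring
  unfold covariance correlation
  simp_rw [key]
  have h4 := h2.mul_const (conj (expectation P v x'))
  have h5 := h3.const_mul (expectation P v x)
  have h6 : Integrable (fun _ : Ω => expectation P v x * conj (expectation P v x')) P :=
    integrable_const _
  refine (integral_sub (h1.sub h4) (h5.sub h6)).trans ?_
  rw [integral_sub' h1 h4, integral_sub' h5 h6, integral_mul_const, integral_const_mul, integral_conj, integral_const]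
  simp [expectation]

/-- The probabilistic half of the theorem, for any finite σ: a layer representation with bounded
deterministic kernels already forces the correlation formula. The signs +, -, -, + come from
multiplying two differences. -/
lemma correlation_of_layer_representation {κ : ℝ} {σ : Measure (Space d)} [IsFiniteMeasure σ]
    {us : Ω → Space d → ℂ} (hDir : IsL2RandomField P σ us)
    (hNeu : IsL2RandomField P σ (fun ω => normalDeriv (us ω))) {x x' : Space d}
    (hk : MemLp (Phi d κ x) ⊤ σ) (hl : MemLp (dPhi d κ x) ⊤ σ)
    (hk' : MemLp (Phi d κ x') ⊤ σ) (hl' : MemLp (dPhi d κ x') ⊤ σ)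
    (hx : ∀ᵐ ω ∂P, us ω x = ∫ z, (dPhi d κ x z * us ω z - Phi d κ x z * normalDeriv (us ω) z) ∂σ)
    (hx' : ∀ᵐ ω ∂P, us ω x' =
      ∫ z, (dPhi d κ x' z * us ω z - Phi d κ x' z * normalDeriv (us ω) z) ∂σ) :
    MemLp (fun ω => us ω x) 2 P ∧
    Integrable (fun p : Space d × Space d => corIntegrand P κ us x x' p.1 p.2) (σ.prod σ) ∧
    ∫ ω, us ω x * conj (us ω x') ∂P = ∫ z, ∫ z', corIntegrand P κ us x x' z z' ∂σ ∂σ := by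
  have hw := (memLp_kernel_mul hl hDir).sub (memLp_kernel_mul hk hNeu)
  have hw' := (memLp_kernel_mul hl' hDir).sub (memLp_kernel_mul hk' hNeu)
  have hae := ae_integral_layer_mul_conj hNeu hDir (Phi d κ x) (dPhi d κ x) (Phi d κ x')
    (dPhi d κ x')
  have hint : Integrable (fun p : Space d × Space d => corIntegrand P κ us x x' p.1 p.2)
      (σ.prod σ) := (integrable_mul_conj hw hw').integral_prod_right.congr hae
  refine ⟨(memLp_integral hw).ae_eq (hx.mono fun ω h => h.symm), hint, ?_⟩
  rw [← integral_prod _ hint]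
  refine Eq.trans ?_ ((expectation_integral_mul_conj hw hw').trans (integral_congr_ae hae))
  refine integral_congr_ae ?_
  filter_upwards [hx, hx'] with ω h h'
  rw [h, h']
  rfl

end Statistics

/-! ### Flux through spheres and shells -/

section Flux

variable {d : ℕ}

/-- Integration in polar coordinates. -/
lemma integral_eq_integral_polar (hd : 0 < d) {f : Space d → ℂ} (hf : Integrable f) :
    ∫ z, f z = ∫ r in Ioi (0 : ℝ), ∫ s : sphere (0 : Space d) 1,
      (r ^ (d - 1)) • f (r • (s : Space d)) ∂(volume : Measure (Space d)).toSphere := by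
  have : Nonempty (Fin d) := ⟨⟨0, hd⟩⟩
  -- Polar coordinates carry Lebesgue measure on the punctured space to the product of the sphere
  -- measure and r^(d-1) dr; the removed origin is a null set.
  have mp := (volume : Measure (Space d)).measurePreserving_homeomorphUnitSphereProd
  have hemb := (homeomorphUnitSphereProd (Space d)).measurableEmbedding
  have hsm : ∀ p : sphere (0 : Space d) 1 × Ioi (0 : ℝ),
      f ((p.2 : ℝ) • (p.1 : Space d)) = f ((homeomorphUnitSphereProd (Space d)).symm p) := by
    intro p; simp
  have h1 : Integrable (fun p : sphere (0 : Space d) 1 × Ioi (0 : ℝ) =>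
      f ((p.2 : ℝ) • (p.1 : Space d)))
      ((volume : Measure (Space d)).toSphere.prod (.volumeIoiPow (d - 1))) := by
    have := mp.integrable_comp_emb hemb (g := fun p => f ((p.2 : ℝ) • (p.1 : Space d)))
    rw [finrank_euclideanSpace_fin] at this
    rw [← this]
    have h2 : IntegrableOn f {0}ᶜ := hf.integrableOn
    rw [integrableOn_iff_comap_subtypeVal (by measurability)] at h2
    refine h2.congr (Eventually.of_forall fun z => ?_)
    simp only [Function.comp, hsm, Homeomorph.symm_apply_apply]
  calc ∫ z, f z = ∫ z : ({(0)}ᶜ : Set (Space d)), f z.1 ∂(Measure.comap Subtype.val volume) := by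
        rw [integral_subtype_comap (measurableSet_singleton _).compl f, restrict_compl_singleton]
    _ = ∫ p : sphere (0 : Space d) 1 × Ioi (0 : ℝ), f ((p.2 : ℝ) • (p.1 : Space d))
          ∂((volume : Measure (Space d)).toSphere.prod (.volumeIoiPow (d - 1))) := by
        have := mp.integral_comp hemb (fun p => f ((p.2 : ℝ) • (p.1 : Space d)))
        rw [finrank_euclideanSpace_fin] at this
        rw [← this]
        simp only [hsm, Homeomorph.symm_apply_apply]
    _ = ∫ r : Ioi (0 : ℝ), ∫ s, f ((r : ℝ) • (s : Space d))
          ∂(volume : Measure (Space d)).toSphere ∂(.volumeIoiPow (d - 1)) :=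
        integral_prod_symm _ h1
    _ = _ := by
      simp only [Measure.volumeIoiPow, ENNReal.ofReal]
      rw [integral_withDensity_eq_integral_smul, integral_subtype_comap measurableSet_Ioi
        fun a : ℝ => Real.toNNReal (a ^ (d - 1)) • ∫ s : sphere (0 : Space d) 1,
          f (a • (s : Space d)) ∂(volume : Measure (Space d)).toSphere]
      · refine setIntegral_congr_fun measurableSet_Ioi fun r hr => ?_
        rw [integral_smul, NNReal.smul_def, Real.coe_toNNReal _ (pow_nonneg (le_of_lt hr) _)]
      · exact (measurable_subtype_coe.pow_const _).real_toNNReal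

/-- The flux of a vector field, encoded by the functionals `X z`, through the sphere of radius `r`
around `c`. -/
noncomputable def flux (X : Space d → Space d →L[ℝ] ℂ) (c : Space d) (r : ℝ) : ℂ :=
  ∫ s : sphere (0 : Space d) 1, (r ^ (d - 1)) • X (c + r • (s : Space d)) s
    ∂(volume : Measure (Space d)).toSphere

/-- The derivative of the smooth transition function. -/
noncomputable def bump (t : ℝ) : ℝ := deriv Real.smoothTransition t

lemma bump_continuous : Continuous bump :=
  (Real.smoothTransition.contDiff (n := 1)).continuous_deriv le_rfl

lemma hasDerivAt_smoothTransition (t : ℝ) : HasDerivAt Real.smoothTransition (bump t) t :=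
  ((Real.smoothTransition.contDiff (n := 1)).differentiable one_ne_zero t).hasDerivAt

lemma bump_of_neg {t : ℝ} (ht : t < 0) : bump t = 0 := by
  have : Real.smoothTransition =ᶠ[𝓝 t] fun _ => 0 := by
    filter_upwards [Iio_mem_nhds ht] with s hs
    exact Real.smoothTransition.zero_of_nonpos (le_of_lt hs)
  rw [bump, this.deriv_eq, deriv_const]

lemma bump_of_one_lt {t : ℝ} (ht : 1 < t) : bump t = 0 := by
  have : Real.smoothTransition =ᶠ[𝓝 t] fun _ => 1 := by
    filter_upwards [Ioi_mem_nhds ht] with s hs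
    exact Real.smoothTransition.one_of_one_le (le_of_lt hs)
  rw [bump, this.deriv_eq, deriv_const]

/-- Unit mass makes the rescaled bumps an approximate identity in the radial variable. -/
lemma integral_bump : ∫ t in Icc (0 : ℝ) 1, bump t = 1 := by
  rw [integral_Icc_eq_integral_Ioc, ← intervalIntegral.integral_of_le zero_le_one,
    intervalIntegral.integral_eq_sub_of_hasDerivAt (fun t _ => hasDerivAt_smoothTransition t)
      (bump_continuous.intervalIntegrable _ _)]
  simp

/-- A radial step of width `ε` across the sphere of radius `r` around `c`. -/
noncomputable def step (ε : ℝ) (c : Space d) (r : ℝ) (z : Space d) : ℝ :=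
  Real.smoothTransition ((‖z - c‖ - r) / ε)

lemma step_of_le {ε : ℝ} (hε : 0 < ε) {c : Space d} {r : ℝ} {z : Space d} (h : ‖z - c‖ ≤ r) :
    step ε c r z = 0 :=
  Real.smoothTransition.zero_of_nonpos (div_nonpos_of_nonpos_of_nonneg (by linarith) hε.le)

lemma step_of_ge {ε : ℝ} (hε : 0 < ε) {c : Space d} {r : ℝ} {z : Space d} (h : r + ε ≤ ‖z - c‖) :
    step ε c r z = 1 :=
  Real.smoothTransition.one_of_one_le (by rw [one_le_div hε]; linarith)

/-- The norm is not smooth at the centre, but since r > 0 the step vanishes identically there. -/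
lemma step_contDiff {ε : ℝ} (hε : 0 < ε) (c : Space d) {r : ℝ} (hr : 0 < r) :
    ContDiff ℝ 1 (step ε c r) := by
  rw [contDiff_iff_contDiffAt]
  intro z
  by_cases hz : z = c
  · have : step ε c r =ᶠ[𝓝 z] fun _ => 0 := by
      filter_upwards [ball_mem_nhds z hr] with y hy
      rw [hz, mem_ball, dist_eq_norm] at hy
      exact step_of_le hε hy.le
    exact contDiffAt_const.congr_of_eventuallyEq this
  · refine Real.smoothTransition.contDiffAt.comp z ?_
    exact (((contDiffAt_norm ℝ (sub_ne_zero.2 hz)).comp z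
      (contDiffAt_id.sub contDiffAt_const)).sub contDiffAt_const).div_const _

/-- At the centre both sides are zero; elsewhere this is the chain rule with the radial unit vector
as gradient of the norm. -/
lemma fderiv_step {ε : ℝ} (hε : 0 < ε) (c : Space d) {r : ℝ} (hr : 0 < r) (z h : Space d) :
    fderiv ℝ (step ε c r) z h =
      ε⁻¹ * bump ((‖z - c‖ - r) / ε) * inner ℝ (‖z - c‖⁻¹ • (z - c)) h := by
  by_cases hz : z = c
  · have : step ε c r =ᶠ[𝓝 z] fun _ => 0 := by
      filter_upwards [ball_mem_nhds z hr] with y hy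
      rw [hz, mem_ball, dist_eq_norm] at hy
      exact step_of_le hε hy.le
    rw [this.fderiv_eq, hz]
    simp
  · have h0 : z - c ≠ 0 := sub_ne_zero.2 hz
    have h1 : HasFDerivAt (fun y : Space d => ‖y - c‖)
        (‖z - c‖⁻¹ • innerSL ℝ (z - c)) z := by
      have h2 := (((hasFDerivAt_id (𝕜 := ℝ) z).sub_const c).norm_sq).sqrt
        (by simpa using h0)
      simp only [id, Real.sqrt_sq (norm_nonneg _)] at h2
      refine h2.congr_fderiv ?_
      ext h
      simp
      field_simp
    have h3 := (hasDerivAt_smoothTransition ((‖z - c‖ - r) / ε)).comp_hasFDerivAt z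
      ((h1.sub_const r).mul_const ε⁻¹)
    have h4 : HasFDerivAt (step ε c r) _ z := h3
    rw [h4.fderiv]
    simp [inner_smul_left, inner_sub_left]
    ring

lemma isCompact_shell (c : Space d) (a b : ℝ) : IsCompact {z | a ≤ ‖z - c‖ ∧ ‖z - c‖ ≤ b} := by
  refine (isCompact_closedBall c b).of_isClosed_subset ?_ fun z hz => by
    simpa [dist_eq_norm] using hz.2
  have h : Continuous fun z : Space d => ‖z - c‖ := by fun_prop
  exact (isClosed_le continuous_const h).inter (isClosed_le h continuous_const)

lemma flux_continuousOn {X : Space d → Space d →L[ℝ] ℂ} {c : Space d} {a b : ℝ} (ha : 0 ≤ a)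
    (hX : ContinuousOn X {z | a ≤ ‖z - c‖ ∧ ‖z - c‖ ≤ b}) :
    ContinuousOn (flux X c) (Icc a b) := by
  refine continuousOn_integral_of_compact_support isCompact_univ ?_ (by simp)
  have h1 : ContinuousOn (fun p : ℝ × sphere (0 : Space d) 1 => X (c + p.1 • (p.2 : Space d)))
      (Icc a b ×ˢ univ) := by
    refine hX.comp (Continuous.continuousOn (by fun_prop)) fun p hp => ?_
    have : ‖c + p.1 • (p.2 : Space d) - c‖ = p.1 := by
      simp [norm_smul, abs_of_nonneg (ha.trans hp.1.1)]
    rw [mem_ofPred_eq, this]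
    exact hp.1
  have h2 : Continuous fun p : ℝ × sphere (0 : Space d) 1 => p.1 ^ (d - 1) := by fun_prop
  have h3 : Continuous fun p : ℝ × sphere (0 : Space d) 1 => (p.2 : Space d) := by fun_prop
  exact h2.continuousOn.smul (h1.clm_apply h3.continuousOn)

/-- A radial integrand concentrated in a shell of width `ε`. -/
noncomputable def shellIntegrand (X : Space d → Space d →L[ℝ] ℂ) (c : Space d) (r ε : ℝ)
    (z : Space d) : ℂ :=
  (ε⁻¹ * bump ((‖z - c‖ - r) / ε)) • X z (‖z - c‖⁻¹ • (z - c))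

/-- The bump vanishes outside [0, 1], so for ε ≤ η the integrand lives in the compact shell where X
is continuous; values of X elsewhere do not matter. -/
lemma integrable_shellIntegrand {X : Space d → Space d →L[ℝ] ℂ} {c : Space d} {r η ε : ℝ}
    (hr : 0 < r) (hX : ContinuousOn X {z | r ≤ ‖z - c‖ ∧ ‖z - c‖ ≤ r + η}) (hε : 0 < ε)
    (hεη : ε ≤ η) : Integrable (shellIntegrand X c r ε) := by
  have hcont : ContinuousOn (shellIntegrand X c r ε) {z | r ≤ ‖z - c‖ ∧ ‖z - c‖ ≤ r + η} := by
    have h1 : Continuous fun z : Space d => ‖z - c‖ := by fun_prop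
    have h2 : Continuous fun z : Space d => ε⁻¹ * bump ((‖z - c‖ - r) / ε) :=
      continuous_const.mul (bump_continuous.comp (by fun_prop))
    have h3 : Continuous fun z : Space d => z - c := by fun_prop
    exact h2.continuousOn.smul (hX.clm_apply ((h1.continuousOn.inv₀
      fun z hz => (hr.trans_le hz.1).ne').smul h3.continuousOn))
  refine (integrableOn_iff_integrable_of_support_subset ?_).1
    (hcont.integrableOn_compact (isCompact_shell c r (r + η)))
  intro z hz
  by_contra hn
  refine hz ?_
  have : bump ((‖z - c‖ - r) / ε) = 0 := by
    rw [mem_ofPred_eq, not_and_or, not_le, not_le] at hn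
    rcases hn with h | h
    · exact bump_of_neg (div_neg_of_neg_of_pos (by linarith) hε)
    · exact bump_of_one_lt (by rw [one_lt_div hε]; linarith)
  simp [shellIntegrand, this]

lemma integral_shellIntegrand (hd : 0 < d) {X : Space d → Space d →L[ℝ] ℂ} {c : Space d}
    {r η ε : ℝ} (hr : 0 < r) (hX : ContinuousOn X {z | r ≤ ‖z - c‖ ∧ ‖z - c‖ ≤ r + η})
    (hε : 0 < ε) (hεη : ε ≤ η) :
    ∫ z, shellIntegrand X c r ε z = ∫ t in Icc (0 : ℝ) 1, bump t • flux X c (r + ε * t) := by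
  have hint := integrable_shellIntegrand hr hX hε hεη
  rw [← integral_add_left_eq_self _ c, integral_eq_integral_polar hd (hint.comp_add_left c)]
  have h1 : ∀ ρ ∈ Ioi (0 : ℝ), ∫ s : sphere (0 : Space d) 1,
      (ρ ^ (d - 1)) • shellIntegrand X c r ε (c + ρ • (s : Space d))
        ∂(volume : Measure (Space d)).toSphere =
      (ε⁻¹ * bump ((ρ - r) / ε)) • flux X c ρ := by
    intro ρ hρ
    rw [flux, ← integral_smul]
    refine integral_congr_ae (Eventually.of_forall fun s => ?_)
    have h2 : ‖ρ • (s : Space d)‖ = ρ := by simp [norm_smul, abs_of_pos hρ.out]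
    simp only [shellIntegrand, add_sub_cancel_left, h2, smul_smul, inv_mul_cancel₀ hρ.out.ne',
      one_smul]
    rw [mul_comm]
  -- Since r > 0, the bump vanishes for ρ ≤ 0, so the radial integral may be taken over the whole
  -- line and translated. The substitution ρ = r + εt then absorbs the factor ε⁻¹.
  rw [setIntegral_congr_fun measurableSet_Ioi h1,
    setIntegral_eq_integral_of_forall_compl_eq_zero, ← integral_add_left_eq_self _ r]
  · have h3 := Measure.integral_comp_mul_left
      (fun y : ℝ => (ε⁻¹ * bump ((r + y - r) / ε)) • flux X c (r + y)) ε
    rw [abs_of_pos (inv_pos.2 hε), eq_inv_smul_iff₀ hε.ne'] at h3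
    rw [← h3, ← integral_smul, setIntegral_eq_integral_of_forall_compl_eq_zero]
    · refine integral_congr_ae (Eventually.of_forall fun t => ?_)
      simp only [smul_smul, add_sub_cancel_left, mul_div_cancel_left₀ _ hε.ne']
      rw [← mul_assoc, mul_inv_cancel₀ hε.ne', one_mul]
    · intro t ht
      rw [mem_Icc, not_and_or, not_le, not_le] at ht
      rcases ht with h | h
      · rw [bump_of_neg h, zero_smul]
      · rw [bump_of_one_lt h, zero_smul]
  · intro ρ hρ
    rw [mem_Ioi, not_lt] at hρ
    rw [bump_of_neg (div_neg_of_neg_of_pos (by linarith) hε), mul_zero, zero_smul]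

/-- The shell integral averages the flux over radii in [r, r + ε] with weight of mass one, and the
flux is continuous from the right at r. This replaces a surface integral by volume integrals. -/
lemma tendsto_integral_shellIntegrand (hd : 0 < d) {X : Space d → Space d →L[ℝ] ℂ} {c : Space d}
    {r η : ℝ} (hr : 0 < r) (hη : 0 < η)
    (hX : ContinuousOn X {z | r ≤ ‖z - c‖ ∧ ‖z - c‖ ≤ r + η}) :
    Tendsto (fun ε => ∫ z, shellIntegrand X c r ε z) (𝓝[>] 0) (𝓝 (flux X c r)) := by
  have hfl := flux_continuousOn hr.le hX
  obtain ⟨M, hM⟩ := isCompact_Icc.exists_bound_of_continuousOn hfl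
  have hev : ∀ᶠ ε in 𝓝[>] (0 : ℝ), 0 < ε ∧ ε ≤ η := by
    filter_upwards [Ioc_mem_nhdsGT hη] with ε hε using hε
  have hmem : ∀ ε t : ℝ, 0 < ε ∧ ε ≤ η → t ∈ Icc (0 : ℝ) 1 → r + ε * t ∈ Icc r (r + η) := by
    intro ε t hε ht
    constructor <;> nlinarith [ht.1, ht.2, hε.1, hε.2]
  have hlim : Tendsto (fun ε => ∫ t in Icc (0 : ℝ) 1, bump t • flux X c (r + ε * t)) (𝓝[>] 0)
      (𝓝 (∫ t in Icc (0 : ℝ) 1, bump t • flux X c r)) := by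
    refine tendsto_integral_filter_of_dominated_convergence (fun t => |bump t| * M) ?_ ?_ ?_ ?_
    · filter_upwards [hev] with ε hε
      refine ContinuousOn.aestronglyMeasurable ?_ measurableSet_Icc
      exact bump_continuous.continuousOn.smul (hfl.comp (Continuous.continuousOn (by fun_prop))
        fun t ht => hmem ε t hε ht)
    · filter_upwards [hev] with ε hε
      filter_upwards [ae_restrict_mem measurableSet_Icc] with t ht
      rw [norm_smul, Real.norm_eq_abs]
      exact mul_le_mul_of_nonneg_left (hM _ (hmem ε t hε ht)) (abs_nonneg _)
    · exact Continuous.integrableOn_Icc (bump_continuous.abs.mul continuous_const)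
    · filter_upwards [ae_restrict_mem measurableSet_Icc] with t ht
      refine Tendsto.const_smul ?_ _
      refine (hfl r ⟨le_rfl, by linarith⟩).tendsto.comp ?_
      refine tendsto_nhdsWithin_iff.2 ⟨?_, hev.mono fun ε hε => hmem ε t hε ht⟩
      have : Tendsto (fun ε : ℝ => r + ε * t) (𝓝 0) (𝓝 (r + 0 * t)) :=
        Continuous.tendsto (by fun_prop) 0
      simpa using this.mono_left nhdsWithin_le_nhds
  rw [integral_smul_const, integral_bump, one_smul] at hlim
  refine hlim.congr' (hev.mono fun ε hε => ?_)
  exact (integral_shellIntegrand hd hr hX hε.1 hε.2).symm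

end Flux

/-! ### Divergence-free fields and Green's field -/

section DivergenceFree

variable {d : ℕ}

/-- The `j`-th standard basis vector. -/
noncomputable abbrev stdVec (j : Fin d) : Space d := EuclideanSpace.basisFun (Fin d) ℝ j

lemma sum_inner_smul_apply (L : Space d →L[ℝ] ℂ) (y : Space d) :
    ∑ j, (inner ℝ y (stdVec j) : ℝ) • L (stdVec j) = L y := by
  conv_rhs => rw [← (EuclideanSpace.basisFun (Fin d) ℝ).sum_repr' y]
  rw [map_sum]
  refine Finset.sum_congr rfl fun j _ => ?_
  rw [map_smul, real_inner_comm]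

/-- A vector field of class `C¹` whose divergence vanishes. -/
structure DivFreeOn (X : Space d → Space d →L[ℝ] ℂ) (U : Set (Space d)) : Prop where
  contDiffOn : ContDiffOn ℝ 1 X U
  div_eq_zero : ∀ z ∈ U, ∑ j, fderiv ℝ X z (stdVec j) (stdVec j) = 0

lemma integrable_smul_of_tsupport_subset {θ : Space d → ℝ} {f : Space d → ℂ} {U : Set (Space d)}
    (hθ : Continuous θ) (hc : HasCompactSupport θ) (hs : tsupport θ ⊆ U)
    (hf : ContinuousOn f U) : Integrable fun z => θ z • f z := by
  refine (integrableOn_iff_integrable_of_support_subset ?_).1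
    ((hθ.continuousOn.smul (hf.mono hs)).integrableOn_compact hc)
  intro z hz
  by_contra hn
  refine hz ?_
  simp [image_eq_zero_of_notMem_tsupport hn]

/-- Weak form of div X = 0: integrating by parts gives -∫ θ div X. The compact support of θ inside U
removes boundary terms and the behaviour of X outside U. -/
lemma integral_fderiv_smul_divFree {U : Set (Space d)} (hU : IsOpen U)
    {X : Space d → Space d →L[ℝ] ℂ} (hX : DivFreeOn X U) {θ : Space d → ℝ}
    (hθ : ContDiff ℝ 1 θ) (hc : HasCompactSupport θ) (hs : tsupport θ ⊆ U) :
    ∫ z, ∑ j, fderiv ℝ θ z (stdVec j) • X z (stdVec j) = 0 := by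
  have hXc : ∀ j, ContinuousOn (fun z => X z (stdVec j)) U := fun j =>
    hX.contDiffOn.continuousOn.clm_apply continuousOn_const
  have hX'c : ∀ j, ContinuousOn (fun z => fderiv ℝ X z (stdVec j) (stdVec j)) U := fun j =>
    ((hX.contDiffOn.continuousOn_fderiv_of_isOpen hU le_rfl).clm_apply
      continuousOn_const).clm_apply continuousOn_const
  have hθ' : ∀ j, Continuous fun z => fderiv ℝ θ z (stdVec j) := fun j =>
    (hθ.continuous_fderiv one_ne_zero).clm_apply continuous_const
  have hθ'c : ∀ j, HasCompactSupport fun z => fderiv ℝ θ z (stdVec j) := fun j =>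
    hc.fderiv_apply ℝ (stdVec j)
  have hθ's : ∀ j, tsupport (fun z => fderiv ℝ θ z (stdVec j)) ⊆ U := fun j =>
    (tsupport_fderiv_apply_subset ℝ (stdVec j)).trans hs
  have h1 : ∀ j, Integrable fun z => fderiv ℝ θ z (stdVec j) • X z (stdVec j) := fun j =>
    integrable_smul_of_tsupport_subset (hθ' j) (hθ'c j) (hθ's j) (hXc j)
  have h2 : ∀ j, Integrable fun z => θ z • fderiv ℝ X z (stdVec j) (stdVec j) := fun j =>
    integrable_smul_of_tsupport_subset hθ.continuous hc hs (hX'c j)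
  have h3 : ∀ j, Integrable fun z => θ z • X z (stdVec j) := fun j =>
    integrable_smul_of_tsupport_subset hθ.continuous hc hs (hXc j)
  have key : ∀ j, ∫ z, fderiv ℝ θ z (stdVec j) • X z (stdVec j) =
      -∫ z, θ z • fderiv ℝ X z (stdVec j) (stdVec j) := fun j =>
    integral_bilinear_hasFDerivAt_right_eq_neg_left_of_integrable (μ := volume)
      (f := fun z => X z (stdVec j))
      (f' := fun z => (ContinuousLinearMap.apply ℝ ℂ (stdVec j)).comp (fderiv ℝ X z))
      (g := θ) (g' := fun z => fderiv ℝ θ z) (v := stdVec j)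
      (B := (ContinuousLinearMap.lsmul ℝ ℝ : ℝ →L[ℝ] ℂ →L[ℝ] ℂ).flip) (h2 j) (h1 j) (h3 j)
      (fun z hz => by
        have hd := (hX.contDiffOn.contDiffAt (hU.mem_nhds (hs hz))).differentiableAt one_ne_zero
        exact (ContinuousLinearMap.apply ℝ ℂ (stdVec j)).hasFDerivAt.comp z hd.hasFDerivAt)
      (fun z _ => (hθ.differentiable one_ne_zero z).hasFDerivAt)
  rw [integral_finsetSum _ fun j _ => h1 j, Finset.sum_congr rfl fun j _ => key j,
    Finset.sum_neg_distrib, ← integral_finsetSum _ fun j _ => h2 j, neg_eq_zero]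
  refine integral_eq_zero_of_ae (Eventually.of_forall fun z => ?_)
  simp only [← Finset.smul_sum, Pi.zero_apply]
  by_cases hz : z ∈ tsupport θ
  · rw [hX.div_eq_zero z (hs hz), smul_zero]
  · rw [image_eq_zero_of_notMem_tsupport hz, zero_smul]

/-- A vanishing linear combination of fluxes of a divergence free field, for a family of spheres
whose steps combine to functions supported in the domain of the field. -/
lemma sum_flux_eq_zero (hd : 0 < d) {U : Set (Space d)} (hU : IsOpen U)
    {X : Space d → Space d →L[ℝ] ℂ} (hX : DivFreeOn X U) {ι : Type*} [Fintype ι] (b : ℝ)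
    (a : ι → ℝ) (c : ι → Space d) (r : ι → ℝ) {η : ℝ} (hη : 0 < η) (hr : ∀ i, 0 < r i)
    (hshell : ∀ i, {z | r i ≤ ‖z - c i‖ ∧ ‖z - c i‖ ≤ r i + η} ⊆ U)
    {K : Set (Space d)} (hK : IsCompact K) (hKU : K ⊆ U)
    (hsupp : ∀ ε, 0 < ε → ε ≤ η → ∀ z ∉ K, b + ∑ i, a i * step ε (c i) (r i) z = 0) :
    ∑ i, a i • flux X (c i) (r i) = 0 := by
  have hXc : ∀ i, ContinuousOn X {z | r i ≤ ‖z - c i‖ ∧ ‖z - c i‖ ≤ r i + η} := fun i =>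
    hX.contDiffOn.continuousOn.mono (hshell i)
  have hlim : Tendsto (fun ε => ∑ i, a i • ∫ z, shellIntegrand X (c i) (r i) ε z) (𝓝[>] 0)
      (𝓝 (∑ i, a i • flux X (c i) (r i))) :=
    tendsto_finsetSum _ fun i _ =>
      (tendsto_integral_shellIntegrand hd (hr i) hη (hXc i)).const_smul (a i)
  -- For every small ε the sum of shell integrals equals ∫ ∇θ · X with θ the combination of steps.
  -- This is zero, hence so is the limit of fluxes.
  refine tendsto_nhds_unique hlim (tendsto_const_nhds.congr' ?_)
  filter_upwards [Ioc_mem_nhdsGT hη] with ε hε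
  have hint : ∀ i, Integrable (shellIntegrand X (c i) (r i) ε) := fun i =>
    integrable_shellIntegrand (hr i) (hXc i) hε.1 hε.2
  set θ : Space d → ℝ := fun z => b + ∑ i, a i * step ε (c i) (r i) z with hθdef
  have hstep : ∀ i, ContDiff ℝ 1 (step ε (c i) (r i)) := fun i => step_contDiff hε.1 _ (hr i)
  have hθ : ContDiff ℝ 1 θ :=
    contDiff_const.add (ContDiff.sum fun i _ => contDiff_const.mul (hstep i))
  have hsub : tsupport θ ⊆ K := by
    refine closure_minimal (fun z hz => ?_) hK.isClosed
    by_contra hn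
    exact hz (hsupp ε hε.1 hε.2 z hn)
  have hc : HasCompactSupport θ := hK.of_isClosed_subset (isClosed_tsupport _) hsub
  have h0 := integral_fderiv_smul_divFree hU hX hθ hc (hsub.trans hKU)
  rw [← h0]
  have hfd : ∀ z h, fderiv ℝ θ z h = ∑ i, a i * fderiv ℝ (step ε (c i) (r i)) z h := by
    intro z h
    have h1 : HasFDerivAt θ (∑ i, a i • fderiv ℝ (step ε (c i) (r i)) z) z := by
      refine HasFDerivAt.const_add b (HasFDerivAt.fun_sum fun i _ => ?_)
      exact ((hstep i).differentiable one_ne_zero z).hasFDerivAt.const_mul (a i)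
    rw [h1.fderiv]
    simp
  simp_rw [hfd, ← integral_smul]
  refine Eq.trans ?_ (integral_finsetSum _ fun i _ => (hint i).smul (a i))
  refine integral_congr_ae (Eventually.of_forall fun z => ?_)
  simp only [Finset.sum_smul]
  rw [Finset.sum_comm]
  refine Finset.sum_congr rfl fun i _ => ?_
  rw [shellIntegrand, ← sum_inner_smul_apply (X z), Finset.smul_sum, Finset.smul_sum]
  refine Finset.sum_congr rfl fun j _ => ?_
  rw [fderiv_step hε.1 _ (hr i), smul_smul, smul_smul]
  congr 1
  ring

/-- The flux of a divergence free field through concentric spheres is constant. -/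
lemma flux_eq_flux (hd : 0 < d) {U : Set (Space d)} (hU : IsOpen U)
    {X : Space d → Space d →L[ℝ] ℂ} (hX : DivFreeOn X U) {c : Space d} {r₁ r₂ : ℝ}
    (hr₁ : 0 < r₁) (hr : r₁ ≤ r₂) (hshell : {z | r₁ ≤ ‖z - c‖} ⊆ U) :
    flux X c r₁ = flux X c r₂ := by
  -- The difference of the two steps vanishes inside the inner sphere and beyond the outer
  -- transition layer, so it is compactly supported in the shell.
  have h := sum_flux_eq_zero hd hU hX 0 ![1, -1] (fun _ => c) ![r₁, r₂] one_pos
    (by simp [Fin.forall_fin_two, hr₁, hr₁.trans_le hr])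
    (by
      simp only [Fin.forall_fin_two]
      exact ⟨fun z hz => hshell hz.1, fun z hz => hshell (hr.trans hz.1)⟩)
    (isCompact_shell c r₁ (r₂ + 1)) (fun z hz => hshell hz.1)
    (by
      intro ε hε hε1 z hz
      rw [mem_ofPred_eq, not_and_or, not_le, not_le] at hz
      rcases hz with h | h
      · simp [Fin.sum_univ_two, step_of_le hε h.le, step_of_le hε (h.le.trans hr)]
      · simp [Fin.sum_univ_two, step_of_ge hε (by linarith : r₁ + ε ≤ ‖z - c‖),
          step_of_ge hε (by linarith : r₂ + ε ≤ ‖z - c‖)])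
  simpa [Fin.sum_univ_two, add_neg_eq_zero] using h

/-- The flux through two spheres around the origin differs by the flux through a small sphere
around a singularity between them. -/
lemma flux_sub_flux_eq (hd : 0 < d) {U : Set (Space d)} (hU : IsOpen U)
    {X : Space d → Space d →L[ℝ] ℂ} {x : Space d} (hX : DivFreeOn X (U \ {x})) {r₁ r₂ δ : ℝ}
    (hr₁ : 0 < r₁) (hδ : 0 < δ) (h₁ : r₁ + 2 * δ ≤ ‖x‖) (h₂ : ‖x‖ + 2 * δ ≤ r₂)
    (hshell : {z | r₁ ≤ ‖z‖} ⊆ U) :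
    flux X 0 r₁ - flux X 0 r₂ + flux X x δ = 0 := by
  set η := δ / 2 with hη
  have hη0 : 0 < η := by positivity
  have hne : ∀ z : Space d, δ ≤ ‖z - x‖ → z ∉ ({x} : Set (Space d)) := by
    rintro z hz rfl
    simp at hz
    linarith
  have htri : ∀ z : Space d, |‖z‖ - ‖x‖| ≤ ‖z - x‖ := fun z => abs_norm_sub_norm_le z x
  have h := sum_flux_eq_zero hd (hU.sdiff isClosed_singleton) hX (-1) ![1, -1, 1] ![0, 0, x]
    ![r₁, r₂, δ] hη0
    (by
      intro i
      fin_cases i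
      · exact hr₁
      · exact (hr₁.trans (by linarith) : 0 < r₂)
      · exact hδ)
    (by
      intro i
      fin_cases i
      · rintro z ⟨hz1, hz2⟩
        simp only [Fin.zero_eta, Matrix.cons_val_zero, sub_zero] at hz1 hz2
        have := neg_le_of_abs_le (htri z)
        exact ⟨hshell hz1, hne z (by linarith)⟩
      · rintro z ⟨hz1, hz2⟩
        simp only [Fin.mk_one, Matrix.cons_val_one, Matrix.cons_val_zero, sub_zero] at hz1 hz2
        have := le_of_abs_le (htri z)
        exact ⟨hshell (by rw [mem_ofPred_eq]; linarith), hne z (by linarith)⟩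
      · rintro z ⟨hz1, hz2⟩
        simp only [Fin.reduceFinMk, Matrix.cons_val] at hz1 hz2
        have := neg_le_of_abs_le (htri z)
        exact ⟨hshell (by rw [mem_ofPred_eq]; linarith), hne z hz1⟩)
    ((isCompact_shell 0 r₁ (r₂ + η)).inter_right
      (isClosed_le continuous_const (by fun_prop) : IsClosed {z : Space d | δ ≤ ‖z - x‖}))
    (by
      rintro z ⟨hz1, hz2⟩
      refine ⟨hshell ?_, hne z hz2⟩
      simpa using hz1.1)
    (by
      intro ε hε hεη z hz
      have hεδ : ε ≤ δ / 2 := hεη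
      have hs : step ε 0 r₁ z - step ε 0 r₂ z + step ε x δ z = 1 := by
        have ha := abs_le.1 (htri z)
        simp only [mem_inter_iff, mem_ofPred_eq, sub_zero, not_and_or, not_le] at hz
        rcases hz with (h | h) | h
        · rw [step_of_le hε (by simpa using h.le), step_of_le hε (by simp; linarith),
            step_of_ge hε (by linarith)]
          ring
        · rw [step_of_ge hε (by simp; linarith), step_of_ge hε (by simp; linarith),
            step_of_ge hε (by linarith)]
          ring
        · rw [step_of_ge hε (by simp; linarith), step_of_le hε (by simp; linarith),
            step_of_le hε h.le]
          ring
      simp only [Fin.sum_univ_three, Matrix.cons_val]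
      linarith)
  simp only [Fin.sum_univ_three, Matrix.cons_val] at h
  simpa [sub_eq_add_neg] using h

/-- Classical solutions of the Helmholtz equation, with the Laplacian written as the trace of the
second derivative. -/
structure HelmholtzOn (κ : ℝ) (u : Space d → ℂ) (U : Set (Space d)) : Prop where
  contDiffOn : ContDiffOn ℝ 2 u U
  trace_eq : ∀ z ∈ U, ∑ j, fderiv ℝ (fderiv ℝ u) z (stdVec j) (stdVec j) = -(κ : ℂ) ^ 2 * u z

lemma HelmholtzOn.mono {κ : ℝ} {u : Space d → ℂ} {U V : Set (Space d)} (h : HelmholtzOn κ u U)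
    (hVU : V ⊆ U) : HelmholtzOn κ u V :=
  ⟨h.contDiffOn.mono hVU, fun z hz => h.trace_eq z (hVU hz)⟩

/-- The vector field of Green's second identity. -/
noncomputable def greenField (u v : Space d → ℂ) (z : Space d) : Space d →L[ℝ] ℂ :=
  u z • fderiv ℝ v z - v z • fderiv ℝ u z

/-- The divergence is u Δv - v Δu: the products of first derivatives cancel, and the remainder
vanishes because both functions have the same wavenumber. -/
lemma divFreeOn_greenField {κ : ℝ} {u v : Space d → ℂ} {U : Set (Space d)} (hU : IsOpen U)
    (hu : HelmholtzOn κ u U) (hv : HelmholtzOn κ v U) : DivFreeOn (greenField u v) U := by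
  have hu' : ContDiffOn ℝ 1 (fderiv ℝ u) U := hu.contDiffOn.fderiv_of_isOpen hU (by norm_num)
  have hv' : ContDiffOn ℝ 1 (fderiv ℝ v) U := hv.contDiffOn.fderiv_of_isOpen hU (by norm_num)
  have hu1 : ContDiffOn ℝ 1 u U := hu.contDiffOn.of_le (by norm_num)
  have hv1 : ContDiffOn ℝ 1 v U := hv.contDiffOn.of_le (by norm_num)
  refine ⟨(hu1.smul hv').sub (hv1.smul hu'), fun z hz => ?_⟩
  have diff : ∀ {F : Type} [NormedAddCommGroup F] [NormedSpace ℝ F] {f : Space d → F},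
      ContDiffOn ℝ 1 f U → HasFDerivAt f (fderiv ℝ f z) z := fun hf =>
    ((hf.contDiffAt (hU.mem_nhds hz)).differentiableAt one_ne_zero).hasFDerivAt
  have h := ((diff hu1).smul (diff hv')).sub ((diff hv1).smul (diff hu'))
  have h' : HasFDerivAt (greenField u v) _ z := h
  rw [h'.fderiv]
  have e : ∀ j : Fin d, (u z • fderiv ℝ (fderiv ℝ v) z +
      (fderiv ℝ u z).smulRight (fderiv ℝ v z) - (v z • fderiv ℝ (fderiv ℝ u) z +
      (fderiv ℝ v z).smulRight (fderiv ℝ u z))) (stdVec j) (stdVec j) =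
      u z * fderiv ℝ (fderiv ℝ v) z (stdVec j) (stdVec j) -
      v z * fderiv ℝ (fderiv ℝ u) z (stdVec j) (stdVec j) := by
    intro j
    simp
    ring
  rw [Finset.sum_congr rfl fun j _ => e j, Finset.sum_sub_distrib, ← Finset.mul_sum,
    ← Finset.mul_sum, hu.trace_eq z hz, hv.trace_eq z hz]
  ring

end DivergenceFree

/-! ### The radiation condition -/

section Radiation

variable {d : ℕ}

/-- The Sommerfeld radiation condition. -/
def Radiating (κ : ℝ) (u : Space d → ℂ) : Prop :=
  Tendsto (fun x : Space d => (((‖x‖ ^ (((d : ℝ) - 1) / 2) : ℝ)) : ℂ) *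
    (normalDeriv u x - Complex.I * κ * u x)) (cobounded (Space d)) (𝓝 0)

lemma tendsto_smul_sphere_cobounded : Tendsto
    (fun p : ℝ × sphere (0 : Space d) 1 => p.1 • (p.2 : Space d)) (atTop ×ˢ ⊤)
    (cobounded (Space d)) := by
  rw [← tendsto_norm_atTop_iff_cobounded]
  have h : Tendsto (fun p : ℝ × sphere (0 : Space d) 1 => |p.1|) (atTop ×ˢ ⊤) atTop :=
    tendsto_abs_atTop_atTop.comp tendsto_fst
  refine h.congr fun p => ?_
  simp [norm_smul]

/-- The filter `⊤` on the sphere factor makes the conclusion uniform in the direction: one threshold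
for r serves all s. -/
lemma eventually_forall_sphere {p : Space d → Prop} (h : ∀ᶠ z in cobounded (Space d), p z) :
    ∀ᶠ r : ℝ in atTop, ∀ s : sphere (0 : Space d) 1, p (r • (s : Space d)) := by
  have h1 := tendsto_smul_sphere_cobounded.eventually h
  rw [eventually_prod_iff] at h1
  obtain ⟨pa, hpa, pb, hpb, hab⟩ := h1
  filter_upwards [hpa] with r hr s
  exact hab hr (by simpa using eventually_top.1 hpb s)

lemma normalDeriv_smul_sphere (f : Space d → ℂ) {r : ℝ} (hr : 0 < r)
    (s : sphere (0 : Space d) 1) :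
    normalDeriv f (r • (s : Space d)) = fderiv ℝ f (r • (s : Space d)) s := by
  have : ‖r • (s : Space d)‖ = r := by simp [norm_smul, abs_of_pos hr]
  rw [normalDeriv, this, smul_smul, inv_mul_cancel₀ hr.ne', one_smul]

lemma flux_greenField_eq (u v : Space d → ℂ) {r : ℝ} (hr : 0 < r) :
    flux (greenField u v) 0 r = ∫ s : sphere (0 : Space d) 1, (r ^ (d - 1)) •
      (u (r • (s : Space d)) * normalDeriv v (r • (s : Space d)) -
        v (r • (s : Space d)) * normalDeriv u (r • (s : Space d)))
      ∂(volume : Measure (Space d)).toSphere := by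
  simp only [flux, zero_add, greenField, normalDeriv_smul_sphere _ hr]
  rfl

lemma continuous_comp_smul_sphere {F : Type*} [TopologicalSpace F] {f : Space d → F}
    {U : Set (Space d)} (hf : ContinuousOn f U) {r : ℝ} (hr : {z : Space d | ‖z‖ = r} ⊆ U)
    (hr0 : 0 < r) : Continuous fun s : sphere (0 : Space d) 1 => f (r • (s : Space d)) := by
  refine hf.comp_continuous (by fun_prop) fun s => hr ?_
  simp [norm_smul, abs_of_pos hr0]

lemma continuous_normalDeriv_sphere {u : Space d → ℂ} {U : Set (Space d)} (hU : IsOpen U)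
    (hu : ContDiffOn ℝ 2 u U) {r : ℝ} (hr : {z : Space d | ‖z‖ = r} ⊆ U) (hr0 : 0 < r) :
    Continuous fun s : sphere (0 : Space d) 1 => normalDeriv u (r • (s : Space d)) := by
  simp only [normalDeriv_smul_sphere _ hr0]
  exact (continuous_comp_smul_sphere (hu.continuousOn_fderiv_of_isOpen hU (by norm_num)) hr
    hr0).clm_apply continuous_subtype_val

/-- The squared Sommerfeld weight is the surface factor of the flux. Positivity of d makes the
natural subtraction agree with the real one. -/
lemma rpow_half_sq (hd : 0 < d) {r : ℝ} (hr : 0 < r) :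
    (r ^ (((d : ℝ) - 1) / 2)) ^ 2 = r ^ (d - 1) := by
  rw [← Real.rpow_natCast, ← Real.rpow_mul hr.le, ← Real.rpow_natCast, Nat.cast_sub hd]
  congr 1
  push_cast
  ring

lemma continuous_integrable_sphere {F : Type*} [NormedAddCommGroup F]
    {f : sphere (0 : Space d) 1 → F} (hf : Continuous f) :
    Integrable f (volume : Measure (Space d)).toSphere :=
  hf.integrable_of_hasCompactSupport (HasCompactSupport.of_compactSpace f)

lemma fderiv_conj {u : Space d → ℂ} (z : Space d) :
    fderiv ℝ (fun y => conj (u y)) z =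
      (Complex.conjCLE : ℂ →L[ℝ] ℂ).comp (fderiv ℝ u z) :=
  Complex.conjCLE.comp_fderiv

/-- Conjugation commutes with real derivatives, and κ² is real. -/
lemma HelmholtzOn.conj {κ : ℝ} {u : Space d → ℂ} {U : Set (Space d)} (hU : IsOpen U)
    (hu : HelmholtzOn κ u U) : HelmholtzOn κ (fun z => conj (u z)) U := by
  refine ⟨Complex.conjCLE.contDiff.comp_contDiffOn hu.contDiffOn, fun z hz => ?_⟩
  have hu' : ContDiffOn ℝ 1 (fderiv ℝ u) U := hu.contDiffOn.fderiv_of_isOpen hU (by norm_num)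
  have h1 := ((hu'.contDiffAt (hU.mem_nhds hz)).differentiableAt one_ne_zero).hasFDerivAt
  have h2 : HasFDerivAt (fderiv ℝ fun y => conj (u y))
      ((ContinuousLinearMap.compL ℝ (Space d) ℂ ℂ (Complex.conjCLE : ℂ →L[ℝ] ℂ)).comp
        (fderiv ℝ (fderiv ℝ u) z)) z := by
    rw [funext fun y => fderiv_conj (u := u) y]
    exact (ContinuousLinearMap.compL ℝ (Space d) ℂ ℂ
      (Complex.conjCLE : ℂ →L[ℝ] ℂ)).hasFDerivAt.comp z h1
  rw [h2.fderiv]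
  have h3 := congrArg conj (hu.trace_eq z hz)
  rw [map_sum] at h3
  simpa using h3

/-- A radiating solution is bounded in mean square over large spheres. -/
lemma exists_sphere_mean_square_bound (hd : 0 < d) {κ : ℝ} (hκ : 0 < κ) {u : Space d → ℂ}
    {U : Set (Space d)} (hU : IsOpen U) (hu : HelmholtzOn κ u U) {R : ℝ} (hR : 0 < R)
    (hRU : {z | R ≤ ‖z‖} ⊆ U) (hrad : Radiating κ u) :
    ∃ M : ℝ, ∀ᶠ r : ℝ in atTop, ∫ s : sphere (0 : Space d) 1,
      r ^ (d - 1) * ‖u (r • (s : Space d))‖ ^ 2 ∂(volume : Measure (Space d)).toSphere ≤ M := by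
  set σ := (volume : Measure (Space d)).toSphere
  set Λ := flux (greenField u fun z => conj (u z)) 0 R with hΛ
  -- The flux Λ is the same on every larger sphere. For large r the radiation condition gives
  -- r^(d-1) |∂u - iκu|² ≤ 1; in the expanded square the cross term integrates to κ Im Λ, and
  -- dropping |∂u|² leaves a bound for κ² times the mean square.
  refine ⟨(σ.real univ - κ * Λ.im) / κ ^ 2, ?_⟩
  have hev : ∀ᶠ z in cobounded (Space d), ‖(((‖z‖ ^ (((d : ℝ) - 1) / 2) : ℝ)) : ℂ) *
      (normalDeriv u z - Complex.I * κ * u z)‖ < 1 := by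
    have := hrad.norm
    rw [norm_zero] at this
    exact this.eventually (gt_mem_nhds one_pos)
  filter_upwards [eventually_forall_sphere hev, eventually_ge_atTop R] with r hr1 hrR
  have hr0 : 0 < r := hR.trans_le hrR
  have hrU : {z : Space d | ‖z‖ = r} ⊆ U := fun z hz => hRU (by rw [mem_ofPred_eq, hz]; exact hrR)
  have hcu := continuous_comp_smul_sphere hu.contDiffOn.continuousOn hrU hr0
  have hcn := continuous_normalDeriv_sphere hU hu.contDiffOn hrU hr0
  have hfl : Λ = flux (greenField u fun z => conj (u z)) 0 r :=
    flux_eq_flux hd hU (divFreeOn_greenField hU hu (hu.conj hU)) hR hrR (by simpa using hRU)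
  have hnc : ∀ z, normalDeriv (fun z => conj (u z)) z = conj (normalDeriv u z) := fun z => by
    simp [normalDeriv, fderiv_conj]
  rw [flux_greenField_eq _ _ hr0] at hfl
  simp only [hnc] at hfl
  have him : Λ.im = ∫ s : sphere (0 : Space d) 1, r ^ (d - 1) *
      (-2 * (normalDeriv u (r • (s : Space d)) * conj (u (r • (s : Space d)))).im) ∂σ := by
    rw [hfl]
    refine (integral_im (𝕜 := ℂ) (continuous_integrable_sphere ?_)).symm.trans ?_
    · exact ((hcu.mul hcn.star).sub (hcu.star.mul hcn)).const_smul (r ^ (d - 1))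
    · refine integral_congr_ae (Eventually.of_forall fun s => ?_)
      simp only [RCLike.im_to_complex]
      rw [Complex.real_smul, Complex.im_ofReal_mul]
      simp
      ring
  rw [le_div_iff₀ (by positivity), le_sub_iff_add_le, him, ← integral_mul_const,
    ← integral_const_mul, ← integral_add]
  · calc _ ≤ ∫ s : sphere (0 : Space d) 1, (1 : ℝ) ∂σ := by
          refine integral_mono (continuous_integrable_sphere ?_) (integrable_const _) fun s => ?_
          · exact ((continuous_const.mul (hcu.norm.pow 2)).mul continuous_const).add
              (continuous_const.mul (continuous_const.mul (continuous_const.mul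
                (Complex.continuous_im.comp (hcn.mul hcu.star)))))
          · have h1 := hr1 s
            set p := normalDeriv u (r • (s : Space d))
            set w := u (r • (s : Space d))
            rw [show ‖r • (s : Space d)‖ = r by simp [norm_smul, abs_of_pos hr0], norm_mul,
              Complex.norm_real, Real.norm_eq_abs, abs_of_pos (Real.rpow_pos_of_pos hr0 _)] at h1
            have h2 : (r ^ (((d : ℝ) - 1) / 2) * ‖p - Complex.I * κ * w‖) ^ 2 ≤ 1 :=
              pow_le_one₀ (by positivity) h1.le
            rw [mul_pow, rpow_half_sq hd hr0] at h2
            have h3 : ‖p - Complex.I * κ * w‖ ^ 2 =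
                ‖p‖ ^ 2 + κ ^ 2 * ‖w‖ ^ 2 - 2 * κ * (p * conj w).im := by
              simp only [← Complex.normSq_eq_norm_sq, Complex.normSq_apply]
              simp
              ring
            rw [h3] at h2
            have h4 : 0 ≤ r ^ (d - 1) * ‖p‖ ^ 2 := by positivity
            simp only
            linarith
    _ = σ.real univ := by simp
  · exact continuous_integrable_sphere ((continuous_const.mul (hcu.norm.pow 2)).mul continuous_const)
  · exact continuous_integrable_sphere (continuous_const.mul (continuous_const.mul
      (continuous_const.mul (Complex.continuous_im.comp (hcn.mul hcu.star)))))

/-- The Green flux of two radiating solutions vanishes at infinity. -/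
lemma tendsto_flux_greenField_radiating (hd : 0 < d) {κ : ℝ} (hκ : 0 < κ) {u v : Space d → ℂ}
    {U : Set (Space d)} (hU : IsOpen U) (hu : HelmholtzOn κ u U) (hv : HelmholtzOn κ v U) {R : ℝ}
    (hR : 0 < R) (hRU : {z | R ≤ ‖z‖} ⊆ U) (hradu : Radiating κ u) (hradv : Radiating κ v) :
    Tendsto (fun r => flux (greenField u v) 0 r) atTop (𝓝 0) := by
  set σ := (volume : Measure (Space d)).toSphere
  obtain ⟨M, hM⟩ := exists_sphere_mean_square_bound hd hκ hU hu hR hRU hradu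
  obtain ⟨N, hN⟩ := exists_sphere_mean_square_bound hd hκ hU hv hR hRU hradv
  rw [Metric.tendsto_nhds]
  intro ε hε
  -- The summand 1 makes the final estimate (ε/B)(|M| + |N| + 2σ(univ)) strictly smaller than ε.
  set B := |M| + |N| + 2 * σ.real univ + 1
  have hB : 0 < B := by positivity
  have hev : ∀ {w : Space d → ℂ}, Radiating κ w → ∀ᶠ z in cobounded (Space d),
      ‖(((‖z‖ ^ (((d : ℝ) - 1) / 2) : ℝ)) : ℂ) *
        (normalDeriv w z - Complex.I * κ * w z)‖ < ε / B := fun hw => by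
    have := hw.norm
    rw [norm_zero] at this
    exact this.eventually (gt_mem_nhds (by positivity))
  filter_upwards [eventually_forall_sphere (hev hradu), eventually_forall_sphere (hev hradv), hM,
    hN, eventually_ge_atTop R] with r hru hrv hMr hNr hrR
  have hr0 : 0 < r := hR.trans_le hrR
  have hrU : {z : Space d | ‖z‖ = r} ⊆ U := fun z hz => hRU (by rw [mem_ofPred_eq, hz]; exact hrR)
  have hcu := continuous_comp_smul_sphere hu.contDiffOn.continuousOn hrU hr0
  have hcv := continuous_comp_smul_sphere hv.contDiffOn.continuousOn hrU hr0
  have hiu : Integrable (fun s : sphere (0 : Space d) 1 =>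
      r ^ (d - 1) * ‖u (r • (s : Space d))‖ ^ 2) σ :=
    continuous_integrable_sphere (continuous_const.mul (hcu.norm.pow 2))
  have hiv : Integrable (fun s : sphere (0 : Space d) 1 =>
      r ^ (d - 1) * ‖v (r • (s : Space d))‖ ^ 2) σ :=
    continuous_integrable_sphere (continuous_const.mul (hcv.norm.pow 2))
  have hiuv : Integrable (fun s : sphere (0 : Space d) 1 =>
      r ^ (d - 1) * ‖u (r • (s : Space d))‖ ^ 2 +
        r ^ (d - 1) * ‖v (r • (s : Space d))‖ ^ 2) σ := hiu.add hiv
  have hbi : Integrable (fun s : sphere (0 : Space d) 1 => ε / B *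
      (r ^ (d - 1) * ‖u (r • (s : Space d))‖ ^ 2 +
      r ^ (d - 1) * ‖v (r • (s : Space d))‖ ^ 2 + 2)) σ :=
    (hiuv.add (integrable_const _)).const_mul _
  rw [dist_zero_right, flux_greenField_eq _ _ hr0]
  refine (norm_integral_le_of_norm_le hbi (Eventually.of_forall fun s => ?_)).trans_lt ?_
  · have h1 := (hru s).le
    have h2 := (hrv s).le
    set p := normalDeriv u (r • (s : Space d))
    set w := u (r • (s : Space d))
    set q := normalDeriv v (r • (s : Space d))
    set y := v (r • (s : Space d))
    rw [show ‖r • (s : Space d)‖ = r by simp [norm_smul, abs_of_pos hr0], norm_mul,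
      Complex.norm_real, Real.norm_eq_abs, abs_of_pos (Real.rpow_pos_of_pos hr0 _)] at h1 h2
    have hsq := rpow_half_sq hd hr0
    have ht0 : 0 < r ^ (((d : ℝ) - 1) / 2) := Real.rpow_pos_of_pos hr0 _
    set t := r ^ (((d : ℝ) - 1) / 2)
    rw [← hsq, norm_smul, Real.norm_eq_abs, abs_of_nonneg (by positivity)]
    -- The terms iκwy cancel, so every product retains a factor that is small by a radiation
    -- condition.
    have h3 : w * q - y * p =
        w * (q - Complex.I * κ * y) - y * (p - Complex.I * κ * w) := by ring
    rw [h3]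
    calc t ^ 2 * ‖w * (q - Complex.I * κ * y) - y * (p - Complex.I * κ * w)‖
        ≤ t ^ 2 * (‖w‖ * ‖q - Complex.I * κ * y‖ + ‖y‖ * ‖p - Complex.I * κ * w‖) := by
          gcongr
          refine (norm_sub_le _ _).trans_eq ?_
          rw [norm_mul, norm_mul]
      _ = (t * ‖w‖) * (t * ‖q - Complex.I * κ * y‖) +
          (t * ‖y‖) * (t * ‖p - Complex.I * κ * w‖) := by ring
      _ ≤ (t * ‖w‖) * (ε / B) + (t * ‖y‖) * (ε / B) := by gcongr
      _ = ε / B * (t * ‖w‖ + t * ‖y‖) := by ring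
      _ ≤ ε / B * (t ^ 2 * ‖w‖ ^ 2 + t ^ 2 * ‖y‖ ^ 2 + 2) := by
          refine mul_le_mul_of_nonneg_left ?_ (by positivity)
          -- The bound a ≤ a² + 1 trades the moduli for the mean squares, which are under control.
          nlinarith [sq_nonneg (t * ‖w‖ - 1), sq_nonneg (t * ‖y‖ - 1)]
  · have hsum : ∫ s : sphere (0 : Space d) 1, ε / B * (r ^ (d - 1) * ‖u (r • (s : Space d))‖ ^ 2 +
        r ^ (d - 1) * ‖v (r • (s : Space d))‖ ^ 2 + 2) ∂σ ≤
        ε / B * (|M| + |N| + 2 * σ.real univ) := by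
      rw [integral_const_mul, integral_add hiuv (integrable_const _),
        integral_add hiu hiv, integral_const, smul_eq_mul, mul_comm _ (2 : ℝ)]
      gcongr
      · exact hMr.trans (le_abs_self _)
      · exact hNr.trans (le_abs_self _)
    refine hsum.trans_lt ?_
    rw [div_mul_eq_mul_div, div_lt_iff₀ hB]
    gcongr
    simp [B]

end Radiation

/-! ### Exterior representation -/

section Representation

variable {d : ℕ}

/-- `ψ`, with derivative `ψ'`, is the radial profile of an outgoing fundamental solution of the
Helmholtz equation in dimension `d`. -/
structure IsOutgoingProfile (d : ℕ) (κ : ℝ) (ψ ψ' : ℝ → ℂ) : Prop where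
  hasDerivAt : ∀ ρ : ℝ, 0 < ρ → HasDerivAt ψ (ψ' ρ) ρ
  ode : ∀ ρ : ℝ, 0 < ρ →
    HasDerivAt ψ' (-(((d : ℂ) - 1) / ρ * ψ' ρ) - (κ : ℂ) ^ 2 * ψ ρ) ρ
  tendsto_zero : Tendsto (fun ρ : ℝ => (ρ ^ (d - 1)) • ψ ρ) (𝓝[>] 0) (𝓝 0)
  tendsto_deriv_zero : Tendsto (fun ρ : ℝ => (ρ ^ (d - 1)) • ψ' ρ) (𝓝[>] 0)
    (𝓝 (-((volume : Measure (Space d)).toSphere.real univ : ℂ)⁻¹))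
  bounded : ∃ C : ℝ, ∀ᶠ ρ : ℝ in atTop, ρ ^ (((d : ℝ) - 1) / 2) * ‖ψ ρ‖ ≤ C
  radiating : Tendsto (fun ρ : ℝ => ρ ^ (((d : ℝ) - 1) / 2) * ‖ψ' ρ - Complex.I * κ * ψ ρ‖)
    atTop (𝓝 0)

variable {κ : ℝ} {ψ ψ' : ℝ → ℂ}

lemma hasFDerivAt_norm_sub {x z : Space d} (hz : z ≠ x) :
    HasFDerivAt (fun y : Space d => ‖x - y‖) (‖x - z‖⁻¹ • innerSL ℝ (z - x)) z := by
  have h0 : x - z ≠ 0 := sub_ne_zero.2 hz.symm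
  have h2 := (((hasFDerivAt_id (𝕜 := ℝ) z).const_sub x).norm_sq).sqrt (by simpa using h0)
  simp only [id, Real.sqrt_sq (norm_nonneg _)] at h2
  refine h2.congr_fderiv ?_
  ext h
  simp only [smul_apply, ContinuousLinearMap.comp_apply, innerSL_apply_apply,
    neg_apply, ContinuousLinearMap.id_apply, inner_sub_left, inner_neg_right,
    smul_eq_mul]
  simp
  field_simp

namespace IsOutgoingProfile

lemma hasFDerivAt_radial (hψ : IsOutgoingProfile d κ ψ ψ') {x z : Space d} (hz : z ≠ x) :
    HasFDerivAt (fun y : Space d => ψ ‖x - y‖)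
      ((innerSL ℝ (z - x)).smulRight ((‖x - z‖⁻¹ : ℝ) • ψ' ‖x - z‖)) z := by
  have h0 : 0 < ‖x - z‖ := norm_pos_iff.2 (sub_ne_zero.2 hz.symm)
  have h := (hψ.hasDerivAt _ h0).hasFDerivAt.comp z (hasFDerivAt_norm_sub hz)
  refine h.congr_fderiv ?_
  ext h
  simp
  ring

/-- The Hessian of a radial function is (ψ'/ρ) Id + q (z - x) ⊗ (z - x) with q = (ψ'/ρ)'/ρ. Only qρ²
enters the trace, and the radial equation evaluates it. -/
lemma hasFDerivAt_fderiv_radial (hψ : IsOutgoingProfile d κ ψ ψ') {x z : Space d} (hz : z ≠ x) :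
    ∃ q : ℂ, q * (‖x - z‖ : ℂ) ^ 2 =
        -((d : ℂ) / ‖x - z‖ * ψ' ‖x - z‖) - (κ : ℂ) ^ 2 * ψ ‖x - z‖ ∧
      ∀ h k, fderiv ℝ (fderiv ℝ fun y : Space d => ψ ‖x - y‖) z h k =
        (inner ℝ h k : ℝ) • ((‖x - z‖⁻¹ : ℝ) • ψ' ‖x - z‖) +
          (inner ℝ (z - x) h * inner ℝ (z - x) k : ℝ) • q := by
  have h0 : 0 < ‖x - z‖ := norm_pos_iff.2 (sub_ne_zero.2 hz.symm)
  have h0' : (‖x - z‖ : ℂ) ≠ 0 := by exact_mod_cast h0.ne'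
  set ρ := ‖x - z‖ with hρ
  have hev : fderiv ℝ (fun y : Space d => ψ ‖x - y‖) =ᶠ[𝓝 z]
      fun y => (innerSL ℝ (y - x)).smulRight ((‖x - y‖⁻¹ : ℝ) • ψ' ‖x - y‖) := by
    filter_upwards [isOpen_ne.mem_nhds hz] with y hy
    exact (hψ.hasFDerivAt_radial hy).fderiv
  have hq : HasDerivAt (fun t : ℝ => (t⁻¹ : ℝ) • ψ' t)
      ((ρ⁻¹ : ℝ) • (-(((d : ℂ) - 1) / ρ * ψ' ρ) - (κ : ℂ) ^ 2 * ψ ρ) +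
        (-(ρ ^ 2)⁻¹ : ℝ) • ψ' ρ) ρ := (hasDerivAt_inv h0.ne').smul (hψ.ode ρ h0)
  set q' := ((ρ⁻¹ : ℝ) • (-(((d : ℂ) - 1) / ρ * ψ' ρ) - (κ : ℂ) ^ 2 * ψ ρ) +
        (-(ρ ^ 2)⁻¹ : ℝ) • ψ' ρ) with hq'
  refine ⟨(ρ⁻¹ : ℝ) • q', ?_, fun h k => ?_⟩
  · rw [hq']
    simp only [Complex.real_smul]
    push_cast
    field_simp
    ring
  · have h1 := hq.hasFDerivAt.comp z (hasFDerivAt_norm_sub hz)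
    have h2 : HasFDerivAt (fun y : Space d => innerSL ℝ (y - x)) (innerSL ℝ) z := by
      have h3 := (innerSL ℝ : Space d →L[ℝ] Space d →L[ℝ] ℝ).hasFDerivAt (x := z - x)
      exact h3.comp z ((hasFDerivAt_id z).sub_const x)
    have h4 := (ContinuousLinearMap.smulRightL ℝ (Space d) ℂ).hasFDerivAt_of_bilinear h2 h1
    have h5 : HasFDerivAt (fun y => (innerSL ℝ (y - x)).smulRight
      ((‖x - y‖⁻¹ : ℝ) • ψ' ‖x - y‖)) _ z := h4
    rw [hev.fderiv_eq, h5.fderiv]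
    have h6 : (innerSL ℝ : Space d →L[ℝ] Space d →L[ℝ] ℝ) h k = inner ℝ h k := rfl
    simp [← hρ, -map_sub]
    rw [h6]
    ring

/-- Bootstrap: the radial equation expresses the derivative of ψ' through continuous functions. -/
lemma contDiffOn (hψ : IsOutgoingProfile d κ ψ ψ') : ContDiffOn ℝ 2 ψ (Ioi 0) := by
  have hd : EqOn (deriv ψ) ψ' (Ioi 0) := fun ρ hρ => (hψ.hasDerivAt ρ hρ).deriv
  have hdiff : DifferentiableOn ℝ ψ (Ioi 0) := fun ρ hρ =>
    (hψ.hasDerivAt ρ hρ).differentiableAt.differentiableWithinAt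
  have hdiff' : DifferentiableOn ℝ ψ' (Ioi 0) := fun ρ hρ =>
    (hψ.ode ρ hρ).differentiableAt.differentiableWithinAt
  have hd' : EqOn (deriv ψ') (fun ρ => -(((d : ℂ) - 1) / ρ * ψ' ρ) - (κ : ℂ) ^ 2 * ψ ρ) (Ioi 0) :=
    fun ρ hρ => (hψ.ode ρ hρ).deriv
  have h1 : ContDiffOn ℝ 1 ψ' (Ioi 0) := by
    rw [show (1 : WithTop ℕ∞) = 0 + 1 by norm_num, contDiffOn_succ_iff_deriv_of_isOpen isOpen_Ioi]
    refine ⟨hdiff', by simp, ContDiffOn.congr ?_ hd'⟩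
    rw [contDiffOn_zero]
    refine ContinuousOn.sub (ContinuousOn.neg (ContinuousOn.mul (ContinuousOn.div
      continuousOn_const Complex.continuous_ofReal.continuousOn ?_) hdiff'.continuousOn))
      (continuousOn_const.mul hdiff.continuousOn)
    intro ρ hρ
    exact_mod_cast (ne_of_gt hρ)
  rw [show (2 : WithTop ℕ∞) = 1 + 1 by norm_num, contDiffOn_succ_iff_deriv_of_isOpen isOpen_Ioi]
  exact ⟨hdiff, by simp, h1.congr hd⟩

lemma helmholtzOn_radial (hψ : IsOutgoingProfile d κ ψ ψ') (x : Space d) :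
    HelmholtzOn κ (fun y : Space d => ψ ‖x - y‖) {x}ᶜ := by
  refine ⟨?_, fun z hz => ?_⟩
  · refine hψ.contDiffOn.comp (t := Ioi 0) (fun y hy => ContDiffAt.contDiffWithinAt ?_)
      fun y hy => norm_pos_iff.2 (sub_ne_zero.2 (Ne.symm hy))
    exact (contDiffAt_norm ℝ (sub_ne_zero.2 (Ne.symm hy))).comp y
      (contDiffAt_const.sub contDiffAt_id)
  · obtain ⟨q, hq, hh⟩ := hψ.hasFDerivAt_fderiv_radial hz
    have h0 : (‖x - z‖ : ℂ) ≠ 0 := by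
      exact_mod_cast (norm_pos_iff.2 (sub_ne_zero.2 (Ne.symm hz))).ne'
    simp only [hh, Finset.sum_add_distrib, ← Finset.sum_smul]
    have h1 : ∑ j : Fin d, inner ℝ (z - x) (stdVec j) * inner ℝ (z - x) (stdVec j) =
        ‖x - z‖ ^ 2 := by
      rw [norm_sub_rev, ← (EuclideanSpace.basisFun (Fin d) ℝ).sum_sq_norm_inner_left (z - x)]
      refine Finset.sum_congr rfl fun j _ => ?_
      rw [Real.norm_eq_abs, sq_abs, sq]
    have h2 : ∑ j : Fin d, inner ℝ (stdVec j : Space d) (stdVec j) = (d : ℝ) := by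
      simp
    rw [h1, h2]
    simp only [Complex.real_smul]
    push_cast
    linear_combination hq

/-- The profile radiates along rays from x, whereas `Radiating` differentiates along rays from the
origin. The directions differ by O(1/‖z‖), and the resulting error multiplies a bounded weighted ψ.
-/
lemma radiating_radial (hd : 0 < d) (hψ : IsOutgoingProfile d κ ψ ψ') (x : Space d) :
    Radiating κ (fun y : Space d => ψ ‖x - y‖) := by
  obtain ⟨C, hC⟩ := hψ.bounded
  set α := ((d : ℝ) - 1) / 2 with hα
  have hα0 : 0 ≤ α := by
    have : (1 : ℝ) ≤ d := by exact_mod_cast hd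
    rw [hα]; linarith
  have hρ : Tendsto (fun z : Space d => ‖x - z‖) (cobounded (Space d)) atTop := by
    refine tendsto_atTop_mono (f := fun z => ‖z‖ - ‖x‖) (fun z => ?_)
      (tendsto_atTop_add_const_right _ _ tendsto_norm_cobounded_atTop)
    rw [norm_sub_rev]
    exact norm_sub_norm_le z x
  have hlim : Tendsto (fun z : Space d => 2 ^ α * (‖x - z‖ ^ α *
      ‖ψ' ‖x - z‖ - Complex.I * κ * ψ ‖x - z‖‖) +
      2 ^ α * |κ| * |C| * (2 * ‖x‖ * ‖z‖⁻¹)) (cobounded (Space d)) (𝓝 0) := by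
    have h1 := (hψ.radiating.comp hρ).const_mul (2 ^ α)
    have h2 := ((tendsto_inv_atTop_zero.comp
      (tendsto_norm_cobounded_atTop (E := Space d))).const_mul (2 * ‖x‖)).const_mul
      (2 ^ α * |κ| * |C|)
    simpa using h1.add h2
  refine squeeze_zero_norm' ?_ hlim
  filter_upwards [hρ.eventually hC, tendsto_norm_cobounded_atTop.eventually_ge_atTop (2 * ‖x‖ + 1)]
    with z hzC hz
  have hz0 : 0 < ‖z‖ := by linarith [norm_nonneg x]
  have hzx : z ≠ x := by
    rintro rfl
    linarith [norm_nonneg z]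
  have hρ0 : 0 < ‖x - z‖ := norm_pos_iff.2 (sub_ne_zero.2 hzx.symm)
  -- c is the cosine of the angle between z and z - x; it converts the derivative ψ' into the
  -- derivative along z.
  set c : ℝ := ‖x - z‖⁻¹ * (‖z‖⁻¹ * inner ℝ (z - x) z) with hc
  have hnd : normalDeriv (fun y : Space d => ψ ‖x - y‖) z = c * ψ' ‖x - z‖ := by
    rw [normalDeriv, (hψ.hasFDerivAt_radial hzx).fderiv]
    simp [hc, inner_sub_left]
    ring
  have hzρ : ‖z‖ ≤ 2 * ‖x - z‖ := by
    have := norm_sub_norm_le z x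
    rw [norm_sub_rev] at this
    linarith
  have hc1 : |c| ≤ 1 := by
    have := abs_real_inner_le_norm (z - x) z
    rw [hc, abs_mul, abs_mul, abs_of_pos (inv_pos.2 hρ0), abs_of_pos (inv_pos.2 hz0),
      inv_mul_le_iff₀ hρ0, inv_mul_le_iff₀ hz0, mul_one, mul_comm, norm_sub_rev x z]
    linarith
  have hc2 : |c - 1| ≤ 2 * ‖x‖ * ‖z‖⁻¹ := by
    have h1 : inner ℝ (z - x) z = ‖x - z‖ ^ 2 + inner ℝ (z - x) x := by
      rw [norm_sub_rev, ← real_inner_self_eq_norm_sq, ← inner_add_right, sub_add_cancel]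
    have h2 := abs_real_inner_le_norm (z - x) x
    rw [norm_sub_rev] at h2
    have h3 : |‖x - z‖ - ‖z‖| ≤ ‖x‖ := by
      have := abs_norm_sub_norm_le (z - x) z
      rw [norm_sub_rev z x] at this
      simpa using this
    have h4 : c - 1 = ‖x - z‖⁻¹ * ‖z‖⁻¹ *
        (‖x - z‖ * (‖x - z‖ - ‖z‖) + inner ℝ (z - x) x) := by
      rw [hc, h1]
      field_simp
      ring
    rw [h4, abs_mul, abs_of_pos (by positivity : 0 < ‖x - z‖⁻¹ * ‖z‖⁻¹)]
    calc _ ≤ ‖x - z‖⁻¹ * ‖z‖⁻¹ * (‖x - z‖ * ‖x‖ + ‖x - z‖ * ‖x‖) := by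
          gcongr
          refine (abs_add_le _ _).trans (add_le_add ?_ h2)
          rw [abs_mul, abs_of_pos hρ0]
          gcongr
      _ = 2 * ‖x‖ * ‖z‖⁻¹ := by
          field_simp
          ring
  have hpow : ‖z‖ ^ α ≤ 2 ^ α * ‖x - z‖ ^ α := by
    rw [← Real.mul_rpow (by norm_num) hρ0.le]
    exact Real.rpow_le_rpow hz0.le hzρ hα0
  rw [hnd, norm_mul, Complex.norm_real, Real.norm_eq_abs,
    abs_of_nonneg (Real.rpow_nonneg hz0.le _)]
  have hsplit : (c : ℂ) * ψ' ‖x - z‖ - Complex.I * κ * ψ ‖x - z‖ =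
      c * (ψ' ‖x - z‖ - Complex.I * κ * ψ ‖x - z‖) +
        ((c - 1 : ℝ) : ℂ) * (Complex.I * κ * ψ ‖x - z‖) := by
    push_cast
    ring
  have hnorm : ‖(c : ℂ) * ψ' ‖x - z‖ - Complex.I * κ * ψ ‖x - z‖‖ ≤
      ‖ψ' ‖x - z‖ - Complex.I * κ * ψ ‖x - z‖‖ + 2 * ‖x‖ * ‖z‖⁻¹ * (|κ| * ‖ψ ‖x - z‖‖) := by
    rw [hsplit]
    refine (norm_add_le _ _).trans (add_le_add ?_ ?_)
    · rw [norm_mul, Complex.norm_real, Real.norm_eq_abs]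
      exact mul_le_of_le_one_left (norm_nonneg _) hc1
    · rw [norm_mul, norm_mul, norm_mul, Complex.norm_real, Complex.norm_real, Complex.norm_I,
        one_mul, Real.norm_eq_abs, Real.norm_eq_abs]
      gcongr
  calc _ ≤ 2 ^ α * ‖x - z‖ ^ α * (‖ψ' ‖x - z‖ - Complex.I * κ * ψ ‖x - z‖‖ +
        2 * ‖x‖ * ‖z‖⁻¹ * (|κ| * ‖ψ ‖x - z‖‖)) := by gcongr
    _ = 2 ^ α * (‖x - z‖ ^ α * ‖ψ' ‖x - z‖ - Complex.I * κ * ψ ‖x - z‖‖) +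
        2 ^ α * |κ| * (‖x - z‖ ^ α * ‖ψ ‖x - z‖‖) * (2 * ‖x‖ * ‖z‖⁻¹) := by ring
    _ ≤ _ := by
      gcongr
      exact hzC.trans (le_abs_self C)

/-- The Green flux with the fundamental solution through small spheres around the singularity. -/
lemma tendsto_flux_radial (hd : 0 < d) (hψ : IsOutgoingProfile d κ ψ ψ') {u : Space d → ℂ}
    {U : Set (Space d)} (hU : IsOpen U) (hu : ContDiffOn ℝ 2 u U) {x : Space d} (hx : x ∈ U) :
    Tendsto (fun δ => flux (greenField u fun y : Space d => ψ ‖x - y‖) x δ) (𝓝[>] 0)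
      (𝓝 (-u x)) := by
  have hne : Nonempty (Fin d) := ⟨⟨0, hd⟩⟩
  set σ := (volume : Measure (Space d)).toSphere with hσ
  have hω : (σ.real univ : ℂ) ≠ 0 := by
    have : σ ≠ 0 := Measure.toSphere_ne_zero _
    have h2 : σ.real univ ≠ 0 := by simp [measureReal_def, ENNReal.toReal_eq_zero_iff, this]
    exact_mod_cast h2
  obtain ⟨r, hr, hball⟩ := nhds_basis_closedBall.mem_iff.1 (hU.mem_nhds hx)
  have hu' : ContinuousOn (fderiv ℝ u) U := hu.continuousOn_fderiv_of_isOpen hU (by norm_num)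
  obtain ⟨M, hM⟩ := (isCompact_closedBall x r).exists_bound_of_continuousOn
    (hu.continuousOn.mono hball)
  obtain ⟨N, hN⟩ := (isCompact_closedBall x r).exists_bound_of_continuousOn (hu'.mono hball)
  have hmem : ∀ δ : ℝ, 0 < δ → δ ≤ r → ∀ s : sphere (0 : Space d) 1,
      x + δ • (s : Space d) ∈ closedBall x r := by
    intro δ h0 h1 s
    simp [dist_eq_norm, norm_smul, abs_of_pos h0, h1]
  have hsmall : ∀ᶠ δ in 𝓝[>] (0 : ℝ), 0 < δ ∧ δ ≤ r := Ioc_mem_nhdsGT hr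
  have hform : ∀ᶠ δ in 𝓝[>] (0 : ℝ), flux (greenField u fun y : Space d => ψ ‖x - y‖) x δ =
      ∫ s : sphere (0 : Space d) 1, (u (x + δ • (s : Space d)) * ((δ ^ (d - 1)) • ψ' δ) -
        ((δ ^ (d - 1)) • ψ δ) * fderiv ℝ u (x + δ • (s : Space d)) s) ∂σ := by
    filter_upwards [hsmall] with δ hδ
    refine integral_congr_ae (Eventually.of_forall fun s => ?_)
    have hs1 : ‖(s : Space d)‖ = 1 := by simp
    have hs : ‖x - (x + δ • (s : Space d))‖ = δ := by simp [norm_smul, abs_of_pos hδ.1]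
    have hne : x + δ • (s : Space d) ≠ x := by
      intro h
      rw [h, sub_self, norm_zero] at hs
      exact hδ.1.ne hs
    simp only [greenField, (hψ.hasFDerivAt_radial hne).fderiv, hs]
    have : (δ : ℂ) ≠ 0 := by exact_mod_cast hδ.1.ne'
    simp [hs1]
    field_simp
  -- On the sphere of radius δ the surface factor times ψ' tends to minus the reciprocal of the
  -- sphere's area, so the first term averages u and yields -u(x). The second disappears because the
  -- surface factor times ψ tends to zero.
  have key : Tendsto (fun δ : ℝ => ∫ s : sphere (0 : Space d) 1,
      (u (x + δ • (s : Space d)) * ((δ ^ (d - 1)) • ψ' δ) -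
        ((δ ^ (d - 1)) • ψ δ) * fderiv ℝ u (x + δ • (s : Space d)) s) ∂σ) (𝓝[>] 0)
      (𝓝 (∫ _ : sphere (0 : Space d) 1, u x * (-(σ.real univ : ℂ)⁻¹) ∂σ)) := by
    have b1 := hψ.tendsto_zero.norm.eventually (gt_mem_nhds (show ‖(0 : ℂ)‖ < 1 by simp))
    have b2 := hψ.tendsto_deriv_zero.norm.eventually (gt_mem_nhds (lt_add_one _))
    set L := ‖-((volume : Measure (Space d)).toSphere.real univ : ℂ)⁻¹‖ + 1
    refine tendsto_integral_filter_of_dominated_convergence (fun _ => M * L + 1 * N) ?_ ?_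
      (integrable_const _) ?_
    · filter_upwards [hsmall] with δ hδ
      have hc : Continuous fun s : sphere (0 : Space d) 1 => x + δ • (s : Space d) := by fun_prop
      have h1 := (hu.continuousOn.mono hball).comp_continuous hc (hmem δ hδ.1 hδ.2)
      have h2 := (hu'.mono hball).comp_continuous hc (hmem δ hδ.1 hδ.2)
      exact ((h1.mul continuous_const).sub (continuous_const.mul
        (h2.clm_apply continuous_subtype_val))).aestronglyMeasurable
    · filter_upwards [hsmall, b1, b2] with δ hδ h1 h2
      refine Eventually.of_forall fun s => ?_
      have h3 := hM _ (hmem δ hδ.1 hδ.2 s)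
      have h4 : ‖fderiv ℝ u (x + δ • (s : Space d)) s‖ ≤ N := by
        refine (ContinuousLinearMap.le_opNorm _ _).trans ?_
        simpa using hN _ (hmem δ hδ.1 hδ.2 s)
      have hM0 : 0 ≤ M := (norm_nonneg _).trans h3
      refine (norm_sub_le _ _).trans (add_le_add ?_ ?_)
      · rw [norm_mul]
        exact mul_le_mul h3 h2.le (norm_nonneg _) hM0
      · rw [norm_mul]
        exact mul_le_mul h1.le h4 (norm_nonneg _) zero_le_one
    · refine Eventually.of_forall fun s => ?_
      have hpath : Tendsto (fun δ : ℝ => x + δ • (s : Space d)) (𝓝[>] 0) (𝓝 x) := by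
        have : Tendsto (fun δ : ℝ => x + δ • (s : Space d)) (𝓝 0) (𝓝 (x + (0 : ℝ) • s)) :=
          Continuous.tendsto (by fun_prop) 0
        rw [zero_smul, add_zero] at this
        exact this.mono_left nhdsWithin_le_nhds
      have h1 := (hu.continuousOn.continuousAt (hU.mem_nhds hx)).tendsto.comp hpath
      have h2 : Tendsto (fun δ : ℝ => fderiv ℝ u (x + δ • (s : Space d)) s) (𝓝[>] 0)
          (𝓝 (fderiv ℝ u x s)) :=
        ((ContinuousLinearMap.apply ℝ ℂ (s : Space d)).continuous.tendsto _).comp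
          ((hu'.continuousAt (hU.mem_nhds hx)).tendsto.comp hpath)
      have h3 := (h1.mul hψ.tendsto_deriv_zero).sub (hψ.tendsto_zero.mul h2)
      rw [zero_mul, sub_zero] at h3
      exact h3
  rw [integral_const, Complex.real_smul] at key
  have hval : (σ.real univ : ℂ) * (u x * (-(σ.real univ : ℂ)⁻¹)) = -u x := by
    field_simp
  rw [hval] at key
  exact key.congr' (hform.mono fun δ h => h.symm)

/-- Green's representation formula in the exterior of a ball. -/
theorem exterior_representation (hd : 0 < d) (hκ : 0 < κ) (hψ : IsOutgoingProfile d κ ψ ψ')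
    {u : Space d → ℂ} {U : Set (Space d)} (hU : IsOpen U) (hu : HelmholtzOn κ u U) {R : ℝ}
    (hR : 0 < R) (hRU : {z | R ≤ ‖z‖} ⊆ U) (hrad : Radiating κ u) {x : Space d} (hx : R < ‖x‖) :
    u x = flux (greenField u fun y : Space d => ψ ‖x - y‖) 0 R := by
  set X := greenField u fun y : Space d => ψ ‖x - y‖ with hX
  have hv := hψ.helmholtzOn_radial x
  have hdiv : DivFreeOn X (U \ {x}) := divFreeOn_greenField (hU.sdiff isClosed_singleton)
    (hu.mono sdiff_subset) (hv.mono fun z hz => hz.2)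
  -- Starting at radius ‖x‖ + 1 leaves the singularity inside, so both functions solve the equation
  -- on all larger spheres.
  have hinf : Tendsto (fun r => flux X 0 r) atTop (𝓝 0) := by
    refine tendsto_flux_greenField_radiating hd hκ (hU.sdiff isClosed_singleton)
      (hu.mono sdiff_subset) (hv.mono fun z hz => hz.2) (R := ‖x‖ + 1) (by positivity)
      (fun z hz => ⟨hRU (show R ≤ ‖z‖ from ?_), ?_⟩) hrad (hψ.radiating_radial hd x)
    · rw [mem_ofPred_eq] at hz
      linarith
    · rintro rfl
      simp at hz
      linarith
  -- For fixed small δ the flux through large spheres is constant in r and tends to zero, so the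
  -- constant is zero. Only afterwards does δ tend to zero.
  have hcst : ∀ᶠ δ in 𝓝[>] (0 : ℝ), flux X 0 R + flux X x δ = 0 := by
    filter_upwards [Ioc_mem_nhdsGT (show 0 < (‖x‖ - R) / 2 by linarith)] with δ hδ
    have h1 : ∀ᶠ r in atTop, flux X 0 r = flux X 0 R + flux X x δ := by
      filter_upwards [eventually_ge_atTop (‖x‖ + 2 * δ)] with r hr
      have := flux_sub_flux_eq hd hU hdiv hR hδ.1 (by linarith [hδ.2]) hr hRU
      linear_combination -this
    exact tendsto_nhds_unique (tendsto_const_nhds.congr' (h1.mono fun r h => h.symm)) hinf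
  have hlim := (hψ.tendsto_flux_radial hd hU hu.contDiffOn (hRU hx.le)).const_add (flux X 0 R)
  have h0 := tendsto_nhds_unique hlim (tendsto_const_nhds.congr' (hcst.mono fun δ h => h.symm))
  linear_combination -h0

end IsOutgoingProfile

end Representation

/-! ### Bessel functions of order zero -/

section BesselSeries

/-- The coefficients of an everywhere convergent real power series. -/
def IsEntireCoeff (c : ℕ → ℝ) : Prop := ∀ R : ℝ, 0 ≤ R → Summable fun m => |c m| * R ^ m

/-- The sum of a real power series. -/
noncomputable def powSum (c : ℕ → ℝ) (x : ℝ) : ℝ := ∑' m, c m * x ^ m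

/-- The coefficients of the derivative of a power series. -/
def derivCoeff (c : ℕ → ℝ) (m : ℕ) : ℝ := (m + 1) * c (m + 1)

lemma IsEntireCoeff.of_le {c : ℕ → ℝ} (h : ∀ m, |c m| ≤ ((m ! : ℕ) : ℝ)⁻¹) : IsEntireCoeff c := by
  intro R hR
  refine Summable.of_nonneg_of_le (fun m => by positivity) (fun m => ?_)
    (Real.summable_pow_div_factorial R)
  rw [div_eq_inv_mul]
  gcongr
  exact h m

lemma IsEntireCoeff.summable {c : ℕ → ℝ} (hc : IsEntireCoeff c) (x : ℝ) :
    Summable fun m => c m * x ^ m := by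
  refine Summable.of_norm ?_
  simpa [abs_mul, abs_pow] using hc |x| (abs_nonneg x)

lemma IsEntireCoeff.derivCoeff {c : ℕ → ℝ} (hc : IsEntireCoeff c) :
    IsEntireCoeff (derivCoeff c) := by
  intro R hR
  have h := (summable_nat_add_iff 1).2 (hc (2 * (R + 1)) (by positivity))
  refine Summable.of_nonneg_of_le (fun m => by positivity) (fun m => ?_) h
  -- The factor m + 1 produced by differentiation is absorbed by doubling the radius.
  have h1 : ((m : ℝ) + 1) ≤ 2 ^ (m + 1) := by
    exact_mod_cast (Nat.lt_two_pow_self (n := m + 1)).le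
  have h2 : R ^ m ≤ (R + 1) ^ (m + 1) :=
    (pow_le_pow_left₀ hR (by linarith) m).trans (pow_le_pow_right₀ (by linarith) (by omega))
  rw [RandomScattering.derivCoeff, abs_mul, abs_of_nonneg (by positivity : (0 : ℝ) ≤ m + 1),
    mul_pow]
  calc _ = |c (m + 1)| * ((m + 1) * R ^ m) := by ring
    _ ≤ _ := by gcongr

lemma hasDerivAt_powSum {c : ℕ → ℝ} (hc : IsEntireCoeff c) (x : ℝ) :
    HasDerivAt (powSum c) (powSum (derivCoeff c) x) x := by
  have hT : 0 ≤ |x| + 1 := by positivity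
  have hu : Summable fun m : ℕ => |(m : ℝ) * c m| * (|x| + 1) ^ (m - 1) := by
    rw [← summable_nat_add_iff 1]
    simpa [derivCoeff] using hc.derivCoeff (|x| + 1) hT
  have h := hasDerivAt_tsum_of_isPreconnected (g := fun m y => c m * y ^ m)
    (g' := fun (m : ℕ) y => c m * ((m : ℝ) * y ^ (m - 1))) (t := ball 0 (|x| + 1)) (y₀ := 0) (y := x) hu
    isOpen_ball (convex_ball _ _).isPreconnected
    (fun m y _ => (hasDerivAt_pow m y).const_mul (c m))
    (fun m y hy => by
      rw [mem_ball_zero_iff, Real.norm_eq_abs] at hy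
      rw [Real.norm_eq_abs, ← mul_assoc, abs_mul, mul_comm (c m), abs_pow]
      gcongr)
    (mem_ball_self (by positivity)) (hc.summable 0)
    (by rw [mem_ball_zero_iff, Real.norm_eq_abs]; linarith)
  refine h.congr_deriv ?_
  have hs : Summable fun m : ℕ => c m * ((m : ℝ) * x ^ (m - 1)) := by
    refine Summable.of_norm_bounded hu fun m => ?_
    rw [Real.norm_eq_abs, ← mul_assoc, abs_mul, mul_comm (c m), abs_pow]
    gcongr
    linarith
  rw [hs.tsum_eq_zero_add, powSum]
  simp only [CharP.cast_eq_zero, zero_mul, mul_zero, zero_add]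
  refine tsum_congr fun m => ?_
  simp only [derivCoeff, Nat.add_sub_cancel]
  push_cast
  ring

lemma hasSum_of_forall_eq {f g : ℕ → ℝ} {a : ℝ} (h : HasSum f a) (e : ∀ m, f m = g m) :
    HasSum g a :=
  funext e ▸ h

lemma hasSum_mul_powSum_derivCoeff {c : ℕ → ℝ} (hc : IsEntireCoeff c) (x : ℝ) :
    HasSum (fun m : ℕ => (m * c m) * x ^ m) (x * powSum (derivCoeff c) x) := by
  have h1 : HasSum (fun m => x * (derivCoeff c m * x ^ m)) (x * powSum (derivCoeff c) x) :=
    (hc.derivCoeff.summable x).hasSum.mul_left x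
  rw [← hasSum_nat_add_iff' 1]
  simp only [Finset.range_one, Finset.sum_singleton, CharP.cast_eq_zero, zero_mul, sub_zero]
  refine hasSum_of_forall_eq h1 fun m => ?_
  simp only [derivCoeff]
  push_cast
  ring

/-- The coefficients of `J₀` as a power series in `t² / 4`. -/
noncomputable def coeffJ (m : ℕ) : ℝ := (-1) ^ m / ((m ! : ℝ)) ^ 2

/-- The coefficients of the entire part of `Y₀` as a power series in `t² / 4`. -/
noncomputable def coeffY (m : ℕ) : ℝ := (-1) ^ m * ((harmonic m : ℚ) : ℝ) / ((m ! : ℝ)) ^ 2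

/-- One of the two factorials in the coefficients of Y₀ pays for the harmonic number; the other
still gives convergence everywhere. -/
lemma harmonic_le_factorial (m : ℕ) : ((harmonic m : ℚ) : ℝ) ≤ (m ! : ℝ) := by
  have h : ((harmonic m : ℚ) : ℝ) ≤ m := by
    induction m with
    | zero => simp
    | succ n ih =>
      rw [harmonic_succ]
      push_cast
      have : ((n : ℝ) + 1)⁻¹ ≤ 1 := inv_le_one_of_one_le₀ (by linarith [n.cast_nonneg (α := ℝ)])
      linarith
  exact h.trans (by exact_mod_cast Nat.self_le_factorial m)

lemma isEntireCoeff_coeffJ : IsEntireCoeff coeffJ := by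
  refine IsEntireCoeff.of_le fun m => ?_
  have h : (1 : ℝ) ≤ (m ! : ℝ) := by exact_mod_cast m.factorial_pos
  rw [coeffJ, abs_div, abs_pow, abs_neg, abs_one, one_pow, abs_of_nonneg (by positivity), one_div]
  gcongr
  exact le_self_pow₀ h two_ne_zero

lemma isEntireCoeff_coeffY : IsEntireCoeff coeffY := by
  refine IsEntireCoeff.of_le fun m => ?_
  have h : (0 : ℝ) < (m ! : ℝ) := by exact_mod_cast m.factorial_pos
  have h0 : 0 ≤ ((harmonic m : ℚ) : ℝ) := by
    rw [harmonic]
    push_cast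
    positivity
  rw [coeffY, abs_div, abs_mul, abs_pow, abs_neg, abs_one, one_pow, one_mul, abs_of_nonneg h0,
    abs_of_nonneg (by positivity), div_le_iff₀ (by positivity)]
  refine (harmonic_le_factorial m).trans_eq ?_
  field_simp

lemma coeffJ_succ (m : ℕ) : ((m : ℝ) + 1) ^ 2 * coeffJ (m + 1) = -coeffJ m := by
  have h : (m ! : ℝ) ≠ 0 := by exact_mod_cast m.factorial_ne_zero
  have h' : (m : ℝ) + 1 ≠ 0 := by positivity
  rw [coeffJ, coeffJ, Nat.factorial_succ]
  push_cast
  field_simp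
  ring

/-- The increment 1/(m + 1) of the harmonic numbers creates the additional term. -/
lemma coeffY_succ (m : ℕ) :
    ((m : ℝ) + 1) ^ 2 * coeffY (m + 1) = -coeffY m + derivCoeff coeffJ m := by
  have h : (m ! : ℝ) ≠ 0 := by exact_mod_cast m.factorial_ne_zero
  have h' : (m : ℝ) + 1 ≠ 0 := by positivity
  rw [coeffY, coeffY, derivCoeff, coeffJ, Nat.factorial_succ, harmonic_succ]
  push_cast
  field_simp
  ring

/-- In the variable x = t²/4, Bessel's equation of order zero reads x y'' + y' + y = 0; compare
coefficients. -/
lemma powSum_coeffJ_ode (x : ℝ) : x * powSum (derivCoeff (derivCoeff coeffJ)) x +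
    powSum (derivCoeff coeffJ) x = -powSum coeffJ x := by
  have h := isEntireCoeff_coeffJ
  refine ((hasSum_mul_powSum_derivCoeff h.derivCoeff x).add
    (h.derivCoeff.summable x).hasSum).unique ?_
  refine hasSum_of_forall_eq (h.summable x).hasSum.neg fun m => ?_
  have := coeffJ_succ m
  simp only [derivCoeff] at this ⊢
  linear_combination -x ^ m * this

/-- The source term on the right is what the derivatives of log t in (log t) J₀ will cancel. -/
lemma powSum_coeffY_ode (x : ℝ) : x * powSum (derivCoeff (derivCoeff coeffY)) x +
    powSum (derivCoeff coeffY) x = -powSum coeffY x + powSum (derivCoeff coeffJ) x := by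
  have h := isEntireCoeff_coeffY
  refine ((hasSum_mul_powSum_derivCoeff h.derivCoeff x).add
    (h.derivCoeff.summable x).hasSum).unique ?_
  refine hasSum_of_forall_eq
    ((h.summable x).hasSum.neg.add (isEntireCoeff_coeffJ.derivCoeff.summable x).hasSum)
    fun m => ?_
  have := coeffY_succ m
  simp only [derivCoeff] at this ⊢
  linear_combination -x ^ m * this

lemma besselJ0_eq (t : ℝ) : besselJ0 t = powSum coeffJ ((t / 2) ^ 2) := by
  simp only [besselJ0, powSum, coeffJ, pow_mul]

lemma besselY0_eq (t : ℝ) : besselY0 t =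
    2 / Real.pi * ((Real.log (t / 2) + Real.eulerMascheroniConstant) * besselJ0 t -
      powSum coeffY ((t / 2) ^ 2)) := by
  simp only [besselY0, powSum, coeffY, pow_mul]

/-- A solution `f` of Bessel's equation of order zero, written as a first order system with
`g t = t * f' t`. -/
def IsBesselPair (f g : ℝ → ℂ) : Prop :=
  ∀ t : ℝ, 0 < t → HasDerivAt f (g t / t) t ∧ HasDerivAt g (-(t * f t)) t

/-- The logarithmic derivative `t * J₀'(t)`. -/
noncomputable def scaledDerivJ (t : ℝ) : ℝ :=
  2 * (t / 2) ^ 2 * powSum (derivCoeff coeffJ) ((t / 2) ^ 2)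

/-- The derivative `t * S'(t)` of the entire part of `Y₀`. -/
noncomputable def scaledDerivS (t : ℝ) : ℝ :=
  2 * (t / 2) ^ 2 * powSum (derivCoeff coeffY) ((t / 2) ^ 2)

/-- The derivative `t * Y₀'(t)`. -/
noncomputable def scaledDerivY (t : ℝ) : ℝ :=
  2 / Real.pi * (besselJ0 t + (Real.log (t / 2) + Real.eulerMascheroniConstant) * scaledDerivJ t -
    scaledDerivS t)

lemma hasDerivAt_powSum_sq {c : ℕ → ℝ} (hc : IsEntireCoeff c) (t : ℝ) :
    HasDerivAt (fun t => powSum c ((t / 2) ^ 2)) (powSum (derivCoeff c) ((t / 2) ^ 2) * (t / 2))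
      t := by
  have h1 : HasDerivAt (fun t : ℝ => (t / 2) ^ 2) (t / 2) t := by
    have := ((hasDerivAt_id t).div_const 2).pow 2
    refine this.congr_deriv ?_
    simp
    ring
  exact (hasDerivAt_powSum hc _).comp t h1

lemma hasDerivAt_scaled_powSum_sq {c : ℕ → ℝ} (hc : IsEntireCoeff c) (t : ℝ) :
    HasDerivAt (fun t => 2 * (t / 2) ^ 2 * powSum (derivCoeff c) ((t / 2) ^ 2))
      (t * ((t / 2) ^ 2 * powSum (derivCoeff (derivCoeff c)) ((t / 2) ^ 2) +
        powSum (derivCoeff c) ((t / 2) ^ 2))) t := by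
  have h1 : HasDerivAt (fun t : ℝ => 2 * (t / 2) ^ 2) t t := by
    have := (((hasDerivAt_id t).div_const 2).pow 2).const_mul 2
    refine this.congr_deriv ?_
    simp
    ring
  refine (h1.mul (hasDerivAt_powSum_sq hc.derivCoeff t)).congr_deriv ?_
  ring

lemma hasDerivAt_besselJ0 {t : ℝ} (ht : 0 < t) : HasDerivAt besselJ0 (scaledDerivJ t / t) t := by
  rw [funext besselJ0_eq]
  refine (hasDerivAt_powSum_sq isEntireCoeff_coeffJ t).congr_deriv ?_
  rw [scaledDerivJ]
  field_simp

lemma hasDerivAt_scaledDerivJ (t : ℝ) : HasDerivAt scaledDerivJ (-(t * besselJ0 t)) t := by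
  refine (hasDerivAt_scaled_powSum_sq isEntireCoeff_coeffJ t).congr_deriv ?_
  rw [powSum_coeffJ_ode, besselJ0_eq]
  ring

lemma hasDerivAt_log_half {t : ℝ} (ht : 0 < t) :
    HasDerivAt (fun t => Real.log (t / 2) + Real.eulerMascheroniConstant) t⁻¹ t := by
  refine ((((hasDerivAt_id t).div_const 2).log (by simpa using ht.ne')).add_const
    Real.eulerMascheroniConstant).congr_deriv ?_
  simp
  field_simp

lemma hasDerivAt_besselY0 {t : ℝ} (ht : 0 < t) : HasDerivAt besselY0 (scaledDerivY t / t) t := by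
  rw [funext besselY0_eq]
  refine ((((hasDerivAt_log_half ht).mul (hasDerivAt_besselJ0 ht)).sub
    (hasDerivAt_powSum_sq isEntireCoeff_coeffY t)).const_mul (2 / Real.pi)).congr_deriv ?_
  rw [scaledDerivY, scaledDerivS]
  field_simp

/-- Differentiating J₀ and the logarithm each contributes t J₀'(t)/t; together they cancel the
source term in the equation of the entire part. -/
lemma hasDerivAt_scaledDerivY {t : ℝ} (ht : 0 < t) :
    HasDerivAt scaledDerivY (-(t * besselY0 t)) t := by
  refine ((((hasDerivAt_besselJ0 ht).add ((hasDerivAt_log_half ht).mul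
    (hasDerivAt_scaledDerivJ t))).sub
    (hasDerivAt_scaled_powSum_sq isEntireCoeff_coeffY t)).const_mul (2 / Real.pi)).congr_deriv ?_
  rw [powSum_coeffY_ode, besselY0_eq, scaledDerivJ]
  field_simp
  ring

/-- The derivative `t * H₀'(t)` of the Hankel function. -/
noncomputable def scaledDerivH (t : ℝ) : ℂ :=
  (scaledDerivJ t : ℂ) + Complex.I * (scaledDerivY t : ℂ)

lemma isBesselPair_besselJ0 :
    IsBesselPair (fun t => (besselJ0 t : ℂ)) (fun t => (scaledDerivJ t : ℂ)) := fun t ht => by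
  refine ⟨(hasDerivAt_besselJ0 ht).ofReal_comp.congr_deriv ?_,
    (hasDerivAt_scaledDerivJ t).ofReal_comp.congr_deriv ?_⟩ <;> push_cast <;> rfl

lemma isBesselPair_hankelH0 : IsBesselPair hankelH0 scaledDerivH := fun t ht => by
  refine ⟨((hasDerivAt_besselJ0 ht).ofReal_comp.add
    ((hasDerivAt_besselY0 ht).ofReal_comp.const_mul Complex.I)).congr_deriv ?_,
    ((hasDerivAt_scaledDerivJ t).ofReal_comp.add
    ((hasDerivAt_scaledDerivY ht).ofReal_comp.const_mul Complex.I)).congr_deriv ?_⟩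
  · rw [scaledDerivH]
    push_cast
    ring
  · rw [hankelH0]
    push_cast
    ring

lemma IsBesselPair.sub_const_mul {f g f' g' : ℝ → ℂ} (h : IsBesselPair f g)
    (h' : IsBesselPair f' g') (c : ℂ) :
    IsBesselPair (fun t => f t - c * f' t) (fun t => g t - c * g' t) := fun t ht => by
  refine ⟨((h t ht).1.sub ((h' t ht).1.const_mul c)).congr_deriv ?_,
    ((h t ht).2.sub ((h' t ht).2.const_mul c)).congr_deriv ?_⟩ <;> ring

/-- The Wronskian of two solutions of Bessel's equation is constant. -/
lemma IsBesselPair.wronskian_eq {f g f' g' : ℝ → ℂ} (h : IsBesselPair f g)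
    (h' : IsBesselPair f' g') {w : ℂ}
    (hw : Tendsto (fun t => f t * g' t - f' t * g t) (𝓝[>] 0) (𝓝 w)) {t : ℝ} (ht : 0 < t) :
    f t * g' t - f' t * g t = w := by
  have hder : ∀ s ∈ Ioi (0 : ℝ), HasDerivAt (fun t => f t * g' t - f' t * g t) 0 s := by
    intro s hs
    have hs' : (s : ℂ) ≠ 0 := by exact_mod_cast (ne_of_gt hs.out)
    refine (((h s hs).1.mul (h' s hs).2).sub ((h' s hs).1.mul (h s hs).2)).congr_deriv ?_
    field_simp
    ring
  have hconst : ∀ s ∈ Ioi (0 : ℝ), f s * g' s - f' s * g s = f t * g' t - f' t * g t := by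
    intro s hs
    exact isOpen_Ioi.is_const_of_deriv_eq_zero isPreconnected_Ioi
      (fun y hy => (hder y hy).differentiableAt.differentiableWithinAt)
      (fun y hy => (hder y hy).deriv) hs ht
  refine tendsto_nhds_unique (tendsto_const_nhds.congr' ?_) hw
  filter_upwards [self_mem_nhdsWithin] with s hs
  exact (hconst s hs).symm

end BesselSeries

/-! ### The outgoing solution as a Laplace integral -/

section LaplaceIntegral

lemma hasDerivAt_exp_neg_mul (t v : ℝ) :
    HasDerivAt (fun t => Real.exp (-(t * v))) (-v * Real.exp (-(t * v))) t := by
  refine (((hasDerivAt_id t).mul_const v).neg.exp).congr_deriv ?_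
  simp
  ring

/-- Differentiation of a Laplace transform. -/
lemma hasDerivAt_laplace {w : ℝ → ℂ}
    (hw : ∀ t : ℝ, 0 < t → IntegrableOn (fun v => Real.exp (-(t * v)) • w v) (Ioi 0)) {t : ℝ}
    (ht : 0 < t) :
    IntegrableOn (fun v => Real.exp (-(t * v)) • (v • w v)) (Ioi 0) ∧
    HasDerivAt (fun t => ∫ v in Ioi (0 : ℝ), Real.exp (-(t * v)) • w v)
      (-∫ v in Ioi (0 : ℝ), Real.exp (-(t * v)) • (v • w v)) t := by
  have h := hasDerivAt_integral_of_dominated_loc_of_deriv_le (μ := volume.restrict (Ioi (0 : ℝ)))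
    (F := fun t v => Real.exp (-(t * v)) • w v)
    (F' := fun t v => (-v * Real.exp (-(t * v))) • w v)
    (bound := fun v => 4 / t * ‖Real.exp (-(t / 4 * v)) • w v‖) (ball_mem_nhds t (half_pos ht))
    (by
      filter_upwards [Ioi_mem_nhds ht] with s hs
      exact (hw s hs).aestronglyMeasurable)
    (hw t ht)
    (by
      have h1 : AEStronglyMeasurable (fun v : ℝ => (-v) • Real.exp (-(t * v)) • w v)
          (volume.restrict (Ioi (0 : ℝ))) :=
        (continuous_neg.aestronglyMeasurable).smul (hw t ht).aestronglyMeasurable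
      simpa only [smul_smul] using h1)
    (by
      filter_upwards [ae_restrict_mem measurableSet_Ioi] with v hv s hs
      rw [mem_Ioi] at hv
      have hs' : t / 2 ≤ s := by
        rw [mem_ball, Real.dist_eq, abs_lt] at hs
        linarith [hs.1]
      rw [norm_smul, norm_smul, ← mul_assoc, norm_mul, norm_neg, Real.norm_eq_abs,
        Real.norm_eq_abs, Real.norm_eq_abs, Real.abs_exp, Real.abs_exp, abs_of_pos hv]
      refine mul_le_mul_of_nonneg_right ?_ (norm_nonneg _)
      -- The decay available for s ≥ t/2 is split in two: a quarter of t absorbs the factor v, the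
      -- other quarter keeps the integrand integrable.
      have h1 : v ≤ 4 / t * Real.exp (t / 4 * v) := by
        have := Real.add_one_le_exp (t / 4 * v)
        rw [div_mul_eq_mul_div, le_div_iff₀ ht]
        linarith
      have h2 : Real.exp (-(s * v)) ≤ Real.exp (-(t / 2 * v)) := by
        apply Real.exp_le_exp.2
        nlinarith
      calc v * Real.exp (-(s * v))
          ≤ 4 / t * Real.exp (t / 4 * v) * Real.exp (-(t / 2 * v)) := by gcongr
        _ = 4 / t * Real.exp (-(t / 4 * v)) := by
          rw [mul_assoc, ← Real.exp_add]
          ring_nf)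
    ((hw (t / 4) (by positivity)).norm.const_mul _)
    (by
      refine Eventually.of_forall fun v s _ => ?_
      exact (hasDerivAt_exp_neg_mul s v).smul_const (w v))
  have e : ∀ v, Real.exp (-(t * v)) • (v • w v) = -((-v * Real.exp (-(t * v))) • w v) := by
    intro v
    rw [smul_smul, ← neg_smul]
    congr 1
    ring
  simp only [e, integral_neg, neg_neg]
  exact ⟨h.1.neg, h.2⟩

/-- The root `(v - 2i)^(1/2)`. -/
noncomputable def rootShift (v : ℝ) : ℂ := ((v : ℂ) - 2 * Complex.I) ^ (2⁻¹ : ℂ)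

lemma rootShift_sq (v : ℝ) : rootShift v ^ 2 = (v : ℂ) - 2 * Complex.I :=
  Complex.cpow_ofNat_inv_pow _ 2

lemma shift_ne_zero (v : ℝ) : (v : ℂ) - 2 * Complex.I ≠ 0 := by
  intro h
  have := congrArg Complex.im h
  simp at this

lemma two_le_norm_shift (v : ℝ) : 2 ≤ ‖(v : ℂ) - 2 * Complex.I‖ := by
  have := Complex.abs_im_le_norm ((v : ℂ) - 2 * Complex.I)
  simpa using this

lemma norm_rootShift_sq (v : ℝ) : ‖rootShift v‖ ^ 2 = ‖(v : ℂ) - 2 * Complex.I‖ := by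
  rw [← norm_pow, rootShift_sq]

/-- The principal root of z has real part √((|z| + Re z)/2), and here |z| ≥ 2 with Re z ≥ 0. -/
lemma one_le_re_rootShift {v : ℝ} (hv : 0 ≤ v) : 1 ≤ (rootShift v).re := by
  rw [rootShift, Complex.cpow_inv_two_re, Real.one_le_sqrt]
  have := two_le_norm_shift v
  simp
  linarith

lemma one_le_norm_rootShift {v : ℝ} (hv : 0 ≤ v) : 1 ≤ ‖rootShift v‖ :=
  (one_le_re_rootShift hv).trans (Complex.re_le_norm _)

lemma rootShift_ne_zero (v : ℝ) : rootShift v ≠ 0 := by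
  intro h
  have := rootShift_sq v
  rw [h, zero_pow two_ne_zero] at this
  exact shift_ne_zero v this.symm

/-- The imaginary part -2 keeps v - 2i off the branch cut for every real v. -/
lemma hasDerivAt_rootShift (v : ℝ) : HasDerivAt rootShift (2 * rootShift v)⁻¹ v := by
  have h1 : HasDerivAt (fun v : ℝ => (v : ℂ) - 2 * Complex.I) 1 v :=
    (hasDerivAt_id v).ofReal_comp.sub_const _
  have hs : (v : ℂ) - 2 * Complex.I ∈ Complex.slitPlane := by
    rw [Complex.mem_slitPlane_iff]
    right
    simp
  have h2 : HasDerivAt (fun z : ℂ => z ^ (2⁻¹ : ℂ)) _ ((v : ℂ) - 2 * Complex.I) :=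
    (hasDerivAt_id _).cpow_const (c := (2⁻¹ : ℂ)) hs
  have h3 := h2.comp v h1
  refine h3.congr_deriv ?_
  have h4 : ((v : ℂ) - 2 * Complex.I) ^ ((2⁻¹ : ℂ) - 1) = rootShift v / rootShift v ^ 2 := by
    rw [Complex.cpow_sub _ _ (shift_ne_zero v), Complex.cpow_one, rootShift_sq]
    rfl
  simp only [id, h4, mul_one]
  have := rootShift_ne_zero v
  field_simp

lemma continuous_rootShift : Continuous rootShift :=
  continuous_iff_continuousAt.2 fun v => (hasDerivAt_rootShift v).continuousAt

/-- The kernel `(v (v - 2i))^(-1/2)`. -/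
noncomputable def hankelKernel (v : ℝ) : ℂ := ((√v : ℂ) * rootShift v)⁻¹

/-- The exponent is left as a - 1 with a = 1/2, the shape of Euler's Gamma integral. -/
lemma norm_hankelKernel_le {v : ℝ} (hv : 0 < v) : ‖hankelKernel v‖ ≤ v ^ ((1 : ℝ) / 2 - 1) := by
  have h1 : v ^ ((1 : ℝ) / 2 - 1) = (√v)⁻¹ := by
    rw [Real.sqrt_eq_rpow, ← Real.rpow_neg hv.le]
    norm_num
  rw [h1, hankelKernel, norm_inv, norm_mul, Complex.norm_real, Real.norm_eq_abs,
    abs_of_nonneg (Real.sqrt_nonneg v)]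
  have h2 : 0 < √v := Real.sqrt_pos.2 hv
  exact inv_anti₀ h2 (le_mul_of_one_le_right h2.le (one_le_norm_rootShift hv.le))

lemma continuousOn_hankelKernel : ContinuousOn hankelKernel (Ioi 0) := by
  refine ContinuousOn.inv₀ (Continuous.continuousOn ?_) fun v hv => ?_
  · exact (Complex.continuous_ofReal.comp Real.continuous_sqrt).mul continuous_rootShift
  · refine mul_ne_zero ?_ (rootShift_ne_zero v)
    exact_mod_cast (Real.sqrt_pos.2 hv).ne'

lemma integrableOn_rpow_mul_exp_neg {a t : ℝ} (ha : 0 < a) (ht : 0 < t) :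
    IntegrableOn (fun v : ℝ => v ^ (a - 1) * Real.exp (-(t * v))) (Ioi 0) := by
  have := integrableOn_rpow_mul_exp_neg_mul_rpow (p := 1) (s := a - 1) (b := t) (by linarith)
    one_pos ht
  simpa using this

lemma integrableOn_laplace_of_le {w : ℝ → ℂ} (hw : ContinuousOn w (Ioi 0)) {a : ℝ} (ha : 0 < a)
    (hb : ∀ v : ℝ, 0 < v → ‖w v‖ ≤ v ^ (a - 1)) {t : ℝ} (ht : 0 < t) :
    IntegrableOn (fun v => Real.exp (-(t * v)) • w v) (Ioi 0) := by
  refine Integrable.mono' (integrableOn_rpow_mul_exp_neg ha ht) ?_ ?_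
  · have h1 : Continuous fun v : ℝ => Real.exp (-(t * v)) := by fun_prop
    exact (h1.continuousOn.smul hw).aestronglyMeasurable measurableSet_Ioi
  · filter_upwards [ae_restrict_mem measurableSet_Ioi] with v hv
    rw [norm_smul, Real.norm_eq_abs, Real.abs_exp, mul_comm]
    gcongr
    exact hb v hv

lemma norm_laplace_le {w : ℝ → ℂ} {a : ℝ} (ha : 0 < a)
    (hb : ∀ v : ℝ, 0 < v → ‖w v‖ ≤ v ^ (a - 1)) {t : ℝ} (ht : 0 < t) :
    ‖∫ v in Ioi (0 : ℝ), Real.exp (-(t * v)) • w v‖ ≤ (1 / t) ^ a * Real.Gamma a := by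
  rw [← Real.integral_rpow_mul_exp_neg_mul_Ioi ha ht]
  refine norm_integral_le_of_norm_le (integrableOn_rpow_mul_exp_neg ha ht) ?_
  filter_upwards [ae_restrict_mem measurableSet_Ioi] with v hv
  rw [norm_smul, Real.norm_eq_abs, Real.abs_exp, mul_comm]
  gcongr
  exact hb v hv

/-- The Laplace transform of the Hankel kernel. -/
noncomputable def laplaceK (t : ℝ) : ℂ :=
  ∫ v in Ioi (0 : ℝ), Real.exp (-(t * v)) • hankelKernel v

/-- The Laplace transform of `v` times the Hankel kernel. -/
noncomputable def laplaceK₁ (t : ℝ) : ℂ :=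
  ∫ v in Ioi (0 : ℝ), Real.exp (-(t * v)) • (v • hankelKernel v)

/-- The Laplace transform of `v²` times the Hankel kernel. -/
noncomputable def laplaceK₂ (t : ℝ) : ℂ :=
  ∫ v in Ioi (0 : ℝ), Real.exp (-(t * v)) • (v • v • hankelKernel v)

lemma integrableOn_laplaceK {t : ℝ} (ht : 0 < t) :
    IntegrableOn (fun v => Real.exp (-(t * v)) • hankelKernel v) (Ioi 0) :=
  integrableOn_laplace_of_le continuousOn_hankelKernel (by norm_num : (0 : ℝ) < 1 / 2)
    (fun _ hv => norm_hankelKernel_le hv) ht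

lemma integrableOn_laplaceK₁ {t : ℝ} (ht : 0 < t) :
    IntegrableOn (fun v => Real.exp (-(t * v)) • (v • hankelKernel v)) (Ioi 0) :=
  (hasDerivAt_laplace (fun _ h => integrableOn_laplaceK h) ht).1

lemma integrableOn_laplaceK₂ {t : ℝ} (ht : 0 < t) :
    IntegrableOn (fun v => Real.exp (-(t * v)) • (v • v • hankelKernel v)) (Ioi 0) :=
  (hasDerivAt_laplace (fun _ h => integrableOn_laplaceK₁ h) ht).1

lemma hasDerivAt_laplaceK {t : ℝ} (ht : 0 < t) : HasDerivAt laplaceK (-laplaceK₁ t) t :=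
  (hasDerivAt_laplace (fun _ h => integrableOn_laplaceK h) ht).2

lemma hasDerivAt_laplaceK₁ {t : ℝ} (ht : 0 < t) : HasDerivAt laplaceK₁ (-laplaceK₂ t) t :=
  (hasDerivAt_laplace (fun _ h => integrableOn_laplaceK₁ h) ht).2

lemma norm_laplaceK_le {t : ℝ} (ht : 0 < t) :
    ‖laplaceK t‖ ≤ (1 / t) ^ ((1 : ℝ) / 2) * Real.Gamma (1 / 2) :=
  norm_laplace_le (by norm_num) (fun _ hv => norm_hankelKernel_le hv) ht

lemma norm_laplaceK₁_le {t : ℝ} (ht : 0 < t) :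
    ‖laplaceK₁ t‖ ≤ (1 / t) ^ ((3 : ℝ) / 2) * Real.Gamma (3 / 2) := by
  refine norm_laplace_le (by norm_num) (fun v hv => ?_) ht
  rw [norm_smul, Real.norm_eq_abs, abs_of_pos hv]
  calc v * ‖hankelKernel v‖ ≤ v * v ^ ((1 : ℝ) / 2 - 1) := by
        gcongr
        exact norm_hankelKernel_le hv
    _ = v ^ ((3 : ℝ) / 2 - 1) := by
        rw [← Real.rpow_one_add' hv.le (by norm_num)]
        norm_num

lemma hasDerivAt_exp_neg_mul' (t v : ℝ) :
    HasDerivAt (fun v => Real.exp (-(t * v))) (-t * Real.exp (-(t * v))) v := by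
  simpa only [mul_comm] using hasDerivAt_exp_neg_mul v t

/-- Integral of the derivative of `e^(-tv) F(v)` over the half-line. -/
lemma laplace_deriv_eq {F F' : ℝ → ℂ} {t : ℝ} (hF0 : F 0 = 0)
    (hc : ContinuousWithinAt F (Ici 0) 0) (hd : ∀ v ∈ Ioi (0 : ℝ), HasDerivAt F (F' v) v)
    (hF : IntegrableOn (fun v => Real.exp (-(t * v)) • F v) (Ioi 0))
    (hF' : IntegrableOn (fun v => Real.exp (-(t * v)) • F' v) (Ioi 0)) :
    ∫ v in Ioi (0 : ℝ), Real.exp (-(t * v)) • F' v =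
      t • ∫ v in Ioi (0 : ℝ), Real.exp (-(t * v)) • F v := by
  have hder : ∀ v ∈ Ioi (0 : ℝ), HasDerivAt (fun v => Real.exp (-(t * v)) • F v)
      (Real.exp (-(t * v)) • F' v - t • (Real.exp (-(t * v)) • F v)) v := by
    intro v hv
    refine ((hasDerivAt_exp_neg_mul' t v).smul (hd v hv)).congr_deriv ?_
    simp only [Complex.real_smul]
    push_cast
    ring
  have hFt : IntegrableOn (fun v => t • (Real.exp (-(t * v)) • F v)) (Ioi 0) := hF.smul t
  have hint : IntegrableOn
      (fun v => Real.exp (-(t * v)) • F' v - t • (Real.exp (-(t * v)) • F v)) (Ioi 0) :=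
    hF'.sub hFt
  -- A function that is integrable together with its derivative tends to zero, so there is no
  -- boundary term at infinity.
  have hlim := tendsto_zero_of_hasDerivAt_of_integrableOn_Ioi hder hint hF
  have hc' : ContinuousWithinAt (fun v => Real.exp (-(t * v)) • F v) (Ici 0) 0 := by
    have he : Continuous fun v : ℝ => Real.exp (-(t * v)) := by fun_prop
    exact he.continuousWithinAt.smul hc
  have h := integral_Ioi_of_hasDerivAt_of_tendsto hc' hder hint hlim
  rw [integral_sub hF' hFt, integral_smul, hF0, smul_zero, sub_zero, sub_eq_zero] at h
  exact h

lemma hasDerivAt_sqrt_ofReal {v : ℝ} (hv : 0 < v) :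
    HasDerivAt (fun v : ℝ => (√v : ℂ)) (2 * (√v : ℂ))⁻¹ v := by
  refine (Real.hasDerivAt_sqrt hv.ne').ofReal_comp.congr_deriv ?_
  push_cast
  ring

lemma sqrt_ofReal_sq {v : ℝ} (hv : 0 ≤ v) : (√v : ℂ) ^ 2 = v := by
  exact_mod_cast Real.sq_sqrt hv

/-- The second order equation for the Laplace transform of the Hankel kernel. -/
lemma laplaceK_ode {t : ℝ} (ht : 0 < t) :
    t * laplaceK₂ t - (1 + 2 * Complex.I * t) * laplaceK₁ t + Complex.I * laplaceK t = 0 := by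
  -- With k the kernel, F = √(v(v - 2i)) equals (v² - 2iv) k and has derivative (v - i) k.
  -- Integrating the derivative of e^(-tv) F gives the equation.
  have hF : ∀ v ∈ Ioi (0 : ℝ), (√v : ℂ) * rootShift v =
      v • v • hankelKernel v - (2 * Complex.I) * (v • hankelKernel v) := by
    intro v hv
    have h1 : (√v : ℂ) ≠ 0 := by exact_mod_cast (Real.sqrt_pos.2 hv).ne'
    have h2 := rootShift_ne_zero v
    simp only [hankelKernel, Complex.real_smul]
    field_simp
    rw [rootShift_sq, sqrt_ofReal_sq (le_of_lt hv)]
  have hd : ∀ v ∈ Ioi (0 : ℝ), HasDerivAt (fun v : ℝ => (√v : ℂ) * rootShift v)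
      (v • hankelKernel v - Complex.I * hankelKernel v) v := by
    intro v hv
    refine ((hasDerivAt_sqrt_ofReal hv).mul (hasDerivAt_rootShift v)).congr_deriv ?_
    have h1 : (√v : ℂ) ≠ 0 := by exact_mod_cast (Real.sqrt_pos.2 hv).ne'
    have h2 := rootShift_ne_zero v
    simp only [hankelKernel, Complex.real_smul]
    field_simp
    rw [rootShift_sq, sqrt_ofReal_sq (le_of_lt hv)]
    ring
  have i0 := integrableOn_laplaceK ht
  have i1 := integrableOn_laplaceK₁ ht
  have i2 := integrableOn_laplaceK₂ ht
  have hFi : ∀ v ∈ Ioi (0 : ℝ), Real.exp (-(t * v)) • ((√v : ℂ) * rootShift v) =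
      Real.exp (-(t * v)) • (v • v • hankelKernel v) -
        (2 * Complex.I) * (Real.exp (-(t * v)) • (v • hankelKernel v)) := by
    intro v hv
    rw [hF v hv]
    simp only [Complex.real_smul]
    ring
  have hF'i : ∀ v ∈ Ioi (0 : ℝ), Real.exp (-(t * v)) •
      (v • hankelKernel v - Complex.I * hankelKernel v) =
      Real.exp (-(t * v)) • (v • hankelKernel v) -
        Complex.I * (Real.exp (-(t * v)) • hankelKernel v) := by
    intro v hv
    rw [smul_sub, mul_smul_comm]
  have key := laplace_deriv_eq (t := t) (F := fun v : ℝ => (√v : ℂ) * rootShift v)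
    (F' := fun v => v • hankelKernel v - Complex.I * hankelKernel v) (by simp)
    ((Complex.continuous_ofReal.comp Real.continuous_sqrt).mul
      continuous_rootShift).continuousWithinAt hd
    ((i2.sub (i1.const_mul (2 * Complex.I))).congr_fun (fun v hv => (hFi v hv).symm)
      measurableSet_Ioi)
    ((i1.sub (i0.const_mul Complex.I)).congr_fun (fun v hv => (hF'i v hv).symm)
      measurableSet_Ioi)
  rw [setIntegral_congr_fun measurableSet_Ioi hFi, setIntegral_congr_fun measurableSet_Ioi hF'i,
    integral_sub i1 (i0.const_mul _), integral_sub i2 (i1.const_mul _), integral_const_mul,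
    integral_const_mul, Complex.real_smul] at key
  change laplaceK₁ t - Complex.I * laplaceK t =
    t * (laplaceK₂ t - 2 * Complex.I * laplaceK₁ t) at key
  linear_combination -key

/-- The outgoing solution of Bessel's equation, up to a constant factor. -/
noncomputable def outgoingK (t : ℝ) : ℂ := Complex.exp (Complex.I * t) * laplaceK t

/-- The derivative `t * f'(t)` of the outgoing solution `f`. -/
noncomputable def scaledDerivK (t : ℝ) : ℂ :=
  t * (Complex.exp (Complex.I * t) * (Complex.I * laplaceK t - laplaceK₁ t))

lemma hasDerivAt_exp_I_mul (t : ℝ) : HasDerivAt (fun t : ℝ => Complex.exp (Complex.I * t))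
    (Complex.exp (Complex.I * t) * Complex.I) t := by
  have h := (((hasDerivAt_id t).ofReal_comp).const_mul Complex.I).cexp
  simpa using h

/-- Factoring e^(it) out of Bessel's equation leaves exactly `laplaceK_ode`. -/
lemma isBesselPair_outgoingK : IsBesselPair outgoingK scaledDerivK := fun t ht => by
  have ht0 : (t : ℂ) ≠ 0 := by exact_mod_cast ht.ne'
  have hid : HasDerivAt (fun t : ℝ => (t : ℂ)) 1 t := (hasDerivAt_id t).ofReal_comp
  refine ⟨((hasDerivAt_exp_I_mul t).mul (hasDerivAt_laplaceK ht)).congr_deriv ?_,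
    (hid.mul ((hasDerivAt_exp_I_mul t).mul (((hasDerivAt_laplaceK ht).const_mul
      Complex.I).sub (hasDerivAt_laplaceK₁ ht)))).congr_deriv ?_⟩
  · rw [scaledDerivK]
    field_simp
    ring
  · simp only [outgoingK, Pi.mul_apply, Pi.sub_apply]
    linear_combination Complex.exp (Complex.I * t) * laplaceK_ode ht +
      t * Complex.exp (Complex.I * t) * laplaceK t * Complex.I_sq

end LaplaceIntegral

/-! ### Behaviour of the Laplace integral at the origin -/

section LaplaceAsymptotics

/-- The quotient `(v - 2i)^(1/2) / v^(1/2)`. -/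
noncomputable def rootRatio (v : ℝ) : ℂ := rootShift v / √v

lemma norm_rootRatio_sq {v : ℝ} (hv : 0 < v) :
    ‖rootRatio v‖ ^ 2 = ‖(v : ℂ) - 2 * Complex.I‖ / v := by
  rw [rootRatio, norm_div, div_pow, norm_rootShift_sq, Complex.norm_real, Real.norm_eq_abs, sq_abs,
    Real.sq_sqrt hv.le]

lemma one_le_norm_rootRatio {v : ℝ} (hv : 0 < v) : 1 ≤ ‖rootRatio v‖ := by
  refine (one_le_sq_iff₀ (norm_nonneg _)).1 ?_
  rw [norm_rootRatio_sq hv, one_le_div hv]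
  have := Complex.abs_re_le_norm ((v : ℂ) - 2 * Complex.I)
  simp [abs_of_pos hv] at this
  exact this

lemma norm_rootRatio_le {v : ℝ} (hv : 0 < v) : ‖rootRatio v‖ ≤ 1 + 2 * v ^ ((1 : ℝ) / 2 - 1) := by
  have h1 : v ^ ((1 : ℝ) / 2 - 1) = (√v)⁻¹ := by
    rw [Real.sqrt_eq_rpow, ← Real.rpow_neg hv.le]
    norm_num
  have hs : 0 < √v := Real.sqrt_pos.2 hv
  rw [h1]
  refine abs_le_of_sq_le_sq' ?_ (by positivity) |>.2
  rw [norm_rootRatio_sq hv, div_le_iff₀ hv]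
  have h2 : ‖(v : ℂ) - 2 * Complex.I‖ ≤ v + 2 := by
    refine (norm_sub_le _ _).trans ?_
    simp [abs_of_pos hv]
  have h3 : (1 + 2 * (√v)⁻¹) ^ 2 * v = v + 4 * √v + 4 := by
    have h4 : v = √v ^ 2 := (Real.sq_sqrt hv.le).symm
    generalize √v = y at hs h4
    subst h4
    field_simp
    ring
  rw [h3]
  linarith

lemma re_rootRatio_nonneg {v : ℝ} (hv : 0 < v) : 0 ≤ (rootRatio v).re := by
  rw [rootRatio, Complex.div_ofReal_re]
  exact div_nonneg (zero_le_one.trans (one_le_re_rootShift hv.le)) (Real.sqrt_nonneg v)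

/-- Rationalize: (q - 1)(q + 1) = -2i/v, and Re q ≥ 0 keeps q + 1 away from zero. The choice of
branch thus excludes the limit -1. -/
lemma tendsto_rootRatio : Tendsto rootRatio atTop (𝓝 1) := by
  rw [tendsto_iff_norm_sub_tendsto_zero]
  have hlim : Tendsto (fun v : ℝ => 2 / v) atTop (𝓝 0) := tendsto_const_nhds.div_atTop tendsto_id
  refine squeeze_zero' (Eventually.of_forall fun v => norm_nonneg _) ?_ hlim
  filter_upwards [eventually_gt_atTop 0] with v hv
  have h1 : (rootRatio v - 1) * (rootRatio v + 1) = -(2 * Complex.I) / v := by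
    have h2 : rootRatio v ^ 2 = ((v : ℂ) - 2 * Complex.I) / v := by
      rw [rootRatio, div_pow, rootShift_sq, sqrt_ofReal_sq hv.le]
    have hv0 : (v : ℂ) ≠ 0 := by exact_mod_cast hv.ne'
    calc _ = rootRatio v ^ 2 - 1 := by ring
      _ = _ := by
        rw [h2]
        field_simp
        ring
  have h3 : 1 ≤ ‖rootRatio v + 1‖ := by
    refine le_trans ?_ (Complex.re_le_norm _)
    simp [re_rootRatio_nonneg hv]
  calc ‖rootRatio v - 1‖ ≤ ‖rootRatio v - 1‖ * ‖rootRatio v + 1‖ :=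
        le_mul_of_one_le_right (norm_nonneg _) h3
    _ = 2 / v := by
        rw [← norm_mul, h1]
        simp [abs_of_pos hv]

lemma tendsto_div_nhdsGT {w : ℝ} (hw : 0 < w) : Tendsto (fun t : ℝ => w / t) (𝓝[>] 0) atTop := by
  simpa only [div_eq_mul_inv] using tendsto_inv_nhdsGT_zero.const_mul_atTop hw

/-- Rescaling turns the limit t → 0 into the behaviour of w at infinity under a fixed weight. -/
lemma smul_laplace_eq (w : ℝ → ℂ) {t : ℝ} (ht : 0 < t) :
    t • ∫ v in Ioi (0 : ℝ), Real.exp (-(t * v)) • w v =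
      ∫ v in Ioi (0 : ℝ), Real.exp (-v) • w (v / t) := by
  have h := integral_comp_mul_left_Ioi (fun y => Real.exp (-y) • w (y / t)) 0 ht
  rw [mul_zero] at h
  rw [eq_inv_smul_iff₀ ht.ne'] at h
  rw [← h]
  congr 1
  refine setIntegral_congr_fun measurableSet_Ioi fun v _ => ?_
  simp only [mul_div_cancel_left₀ _ ht.ne']

lemma integrableOn_exp_neg : IntegrableOn (fun v : ℝ => Real.exp (-v)) (Ioi 0) := by
  simpa using integrableOn_rpow_mul_exp_neg one_pos one_pos

lemma integral_exp_neg_smul (c : ℂ) : ∫ v in Ioi (0 : ℝ), Real.exp (-v) • c = c := by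
  rw [integral_smul_const, integral_exp_neg_Ioi_zero, one_smul]

/-- `t` times the second Laplace transform tends to one at zero. -/
lemma tendsto_mul_laplaceK₁ : Tendsto (fun t : ℝ => (t : ℂ) * laplaceK₁ t) (𝓝[>] 0) (𝓝 1) := by
  -- The rescaled integrand is the reciprocal of a ratio of modulus at least one tending to one, so
  -- e^(-v) dominates.
  have hker : ∀ v ∈ Ioi (0 : ℝ), v • hankelKernel v = (rootRatio v)⁻¹ := by
    intro v hv
    have h1 : (√v : ℂ) ≠ 0 := by exact_mod_cast (Real.sqrt_pos.2 hv).ne'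
    have h2 := rootShift_ne_zero v
    rw [Complex.real_smul, ← sqrt_ofReal_sq (le_of_lt hv), hankelKernel, rootRatio]
    field_simp
  have hcont : ContinuousOn (fun v : ℝ => v • hankelKernel v) (Ioi 0) :=
    continuousOn_id.smul continuousOn_hankelKernel
  have hlim : Tendsto (fun t : ℝ => ∫ v in Ioi (0 : ℝ), Real.exp (-v) •
      ((v / t) • hankelKernel (v / t))) (𝓝[>] 0)
      (𝓝 (∫ v in Ioi (0 : ℝ), Real.exp (-v) • (1 : ℂ))) := by
    refine tendsto_integral_filter_of_dominated_convergence (fun v => Real.exp (-v)) ?_ ?_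
      integrableOn_exp_neg ?_
    · filter_upwards [self_mem_nhdsWithin] with t ht
      have h1 : Continuous fun v : ℝ => Real.exp (-v) := by fun_prop
      have h2 : Continuous fun v : ℝ => v / t := by fun_prop
      exact (h1.continuousOn.smul (hcont.comp h2.continuousOn
        fun v hv => div_pos hv.out ht.out)).aestronglyMeasurable measurableSet_Ioi
    · filter_upwards [self_mem_nhdsWithin] with t ht
      filter_upwards [ae_restrict_mem measurableSet_Ioi] with v hv
      have hvt : 0 < v / t := div_pos hv.out ht.out
      rw [hker _ hvt, norm_smul, Real.norm_eq_abs, Real.abs_exp, norm_inv]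
      exact mul_le_of_le_one_right (Real.exp_pos _).le
        (inv_le_one_of_one_le₀ (one_le_norm_rootRatio hvt))
    · filter_upwards [ae_restrict_mem measurableSet_Ioi] with v hv
      refine Tendsto.const_smul ?_ _
      have h1 := (tendsto_rootRatio.inv₀ one_ne_zero).comp (tendsto_div_nhdsGT hv.out)
      rw [inv_one] at h1
      refine h1.congr' ?_
      filter_upwards [self_mem_nhdsWithin] with t ht
      exact (hker _ (div_pos hv.out ht.out)).symm
  rw [integral_exp_neg_smul] at hlim
  refine hlim.congr' ?_
  filter_upwards [self_mem_nhdsWithin] with t ht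
  rw [← Complex.real_smul, laplaceK₁, smul_laplace_eq (fun v => v • hankelKernel v) ht]

/-- The logarithm of `-2i`. -/
noncomputable def logShift : ℂ := Real.log 2 - Real.pi / 2 * Complex.I

lemma log_shift_zero : Complex.log (((0 : ℝ) : ℂ) - 2 * Complex.I) = logShift := by
  have : ((0 : ℝ) : ℂ) - 2 * Complex.I = ((2 : ℝ) : ℂ) * (-Complex.I) := by
    push_cast
    ring
  rw [this, Complex.log_ofReal_mul two_pos (by simp), Complex.log_neg_I, logShift]
  ring

/-- A primitive of the Hankel kernel. -/
noncomputable def kernelPrimitive (v : ℝ) : ℂ := 2 * Complex.log (√v + rootShift v) - logShift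

/-- The argument of √(-2i) is -π/4, inside the principal strip, so the logarithm inverts the
exponential and `logShift` is the right constant of integration. -/
lemma kernelPrimitive_zero : kernelPrimitive 0 = 0 := by
  have h : rootShift 0 = Complex.exp (logShift / 2) := by
    rw [rootShift, Complex.cpow_def_of_ne_zero (shift_ne_zero 0), log_shift_zero]
    rfl
  have him : (logShift / 2).im = -(Real.pi / 4) := by
    have : logShift / 2 = ((Real.log 2 / 2 : ℝ) : ℂ) + ((-(Real.pi / 4) : ℝ) : ℂ) * Complex.I := by
      rw [logShift]
      push_cast
      ring
    rw [this, Complex.add_im, Complex.ofReal_im, Complex.im_ofReal_mul, Complex.I_im]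
    ring
  rw [kernelPrimitive, Real.sqrt_zero, Complex.ofReal_zero, zero_add, h, Complex.log_exp]
  · ring
  · rw [him]
    linarith [Real.pi_pos]
  · rw [him]
    linarith [Real.pi_pos]

lemma one_le_re_sqrt_add_rootShift {v : ℝ} (hv : 0 ≤ v) : 1 ≤ ((√v : ℂ) + rootShift v).re := by
  have := one_le_re_rootShift hv
  have h2 := Real.sqrt_nonneg v
  simp
  linarith

lemma hasDerivAt_kernelPrimitive {v : ℝ} (hv : 0 < v) :
    HasDerivAt kernelPrimitive (hankelKernel v) v := by
  have hre := one_le_re_sqrt_add_rootShift hv.le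
  have h1 := ((hasDerivAt_sqrt_ofReal hv).add (hasDerivAt_rootShift v)).clog_real
    (by
      rw [Complex.mem_slitPlane_iff]
      left
      exact one_pos.trans_le hre)
  have h2 : HasDerivAt kernelPrimitive _ v := (h1.const_mul 2).sub_const logShift
  refine h2.congr_deriv ?_
  have h3 : (√v : ℂ) ≠ 0 := by exact_mod_cast (Real.sqrt_pos.2 hv).ne'
  have h4 := rootShift_ne_zero v
  have h5 : (√v : ℂ) + rootShift v ≠ 0 := by
    intro h
    rw [h] at hre
    norm_num at hre
  rw [hankelKernel]
  simp only [Pi.add_apply]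
  field_simp
  ring

lemma continuousWithinAt_kernelPrimitive : ContinuousWithinAt kernelPrimitive (Ici 0) 0 := by
  have h1 : ContinuousAt (fun v : ℝ => (√v : ℂ) + rootShift v) 0 :=
    ((Complex.continuous_ofReal.comp Real.continuous_sqrt).add
      continuous_rootShift).continuousAt
  have h2 := h1.clog (by
    rw [Complex.mem_slitPlane_iff]
    left
    exact one_pos.trans_le (one_le_re_sqrt_add_rootShift le_rfl))
  have h3 : ContinuousAt kernelPrimitive 0 := (h2.const_mul 2).sub_const logShift
  exact h3.continuousWithinAt

lemma norm_log_le {z : ℂ} (hz : 1 ≤ ‖z‖) : ‖Complex.log z‖ ≤ ‖z‖ + Real.pi := by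
  refine (Complex.norm_le_abs_re_add_abs_im _).trans (add_le_add ?_ ?_)
  · rw [Complex.log_re, abs_of_nonneg (Real.log_nonneg hz)]
    exact Real.log_le_self (norm_nonneg _)
  · rw [Complex.log_im]
    exact Complex.abs_arg_le_pi z

lemma norm_kernelPrimitive_le {v : ℝ} (hv : 0 < v) :
    ‖kernelPrimitive v‖ ≤ 4 * v + (6 + 2 * Real.pi + ‖logShift‖) := by
  have hre := one_le_re_sqrt_add_rootShift hv.le
  have h1 := norm_log_le (hre.trans (Complex.re_le_norm _))
  have h2 : ‖(√v : ℂ) + rootShift v‖ ≤ 2 * v + 3 := by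
    refine (norm_add_le _ _).trans ?_
    have h3 : ‖(√v : ℂ)‖ ≤ v + 1 := by
      rw [Complex.norm_real, Real.norm_eq_abs, abs_of_nonneg (Real.sqrt_nonneg v)]
      nlinarith [Real.sq_sqrt hv.le, sq_nonneg (√v - 1), Real.sqrt_nonneg v]
    have h4 : ‖rootShift v‖ ≤ v + 2 := by
      have h5 : ‖(v : ℂ) - 2 * Complex.I‖ ≤ v + 2 := by
        refine (norm_sub_le _ _).trans ?_
        simp [abs_of_pos hv]
      rw [← norm_rootShift_sq] at h5
      nlinarith [one_le_norm_rootShift hv.le]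
    linarith
  refine (norm_sub_le _ _).trans ?_
  rw [norm_mul, Complex.norm_two]
  linarith

lemma continuousOn_kernelPrimitive : ContinuousOn kernelPrimitive (Ioi 0) := fun _ hv =>
  (hasDerivAt_kernelPrimitive hv).continuousAt.continuousWithinAt

lemma integrableOn_kernelPrimitive {t : ℝ} (ht : 0 < t) :
    IntegrableOn (fun v => Real.exp (-(t * v)) • kernelPrimitive v) (Ioi 0) := by
  have i1 := (integrableOn_rpow_mul_exp_neg two_pos ht).const_mul 4
  have i2 := (integrableOn_rpow_mul_exp_neg one_pos ht).const_mul
    (6 + 2 * Real.pi + ‖logShift‖)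
  refine Integrable.mono' (i1.add i2) ?_ ?_
  · have h1 : Continuous fun v : ℝ => Real.exp (-(t * v)) := by fun_prop
    exact (h1.continuousOn.smul continuousOn_kernelPrimitive).aestronglyMeasurable
      measurableSet_Ioi
  · filter_upwards [ae_restrict_mem measurableSet_Ioi] with v hv
    rw [norm_smul, Real.norm_eq_abs, Real.abs_exp]
    have h2 := norm_kernelPrimitive_le hv.out
    have h3 : (v : ℝ) ^ ((2 : ℝ) - 1) = v := by norm_num
    have h4 : (v : ℝ) ^ ((1 : ℝ) - 1) = 1 := by norm_num
    simp only [Pi.add_apply, h3, h4]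
    nlinarith [Real.exp_pos (-(t * v))]

/-- After integration by parts and rescaling, the logarithmic growth of the primitive at infinity
becomes the singularity -log t. -/
lemma laplaceK_eq {t : ℝ} (ht : 0 < t) :
    laplaceK t = ∫ v in Ioi (0 : ℝ), Real.exp (-v) • kernelPrimitive (v / t) := by
  rw [laplaceK, laplace_deriv_eq kernelPrimitive_zero continuousWithinAt_kernelPrimitive
    (fun v hv => hasDerivAt_kernelPrimitive hv) (integrableOn_kernelPrimitive ht)
    (integrableOn_laplaceK ht), smul_laplace_eq kernelPrimitive ht]

/-- The primitive of the Hankel kernel without its logarithmic growth. -/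
noncomputable def regularPart (v : ℝ) : ℂ := 2 * Complex.log (1 + rootRatio v) - logShift

lemma kernelPrimitive_eq {v : ℝ} (hv : 0 < v) :
    kernelPrimitive v = (Real.log v : ℂ) + regularPart v := by
  have hs : 0 < √v := Real.sqrt_pos.2 hv
  have hs' : (√v : ℂ) ≠ 0 := by exact_mod_cast hs.ne'
  have h1 : (√v : ℂ) + rootShift v = (√v : ℂ) * (1 + rootRatio v) := by
    rw [rootRatio]
    field_simp
  have h2 : 1 + rootRatio v ≠ 0 := by
    intro h
    have := congrArg Complex.re h
    have h3 := re_rootRatio_nonneg hv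
    simp at this
    linarith
  rw [kernelPrimitive, regularPart, h1, Complex.log_ofReal_mul hs h2, Real.log_sqrt hv.le]
  push_cast
  ring

lemma tendsto_regularPart : Tendsto regularPart atTop
    (𝓝 ((Real.log 2 : ℂ) + Real.pi / 2 * Complex.I)) := by
  have h1 : Tendsto (fun v => 1 + rootRatio v) atTop (𝓝 (1 + 1)) :=
    tendsto_rootRatio.const_add 1
  have h2 := ((h1.clog (by rw [Complex.mem_slitPlane_iff]; left; norm_num)).const_mul
    2).sub_const logShift
  have h3 : 2 * Complex.log (1 + 1) - logShift = (Real.log 2 : ℂ) + Real.pi / 2 * Complex.I := by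
    rw [logShift, show (1 : ℂ) + 1 = ((2 : ℝ) : ℂ) by norm_num, ← Complex.ofReal_log two_pos.le]
    ring
  rw [h3] at h2
  exact h2

lemma norm_regularPart_le {v : ℝ} (hv : 0 < v) :
    ‖regularPart v‖ ≤ 4 * v ^ ((1 : ℝ) / 2 - 1) + (4 + 2 * Real.pi + ‖logShift‖) := by
  have h0 : 1 ≤ ‖1 + rootRatio v‖ := by
    refine le_trans ?_ (Complex.re_le_norm _)
    simp [re_rootRatio_nonneg hv]
  have h1 := norm_log_le h0
  have h2 : ‖1 + rootRatio v‖ ≤ 2 + 2 * v ^ ((1 : ℝ) / 2 - 1) := by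
    refine (norm_add_le _ _).trans ?_
    have := norm_rootRatio_le hv
    rw [norm_one]
    linarith
  refine (norm_sub_le _ _).trans ?_
  rw [norm_mul, Complex.norm_two]
  linarith

lemma continuousOn_regularPart : ContinuousOn regularPart (Ioi 0) := by
  have : ∀ v ∈ Ioi (0 : ℝ), regularPart v = kernelPrimitive v - (Real.log v : ℂ) := fun v hv => by
    rw [kernelPrimitive_eq hv]
    ring
  refine ContinuousOn.congr (continuousOn_kernelPrimitive.sub ?_) this
  exact Complex.continuous_ofReal.comp_continuousOn
    (Real.continuousOn_log.mono fun v hv => ne_of_gt hv)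

/-- The dominating function for the regular part. -/
noncomputable def regularBound (v : ℝ) : ℝ :=
  4 * (v ^ ((1 : ℝ) / 2 - 1) * Real.exp (-v)) + (4 + 2 * Real.pi + ‖logShift‖) * Real.exp (-v)

lemma integrableOn_regularBound : IntegrableOn regularBound (Ioi 0) := by
  have i1 := (integrableOn_rpow_mul_exp_neg (a := 1 / 2) (by norm_num) one_pos).const_mul 4
  simp only [one_mul] at i1
  exact i1.add (integrableOn_exp_neg.const_mul _)

lemma aestronglyMeasurable_regularPart {t : ℝ} (ht : 0 < t) : AEStronglyMeasurable
    (fun v => Real.exp (-v) • regularPart (v / t)) (volume.restrict (Ioi 0)) := by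
  have h1 : Continuous fun v : ℝ => Real.exp (-v) := by fun_prop
  have h2 : Continuous fun v : ℝ => v / t := by fun_prop
  exact (h1.continuousOn.smul (continuousOn_regularPart.comp h2.continuousOn
    fun v hv => div_pos hv.out ht)).aestronglyMeasurable measurableSet_Ioi

/-- For t ≤ 1 one has v/t ≥ v, and the power in the bound is negative; so one dominating function
serves all these t. -/
lemma norm_regularPart_div_le {t : ℝ} (ht : 0 < t) (ht1 : t ≤ 1) : ∀ᵐ v ∂volume.restrict (Ioi 0),
    ‖Real.exp (-v) • regularPart (v / t)‖ ≤ regularBound v := by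
  filter_upwards [ae_restrict_mem measurableSet_Ioi] with v hv
  have hv0 : 0 < v := hv
  have h1 := norm_regularPart_le (div_pos hv0 ht)
  have h2 : (v / t) ^ ((1 : ℝ) / 2 - 1) ≤ v ^ ((1 : ℝ) / 2 - 1) :=
    Real.rpow_le_rpow_of_nonpos hv0 (by rw [le_div_iff₀ ht]; nlinarith) (by norm_num)
  rw [norm_smul, Real.norm_eq_abs, Real.abs_exp, regularBound]
  calc _ ≤ Real.exp (-v) * (4 * v ^ ((1 : ℝ) / 2 - 1) + (4 + 2 * Real.pi + ‖logShift‖)) := by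
        gcongr
        linarith
    _ = _ := by ring

/-- This is Γ'(1) = -γ, with Γ' computed by differentiating Euler's integral. -/
lemma integral_exp_neg_mul_log :
    ∫ v in Ioi (0 : ℝ), Real.exp (-v) • (Real.log v : ℂ) = -(Real.eulerMascheroniConstant : ℂ) := by
  have h1 := Complex.hasDerivAt_GammaIntegral (s := 1) (by simp)
  have h2 : HasDerivAt Complex.GammaIntegral (-(Real.eulerMascheroniConstant : ℂ)) 1 := by
    refine Complex.hasDerivAt_Gamma_one.congr_of_eventuallyEq ?_
    have : ∀ᶠ s : ℂ in 𝓝 1, 0 < s.re :=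
      Complex.continuous_re.continuousAt.eventually (lt_mem_nhds (by simp))
    filter_upwards [this] with s hs
    exact (Complex.Gamma_eq_integral hs).symm
  rw [← h1.unique h2]
  refine setIntegral_congr_fun measurableSet_Ioi fun v _ => ?_
  simp
  ring

/-- The logarithmic singularity of the Laplace transform of the Hankel kernel at zero. -/
lemma tendsto_laplaceK_add_log : Tendsto
    (fun t : ℝ => laplaceK t + ((Real.log (t / 2) + Real.eulerMascheroniConstant : ℝ) : ℂ))
    (𝓝[>] 0) (𝓝 (Real.pi / 2 * Complex.I)) := by
  have hlim : Tendsto (fun t : ℝ => ∫ v in Ioi (0 : ℝ), Real.exp (-v) • regularPart (v / t))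
      (𝓝[>] 0) (𝓝 (∫ v in Ioi (0 : ℝ), Real.exp (-v) •
        ((Real.log 2 : ℂ) + Real.pi / 2 * Complex.I))) := by
    refine tendsto_integral_filter_of_dominated_convergence regularBound ?_ ?_
      integrableOn_regularBound ?_
    · filter_upwards [self_mem_nhdsWithin] with t ht using aestronglyMeasurable_regularPart ht
    · filter_upwards [Ioc_mem_nhdsGT (one_pos : (0 : ℝ) < 1)] with t ht using
        norm_regularPart_div_le ht.1 ht.2
    · filter_upwards [ae_restrict_mem measurableSet_Ioi] with v hv
      exact (tendsto_regularPart.comp (tendsto_div_nhdsGT hv.out)).const_smul _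
  rw [integral_exp_neg_smul] at hlim
  have hlim' := hlim.sub_const (Real.log 2 : ℂ)
  rw [add_sub_cancel_left] at hlim'
  refine hlim'.congr' ?_
  filter_upwards [Ioc_mem_nhdsGT (one_pos : (0 : ℝ) < 1)] with t ht
  have hreg : IntegrableOn (fun v => Real.exp (-v) • regularPart (v / t)) (Ioi 0) :=
    Integrable.mono' integrableOn_regularBound (aestronglyMeasurable_regularPart ht.1)
      (norm_regularPart_div_le ht.1 ht.2)
  have hprim : IntegrableOn (fun v => Real.exp (-v) • kernelPrimitive v) (Ioi 0) := by
    simpa using integrableOn_kernelPrimitive one_pos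
  have hreg1 : IntegrableOn (fun v => Real.exp (-v) • regularPart v) (Ioi 0) := by
    have := Integrable.mono' integrableOn_regularBound (aestronglyMeasurable_regularPart one_pos)
      (norm_regularPart_div_le one_pos le_rfl)
    simp only [div_one] at this
    exact this
  -- The logarithm is the primitive minus its regular part, both integrable against e^(-v).
  have hlog : IntegrableOn (fun v => Real.exp (-v) • (Real.log v : ℂ)) (Ioi 0) := by
    refine (hprim.sub hreg1).congr_fun (fun v hv => ?_) measurableSet_Ioi
    simp only [Pi.sub_apply, kernelPrimitive_eq hv.out]
    rw [← smul_sub, add_sub_cancel_right]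
  have hcst : IntegrableOn (fun v : ℝ => Real.exp (-v) • (Real.log t : ℂ)) (Ioi 0) :=
    integrableOn_exp_neg.smul_const _
  have hsplit : ∀ v ∈ Ioi (0 : ℝ), Real.exp (-v) • kernelPrimitive (v / t) =
      Real.exp (-v) • (Real.log v : ℂ) - Real.exp (-v) • (Real.log t : ℂ) +
        Real.exp (-v) • regularPart (v / t) := by
    intro v hv
    rw [kernelPrimitive_eq (div_pos hv.out ht.1), Real.log_div hv.out.ne' ht.1.ne', smul_add,
      Complex.ofReal_sub, smul_sub]
  have hsum := integral_add (hlog.sub hcst) hreg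
  have hdiff := integral_sub hlog hcst
  simp only [Pi.sub_apply] at hsum
  rw [laplaceK_eq ht.1, setIntegral_congr_fun measurableSet_Ioi hsplit, hsum, hdiff,
    integral_exp_neg_mul_log, integral_exp_neg_smul, Real.log_div ht.1.ne' two_ne_zero]
  push_cast
  ring

end LaplaceAsymptotics

/-! ### The Hankel function -/

section Hankel

/-- The logarithmic term `log (t / 2) + γ` of `Y₀`. -/
noncomputable def logTerm (t : ℝ) : ℝ := Real.log (t / 2) + Real.eulerMascheroniConstant

lemma tendsto_mul_logTerm : Tendsto (fun t => t * logTerm t) (𝓝[>] 0) (𝓝 0) := by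
  have h1 : Tendsto (fun t : ℝ => Real.log t * t) (𝓝[>] 0) (𝓝 0) := by
    refine (tendsto_log_mul_rpow_nhdsGT_zero one_pos).congr fun t => ?_
    rw [Real.rpow_one]
  have h2 : Tendsto (fun t : ℝ => t * (Real.eulerMascheroniConstant - Real.log 2)) (𝓝[>] 0)
      (𝓝 (0 * (Real.eulerMascheroniConstant - Real.log 2))) :=
    (tendsto_id.mono_left nhdsWithin_le_nhds).mul_const _
  rw [zero_mul] at h2
  have h3 := h1.add h2
  rw [add_zero] at h3
  refine h3.congr' ?_
  filter_upwards [self_mem_nhdsWithin] with t ht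
  rw [logTerm, Real.log_div (ne_of_gt ht) two_ne_zero]
  ring

lemma continuous_powSum {c : ℕ → ℝ} (hc : IsEntireCoeff c) : Continuous (powSum c) :=
  continuous_iff_continuousAt.2 fun x => (hasDerivAt_powSum hc x).continuousAt

lemma powSum_zero (c : ℕ → ℝ) : powSum c 0 = c 0 := by
  rw [powSum, tsum_eq_single 0 fun m hm => by simp [hm]]
  simp

lemma tendsto_powSum_sq {c : ℕ → ℝ} (hc : IsEntireCoeff c) :
    Tendsto (fun t : ℝ => powSum c ((t / 2) ^ 2)) (𝓝[>] 0) (𝓝 (c 0)) := by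
  have h1 : Continuous fun t : ℝ => powSum c ((t / 2) ^ 2) :=
    (continuous_powSum hc).comp (by fun_prop)
  have h2 := (h1.tendsto 0).mono_left (nhdsWithin_le_nhds (s := Ioi (0 : ℝ)))
  simpa [powSum_zero] using h2

lemma tendsto_besselJ0 : Tendsto besselJ0 (𝓝[>] 0) (𝓝 1) := by
  have h := tendsto_powSum_sq isEntireCoeff_coeffJ
  rw [funext besselJ0_eq]
  simpa [coeffJ] using h

/-- J₀ is even, so J₀ - 1 = o(t), while t log t tends to zero. -/
lemma tendsto_besselJ0_sub_one_mul_logTerm :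
    Tendsto (fun t => (besselJ0 t - 1) * logTerm t) (𝓝[>] 0) (𝓝 0) := by
  have h1 := (hasDerivAt_powSum_sq isEntireCoeff_coeffJ 0).tendsto_slope_zero_right
  simp only [zero_div, mul_zero, zero_add] at h1
  have h2 := h1.mul tendsto_mul_logTerm
  rw [mul_zero] at h2
  refine h2.congr' ?_
  filter_upwards [self_mem_nhdsWithin] with t ht
  have h3 : powSum coeffJ (0 ^ 2) = 1 := by
    rw [zero_pow two_ne_zero, powSum_zero]
    simp [coeffJ]
  rw [h3, besselJ0_eq, smul_eq_mul]
  have := ne_of_gt ht.out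
  field_simp

lemma tendsto_mul_self_powSum {c : ℕ → ℝ} (hc : IsEntireCoeff c) :
    Tendsto (fun t : ℝ => t / 2 * powSum c ((t / 2) ^ 2)) (𝓝[>] 0) (𝓝 0) := by
  have h1 : Tendsto (fun t : ℝ => t / 2) (𝓝[>] 0) (𝓝 (0 / 2)) :=
    (tendsto_id.mono_left nhdsWithin_le_nhds).div_const _
  simpa using h1.mul (tendsto_powSum_sq hc)

lemma tendsto_scaled_powSum {c : ℕ → ℝ} (hc : IsEntireCoeff c) :
    Tendsto (fun t : ℝ => 2 * (t / 2) ^ 2 * powSum c ((t / 2) ^ 2)) (𝓝[>] 0) (𝓝 0) := by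
  have h1 : Tendsto (fun t : ℝ => t) (𝓝[>] 0) (𝓝 0) := tendsto_id.mono_left nhdsWithin_le_nhds
  have h2 := h1.mul (tendsto_mul_self_powSum hc)
  rw [mul_zero] at h2
  refine h2.congr fun t => ?_
  ring

lemma tendsto_scaledDerivJ : Tendsto scaledDerivJ (𝓝[>] 0) (𝓝 0) :=
  tendsto_scaled_powSum isEntireCoeff_coeffJ.derivCoeff

lemma tendsto_scaledDerivJ_mul_logTerm :
    Tendsto (fun t => logTerm t * scaledDerivJ t) (𝓝[>] 0) (𝓝 0) := by
  have h := tendsto_mul_logTerm.mul (tendsto_mul_self_powSum isEntireCoeff_coeffJ.derivCoeff)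
  rw [mul_zero] at h
  refine h.congr fun t => ?_
  rw [scaledDerivJ]
  ring

lemma tendsto_besselY0_sub : Tendsto (fun t => besselY0 t - 2 / Real.pi * logTerm t) (𝓝[>] 0)
    (𝓝 0) := by
  have h1 := (tendsto_besselJ0_sub_one_mul_logTerm.sub
    (tendsto_powSum_sq isEntireCoeff_coeffY)).const_mul (2 / Real.pi)
  have h2 : coeffY 0 = 0 := by simp [coeffY]
  rw [h2, sub_zero, mul_zero] at h1
  refine h1.congr fun t => ?_
  rw [besselY0_eq, logTerm]
  ring

lemma tendsto_scaledDerivY : Tendsto scaledDerivY (𝓝[>] 0) (𝓝 (2 / Real.pi)) := by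
  have h := ((tendsto_besselJ0.add tendsto_scaledDerivJ_mul_logTerm).sub
    (tendsto_scaled_powSum isEntireCoeff_coeffY.derivCoeff)).const_mul (2 / Real.pi)
  rw [add_zero, sub_zero, mul_one] at h
  exact h

lemma tendsto_ofReal_complex {f : ℝ → ℝ} {l : Filter ℝ} {a : ℝ} (h : Tendsto f l (𝓝 a)) :
    Tendsto (fun t => (f t : ℂ)) l (𝓝 (a : ℂ)) :=
  (Complex.continuous_ofReal.tendsto a).comp h

lemma tendsto_hankelH0_sub : Tendsto
    (fun t => hankelH0 t - 2 * Complex.I / Real.pi * (logTerm t : ℂ)) (𝓝[>] 0) (𝓝 1) := by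
  have h := (tendsto_ofReal_complex tendsto_besselJ0).add
    ((tendsto_ofReal_complex tendsto_besselY0_sub).const_mul Complex.I)
  simp only [Complex.ofReal_one, Complex.ofReal_zero, mul_zero, add_zero] at h
  refine h.congr fun t => ?_
  rw [hankelH0]
  push_cast
  ring

lemma tendsto_scaledDerivH : Tendsto scaledDerivH (𝓝[>] 0) (𝓝 (2 * Complex.I / Real.pi)) := by
  have h := (tendsto_ofReal_complex tendsto_scaledDerivJ).add
    ((tendsto_ofReal_complex tendsto_scaledDerivY).const_mul Complex.I)
  have e : ((0 : ℝ) : ℂ) + Complex.I * ((2 / Real.pi : ℝ) : ℂ) = 2 * Complex.I / Real.pi := by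
    push_cast
    ring
  rw [e] at h
  exact h

lemma tendsto_mul_laplaceK : Tendsto (fun t : ℝ => (t : ℂ) * laplaceK t) (𝓝[>] 0) (𝓝 0) := by
  have h1 : Tendsto (fun t : ℝ => (t : ℂ)) (𝓝[>] 0) (𝓝 ((0 : ℝ) : ℂ)) :=
    tendsto_ofReal_complex (tendsto_id.mono_left nhdsWithin_le_nhds)
  have h2 := (h1.mul tendsto_laplaceK_add_log).sub (tendsto_ofReal_complex tendsto_mul_logTerm)
  simp only [Complex.ofReal_zero, zero_mul, sub_zero] at h2
  refine h2.congr fun t => ?_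
  rw [logTerm]
  push_cast
  ring

lemma tendsto_exp_I_mul : Tendsto (fun t : ℝ => Complex.exp (Complex.I * t)) (𝓝[>] 0) (𝓝 1) := by
  have h : Continuous fun t : ℝ => Complex.exp (Complex.I * t) := by fun_prop
  have h2 := (h.tendsto 0).mono_left (nhdsWithin_le_nhds (s := Ioi (0 : ℝ)))
  simpa using h2

/-- The factor e^(it) - 1 is O(t) and removes the logarithm, so the exponential does not alter the
limit. -/
lemma tendsto_outgoingK_sub : Tendsto (fun t => outgoingK t + (logTerm t : ℂ)) (𝓝[>] 0)
    (𝓝 (Real.pi / 2 * Complex.I)) := by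
  have h1 := (hasDerivAt_exp_I_mul 0).tendsto_slope_zero_right
  have h2 := (h1.mul tendsto_mul_laplaceK).add tendsto_laplaceK_add_log
  simp only [mul_zero, zero_add] at h2
  refine h2.congr' ?_
  filter_upwards [self_mem_nhdsWithin] with t ht
  have ht0 : (t : ℂ) ≠ 0 := by exact_mod_cast ne_of_gt ht.out
  rw [outgoingK, logTerm, Complex.real_smul, Complex.ofReal_inv]
  simp only [Complex.ofReal_zero, mul_zero, Complex.exp_zero]
  field_simp
  ring

lemma tendsto_scaledDerivK : Tendsto scaledDerivK (𝓝[>] 0) (𝓝 (-1)) := by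
  have h := tendsto_exp_I_mul.mul ((tendsto_mul_laplaceK.const_mul Complex.I).sub
    tendsto_mul_laplaceK₁)
  simp only [mul_zero, zero_sub, one_mul] at h
  refine h.congr fun t => ?_
  rw [scaledDerivK]
  ring

/-- The Hankel function as a Laplace integral. -/
theorem hankelH0_eq {t : ℝ} (ht : 0 < t) :
    hankelH0 t = -(2 * Complex.I / Real.pi) * outgoingK t := by
  have hpi : (Real.pi : ℂ) ≠ 0 := by exact_mod_cast Real.pi_ne_zero
  -- c matches the logarithmic singularities. The constant terms then match too, which excludes an
  -- added multiple of J₀.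
  set c : ℂ := -(2 * Complex.I / Real.pi) with hc
  set f : ℝ → ℂ := fun t => hankelH0 t - c * outgoingK t with hf
  set g : ℝ → ℂ := fun t => scaledDerivH t - c * scaledDerivK t with hg
  have hpair : IsBesselPair f g := isBesselPair_hankelH0.sub_const_mul isBesselPair_outgoingK c
  have hJ := tendsto_ofReal_complex tendsto_besselJ0
  have hJ' := tendsto_ofReal_complex tendsto_scaledDerivJ
  rw [Complex.ofReal_one] at hJ
  rw [Complex.ofReal_zero] at hJ'
  have hf0 : Tendsto f (𝓝[>] 0) (𝓝 0) := by
    have h := tendsto_hankelH0_sub.sub (tendsto_outgoingK_sub.const_mul c)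
    have e : 1 - c * (Real.pi / 2 * Complex.I) = 0 := by
      rw [hc]
      field_simp
      linear_combination Complex.I_sq
    rw [e] at h
    refine h.congr fun t => ?_
    rw [hf, hc]
    ring
  have hg0 : Tendsto g (𝓝[>] 0) (𝓝 0) := by
    have h := tendsto_scaledDerivH.sub (tendsto_scaledDerivK.const_mul c)
    have e : 2 * Complex.I / Real.pi - c * -1 = 0 := by
      rw [hc]
      ring
    rwa [e] at h
  have hHJ' : Tendsto (fun t => hankelH0 t * (scaledDerivJ t : ℂ)) (𝓝[>] 0) (𝓝 0) := by
    have h1 := (tendsto_hankelH0_sub.mul hJ').add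
      ((tendsto_ofReal_complex tendsto_scaledDerivJ_mul_logTerm).const_mul
        (2 * Complex.I / Real.pi))
    simp only [Complex.ofReal_zero, mul_zero, add_zero] at h1
    refine h1.congr fun t => ?_
    push_cast
    ring
  have w1 : ∀ s : ℝ, 0 < s → f s * (scaledDerivJ s : ℂ) - (besselJ0 s : ℂ) * g s = 0 :=
    fun s hs => hpair.wronskian_eq isBesselPair_besselJ0
      (by simpa using (hf0.mul hJ').sub (hJ.mul hg0)) hs
  have w2 : ∀ s : ℝ, 0 < s → (besselJ0 s : ℂ) * scaledDerivH s -
      hankelH0 s * (scaledDerivJ s : ℂ) = 2 * Complex.I / Real.pi :=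
    fun s hs => isBesselPair_besselJ0.wronskian_eq isBesselPair_hankelH0
      (by simpa using (hJ.mul tendsto_scaledDerivH).sub hHJ') hs
  -- The Wronskian of f and H₀ is constant, but its value cannot be read off at the origin, where H₀
  -- g is a logarithm times o(1); it is kept as its value at t. Since f and J₀ have Wronskian zero,
  -- f is a multiple of J₀.
  have w3 : ∀ s : ℝ, 0 < s → f s * (2 * Complex.I / Real.pi) =
      (besselJ0 s : ℂ) * (f t * scaledDerivH t - hankelH0 t * g t) := by
    intro s hs
    have hder : f s * scaledDerivH s - hankelH0 s * g s =
        f t * scaledDerivH t - hankelH0 t * g t := by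
      have hd : ∀ y ∈ Ioi (0 : ℝ), HasDerivAt
          (fun t => f t * scaledDerivH t - hankelH0 t * g t) 0 y := by
        intro y hy
        have hy' : (y : ℂ) ≠ 0 := by exact_mod_cast (ne_of_gt hy.out)
        refine (((hpair y hy).1.mul (isBesselPair_hankelH0 y hy).2).sub
          ((isBesselPair_hankelH0 y hy).1.mul (hpair y hy).2)).congr_deriv ?_
        field_simp
        ring
      exact isOpen_Ioi.is_const_of_deriv_eq_zero isPreconnected_Ioi
        (fun y hy => (hd y hy).differentiableAt.differentiableWithinAt)
        (fun y hy => (hd y hy).deriv) hs ht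
    rw [← w2 s hs, ← hder]
    linear_combination -hankelH0 s * w1 s hs
  -- At the origin f tends to 0 and J₀ to 1, so the multiple is zero.
  have hk : f t * scaledDerivH t - hankelH0 t * g t = 0 := by
    have h1 := hf0.mul_const (2 * Complex.I / Real.pi)
    have h2 := hJ.mul_const (f t * scaledDerivH t - hankelH0 t * g t)
    rw [zero_mul] at h1
    rw [one_mul] at h2
    refine tendsto_nhds_unique (h2.congr' ?_) h1
    filter_upwards [self_mem_nhdsWithin] with s hs
    exact (w3 s hs).symm
  have h0 := w3 t ht
  rw [hk, mul_zero] at h0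
  have hne : (2 * Complex.I / Real.pi : ℂ) ≠ 0 := by simp [hpi]
  have hft : f t = 0 := (mul_eq_zero.1 h0).resolve_right hne
  exact sub_eq_zero.1 hft

end Hankel

/-! ### The radial profiles of the fundamental solution -/

section Profiles

lemma toSphere_real_univ_two :
    (volume : Measure (Space 2)).toSphere.real univ = 2 * Real.pi := by
  have h := EuclideanSpace.volume_ball_fin_two (0 : Space 2) 1
  rw [Measure.toSphere_real_apply_univ, measureReal_def, h]
  simp [Real.pi_pos.le]

lemma toSphere_real_univ_three :
    (volume : Measure (Space 3)).toSphere.real univ = 4 * Real.pi := by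
  have h := EuclideanSpace.volume_ball_fin_three (0 : Space 3) 1
  rw [Measure.toSphere_real_apply_univ, measureReal_def, h]
  have h2 : 0 ≤ Real.pi * (4 / 3) := by positivity
  simp [ENNReal.toReal_ofReal, h2, mul_div_assoc]
  ring

/-- The radial profile of the fundamental solution in the plane. -/
noncomputable def profileTwo (κ ρ : ℝ) : ℂ := Complex.I / 4 * hankelH0 (κ * ρ)

/-- The derivative of `profileTwo`. -/
noncomputable def derivProfileTwo (κ ρ : ℝ) : ℂ :=
  (2 * Real.pi : ℂ)⁻¹ * (scaledDerivK (κ * ρ) / ρ)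

lemma profileTwo_eq {κ ρ : ℝ} (hκ : 0 < κ) (hρ : 0 < ρ) :
    profileTwo κ ρ = (2 * Real.pi : ℂ)⁻¹ * outgoingK (κ * ρ) := by
  have hpi : (Real.pi : ℂ) ≠ 0 := by exact_mod_cast Real.pi_ne_zero
  rw [profileTwo, hankelH0_eq (mul_pos hκ hρ)]
  field_simp
  linear_combination (-4 * outgoingK (κ * ρ)) * Complex.I_sq

lemma hasDerivAt_outgoingK_scaled {κ ρ : ℝ} (hκ : 0 < κ) (hρ : 0 < ρ) :
    HasDerivAt (fun ρ => outgoingK (κ * ρ)) (scaledDerivK (κ * ρ) / ρ) ρ ∧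
    HasDerivAt (fun ρ => scaledDerivK (κ * ρ)) (-((κ : ℂ) ^ 2 * ρ * outgoingK (κ * ρ))) ρ := by
  obtain ⟨h1, h2⟩ := isBesselPair_outgoingK (κ * ρ) (mul_pos hκ hρ)
  have hm : HasDerivAt (fun ρ : ℝ => κ * ρ) κ ρ := by
    simpa using (hasDerivAt_id ρ).const_mul κ
  have hκ0 : (κ : ℂ) ≠ 0 := by exact_mod_cast hκ.ne'
  have hρ0 : (ρ : ℂ) ≠ 0 := by exact_mod_cast hρ.ne'
  constructor
  · refine (h1.scomp ρ hm).congr_deriv ?_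
    rw [Complex.real_smul]
    push_cast
    field_simp
  · refine (h2.scomp ρ hm).congr_deriv ?_
    rw [Complex.real_smul]
    push_cast
    ring

lemma tendsto_const_mul_nhdsGT_zero {κ : ℝ} (hκ : 0 < κ) :
    Tendsto (fun ρ : ℝ => κ * ρ) (𝓝[>] 0) (𝓝[>] 0) := by
  refine tendsto_nhdsWithin_iff.2 ⟨?_, ?_⟩
  · have h : Continuous fun ρ : ℝ => κ * ρ := by fun_prop
    have h2 := (h.tendsto 0).mono_left (nhdsWithin_le_nhds (s := Ioi (0 : ℝ)))
    rwa [mul_zero] at h2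
  · filter_upwards [self_mem_nhdsWithin] with ρ hρ using mul_pos hκ hρ

/-- The conditions at the origin come from the limits of the Laplace transforms, those at infinity
from their Gamma function bounds. -/
lemma isOutgoingProfile_two {κ : ℝ} (hκ : 0 < κ) :
    IsOutgoingProfile 2 κ (profileTwo κ) (derivProfileTwo κ) := by
  have hpi : (Real.pi : ℂ) ≠ 0 := by exact_mod_cast Real.pi_ne_zero
  have hκ0 : (κ : ℂ) ≠ 0 := by exact_mod_cast hκ.ne'
  have hexp : (((2 : ℕ) : ℝ) - 1) / 2 = 1 / 2 := by norm_num
  refine ⟨fun ρ hρ => ?_, fun ρ hρ => ?_, ?_, ?_, ?_, ?_⟩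
  · refine ((hasDerivAt_outgoingK_scaled hκ hρ).1.const_mul _).congr_of_eventuallyEq ?_
    filter_upwards [lt_mem_nhds hρ] with r hr using profileTwo_eq hκ hr
  · have hρ0 : (ρ : ℂ) ≠ 0 := by exact_mod_cast hρ.ne'
    refine (((hasDerivAt_outgoingK_scaled hκ hρ).2.div (hasDerivAt_id ρ).ofReal_comp
      hρ0).const_mul (2 * Real.pi : ℂ)⁻¹).congr_deriv ?_
    rw [profileTwo_eq hκ hρ, derivProfileTwo]
    simp only [id, Complex.ofReal_one]
    push_cast
    field_simp
    ring
  · have h := ((tendsto_exp_I_mul.mul tendsto_mul_laplaceK).comp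
      (tendsto_const_mul_nhdsGT_zero hκ)).const_mul ((2 * Real.pi : ℂ)⁻¹ * (κ : ℂ)⁻¹)
    simp only [mul_zero] at h
    refine h.congr' ?_
    filter_upwards [self_mem_nhdsWithin] with ρ hρ
    rw [profileTwo_eq hκ hρ, Complex.real_smul, Function.comp_apply, outgoingK]
    push_cast
    field_simp
    try ring
  · have h := (tendsto_scaledDerivK.comp (tendsto_const_mul_nhdsGT_zero hκ)).const_mul
      (2 * Real.pi : ℂ)⁻¹
    have e : (2 * Real.pi : ℂ)⁻¹ * -1 =
        -((volume : Measure (Space 2)).toSphere.real univ : ℂ)⁻¹ := by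
      rw [toSphere_real_univ_two]
      push_cast
      ring
    rw [e] at h
    refine h.congr' ?_
    filter_upwards [self_mem_nhdsWithin] with ρ hρ
    have hρ0 : (ρ : ℂ) ≠ 0 := by exact_mod_cast hρ.out.ne'
    rw [derivProfileTwo, Complex.real_smul, Function.comp_apply]
    push_cast
    field_simp
  · refine ⟨(2 * Real.pi)⁻¹ * ((1 / κ) ^ ((1 : ℝ) / 2) * Real.Gamma (1 / 2)), ?_⟩
    filter_upwards [eventually_gt_atTop 0] with ρ hρ
    rw [profileTwo_eq hκ hρ, norm_mul, outgoingK, norm_mul, Complex.norm_exp_I_mul_ofReal, one_mul,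
      hexp]
    have h2 : ‖(2 * Real.pi : ℂ)⁻¹‖ = (2 * Real.pi)⁻¹ := by
      rw [norm_inv, norm_mul, Complex.norm_real, Real.norm_of_nonneg Real.pi_pos.le]
      simp
    have h3 : (1 / (κ * ρ)) ^ ((1 : ℝ) / 2) = (1 / κ) ^ ((1 : ℝ) / 2) * (ρ ^ ((1 : ℝ) / 2))⁻¹ := by
      rw [one_div, mul_inv, ← one_div κ, Real.mul_rpow (by positivity) (by positivity),
        Real.inv_rpow hρ.le]
    have h4 := norm_laplaceK_le (mul_pos hκ hρ)
    rw [h3] at h4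
    have h5 : 0 < ρ ^ ((1 : ℝ) / 2) := by positivity
    rw [h2]
    calc _ ≤ ρ ^ ((1 : ℝ) / 2) * ((2 * Real.pi)⁻¹ * ((1 / κ) ^ ((1 : ℝ) / 2) *
          (ρ ^ ((1 : ℝ) / 2))⁻¹ * Real.Gamma (1 / 2))) := by gcongr
      _ = _ := by field_simp
  · have hlim : Tendsto (fun ρ : ℝ => ((2 * Real.pi)⁻¹ * κ * ((1 / κ) ^ ((3 : ℝ) / 2) *
        Real.Gamma (3 / 2))) * ρ⁻¹) atTop (𝓝 0) := by
      simpa using tendsto_inv_atTop_zero.const_mul ((2 * Real.pi)⁻¹ * κ * ((1 / κ) ^ ((3 : ℝ) / 2) *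
        Real.Gamma (3 / 2)))
    refine squeeze_zero' ?_ ?_ hlim
    · filter_upwards [eventually_ge_atTop 0] with ρ hρ
      positivity
    · filter_upwards [eventually_gt_atTop 0] with ρ hρ
      have hρ0 : (ρ : ℂ) ≠ 0 := by exact_mod_cast hρ.ne'
      -- Subtracting iκ times the profile cancels the derivative of the exponential. What remains is
      -- the transform with an additional factor v, of order ρ^(-3/2), one power of ρ better than
      -- the profile bound.
      have h1 : derivProfileTwo κ ρ - Complex.I * κ * profileTwo κ ρ =
          -((2 * Real.pi : ℂ)⁻¹ * κ * (Complex.exp (Complex.I * (κ * ρ : ℝ)) *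
            laplaceK₁ (κ * ρ))) := by
        rw [profileTwo_eq hκ hρ, derivProfileTwo, scaledDerivK, outgoingK]
        push_cast
        field_simp
        ring
      have h2 : ‖(2 * Real.pi : ℂ)⁻¹‖ = (2 * Real.pi)⁻¹ := by
        rw [norm_inv, norm_mul, Complex.norm_real, Real.norm_of_nonneg Real.pi_pos.le]
        simp
      have h3 : (1 / (κ * ρ)) ^ ((3 : ℝ) / 2) =
          (1 / κ) ^ ((3 : ℝ) / 2) * (ρ ^ ((1 : ℝ) / 2) * ρ)⁻¹ := by
        rw [one_div, mul_inv, ← one_div κ, Real.mul_rpow (by positivity) (by positivity),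
          Real.inv_rpow hρ.le, ← Real.rpow_add_one hρ.ne']
        norm_num
      have h4 := norm_laplaceK₁_le (mul_pos hκ hρ)
      rw [h3] at h4
      have h5 : 0 < ρ ^ ((1 : ℝ) / 2) := by positivity
      rw [h1, norm_neg, norm_mul, norm_mul, norm_mul, Complex.norm_exp_I_mul_ofReal, one_mul, hexp,
        h2, Complex.norm_real, Real.norm_of_nonneg hκ.le]
      calc _ ≤ ρ ^ ((1 : ℝ) / 2) * ((2 * Real.pi)⁻¹ * κ * ((1 / κ) ^ ((3 : ℝ) / 2) *
            (ρ ^ ((1 : ℝ) / 2) * ρ)⁻¹ * Real.Gamma (3 / 2))) := by gcongr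
        _ = _ := by field_simp

/-- The radial profile of the fundamental solution in space. -/
noncomputable def profileThree (κ ρ : ℝ) : ℂ :=
  Complex.exp (Complex.I * κ * ρ) / (4 * Real.pi * ρ)

/-- The derivative of `profileThree`. -/
noncomputable def derivProfileThree (κ ρ : ℝ) : ℂ :=
  Complex.exp (Complex.I * κ * ρ) * (Complex.I * κ * ρ - 1) / (4 * Real.pi * (ρ : ℂ) ^ 2)

lemma isOutgoingProfile_three (κ : ℝ) :
    IsOutgoingProfile 3 κ (profileThree κ) (derivProfileThree κ) := by
  have hpi : (Real.pi : ℂ) ≠ 0 := by exact_mod_cast Real.pi_ne_zero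
  have hexp : (((3 : ℕ) : ℝ) - 1) / 2 = 1 := by norm_num
  have hE : ∀ ρ : ℝ, HasDerivAt (fun ρ : ℝ => Complex.exp (Complex.I * κ * ρ))
      (Complex.exp (Complex.I * κ * ρ) * (Complex.I * κ)) ρ := fun ρ => by
    have h := ((hasDerivAt_id ρ).ofReal_comp.const_mul (Complex.I * κ)).cexp
    simpa using h
  have hn : ∀ ρ : ℝ, ‖Complex.exp (Complex.I * κ * ρ)‖ = 1 := fun ρ => by
    rw [mul_assoc, ← Complex.ofReal_mul, Complex.norm_exp_I_mul_ofReal]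
  have hid : ∀ ρ : ℝ, HasDerivAt (fun ρ : ℝ => (ρ : ℂ)) 1 ρ := fun ρ =>
    (hasDerivAt_id ρ).ofReal_comp
  refine ⟨fun ρ hρ => ?_, fun ρ hρ => ?_, ?_, ?_, ?_, ?_⟩
  · have hρ0 : (ρ : ℂ) ≠ 0 := by exact_mod_cast hρ.ne'
    refine ((hE ρ).div ((hid ρ).const_mul (4 * Real.pi : ℂ))
      (by simp [hpi, hρ0])).congr_deriv ?_
    rw [derivProfileThree]
    field_simp
  · have hρ0 : (ρ : ℂ) ≠ 0 := by exact_mod_cast hρ.ne'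
    refine (((hE ρ).mul (((hid ρ).const_mul (Complex.I * κ)).sub_const 1)).div
      (((hid ρ).pow 2).const_mul (4 * Real.pi : ℂ)) (by simp [hpi, hρ0])).congr_deriv ?_
    rw [derivProfileThree, profileThree]
    simp only [Pi.mul_apply, Pi.pow_apply]
    push_cast
    field_simp
    linear_combination (ρ ^ 2 * κ ^ 2 : ℂ) * Complex.I_sq
  · have hc : Continuous fun ρ : ℝ => (ρ : ℂ) * Complex.exp (Complex.I * κ * ρ) / (4 * Real.pi) := by
      fun_prop
    have h := (hc.tendsto 0).mono_left (nhdsWithin_le_nhds (s := Ioi (0 : ℝ)))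
    simp only [Complex.ofReal_zero, zero_mul, zero_div] at h
    refine h.congr' ?_
    filter_upwards [self_mem_nhdsWithin] with ρ hρ
    have hρ0 : (ρ : ℂ) ≠ 0 := by exact_mod_cast hρ.out.ne'
    rw [profileThree, Complex.real_smul]
    push_cast
    field_simp
  · have hc : Continuous fun ρ : ℝ =>
        Complex.exp (Complex.I * κ * ρ) * (Complex.I * κ * ρ - 1) / (4 * Real.pi) := by
      fun_prop
    have h := (hc.tendsto 0).mono_left (nhdsWithin_le_nhds (s := Ioi (0 : ℝ)))
    have e : Complex.exp (Complex.I * κ * (0 : ℝ)) * (Complex.I * κ * (0 : ℝ) - 1) /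
        (4 * Real.pi) = -((volume : Measure (Space 3)).toSphere.real univ : ℂ)⁻¹ := by
      rw [toSphere_real_univ_three]
      push_cast
      simp
      ring
    rw [e] at h
    refine h.congr' ?_
    filter_upwards [self_mem_nhdsWithin] with ρ hρ
    have hρ0 : (ρ : ℂ) ≠ 0 := by exact_mod_cast hρ.out.ne'
    rw [derivProfileThree, Complex.real_smul]
    push_cast
    field_simp
  · refine ⟨(4 * Real.pi)⁻¹, ?_⟩
    filter_upwards [eventually_gt_atTop 0] with ρ hρ
    rw [profileThree, norm_div, hn, norm_mul, norm_mul, Complex.norm_real, Complex.norm_real,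
      Real.norm_of_nonneg Real.pi_pos.le, Real.norm_of_nonneg hρ.le, hexp, Real.rpow_one]
    refine le_of_eq ?_
    rw [Complex.norm_ofNat]
    field_simp
  · have hlim : Tendsto (fun ρ : ℝ => (4 * Real.pi)⁻¹ * ρ⁻¹) atTop (𝓝 0) := by
      simpa using tendsto_inv_atTop_zero.const_mul (4 * Real.pi)⁻¹
    refine hlim.congr' ?_
    filter_upwards [eventually_gt_atTop 0] with ρ hρ
    have hρ0 : (ρ : ℂ) ≠ 0 := by exact_mod_cast hρ.ne'
    have h1 : derivProfileThree κ ρ - Complex.I * κ * profileThree κ ρ =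
        -(Complex.exp (Complex.I * κ * ρ) / (4 * Real.pi * (ρ : ℂ) ^ 2)) := by
      rw [derivProfileThree, profileThree]
      field_simp
      ring
    rw [h1, norm_neg, norm_div, hn, norm_mul, norm_mul, norm_pow, Complex.norm_real,
      Complex.norm_real, Real.norm_of_nonneg Real.pi_pos.le, Real.norm_of_nonneg hρ.le, hexp,
      Real.rpow_one, Complex.norm_ofNat]
    field_simp

end Profiles

/-! ### Incident and scattered waves -/

section Scattering

variable {d : ℕ}

lemma incidentWave_hasFDerivAt (κ : ℝ) (e z : Space d) :
    HasFDerivAt (incidentWave d κ e)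
      ((incidentWave d κ e z * (Complex.I * κ)) • Complex.ofRealCLM.comp (innerSL ℝ e)) z := by
  have h1 : HasFDerivAt (fun x : Space d => ((inner ℝ e x : ℝ) : ℂ))
      (Complex.ofRealCLM.comp (innerSL ℝ e)) z :=
    (Complex.ofRealCLM.comp (innerSL ℝ e)).hasFDerivAt
  refine ((h1.const_mul (Complex.I * κ)).cexp).congr_fderiv ?_
  rw [smul_smul]
  rfl

lemma sum_stdVec_sq (e : Space d) : ∑ j, (inner ℝ e (stdVec j)) ^ 2 = ‖e‖ ^ 2 := by
  rw [← (EuclideanSpace.basisFun (Fin d) ℝ).sum_sq_inner_left e]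

/-- The Hessian is -κ² u_inc e ⊗ e, with trace -κ² u_inc because e is a unit vector. -/
lemma helmholtzOn_incidentWave (κ : ℝ) {e : Space d} (he : ‖e‖ = 1) (U : Set (Space d)) :
    HelmholtzOn κ (incidentWave d κ e) U := by
  have hc : ContDiff ℝ 2 (incidentWave d κ e) := by
    have h1 : ContDiff ℝ 2 fun x : Space d => ((inner ℝ e x : ℝ) : ℂ) :=
      (Complex.ofRealCLM.comp (innerSL ℝ e)).contDiff
    exact (contDiff_const.mul h1).cexp
  refine ⟨hc.contDiffOn, fun z _ => ?_⟩
  have hf : fderiv ℝ (incidentWave d κ e) = fun z =>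
      (incidentWave d κ e z * (Complex.I * κ)) • Complex.ofRealCLM.comp (innerSL ℝ e) :=
    funext fun z => (incidentWave_hasFDerivAt κ e z).fderiv
  have h2 := ((incidentWave_hasFDerivAt κ e z).mul_const (Complex.I * κ)).smul_const
    (Complex.ofRealCLM.comp (innerSL ℝ e))
  rw [hf, h2.fderiv]
  have h3 : ∀ w : Space d, (((Complex.I * κ) • (incidentWave d κ e z * (Complex.I * κ)) •
      Complex.ofRealCLM.comp (innerSL ℝ e)).smulRight
        (Complex.ofRealCLM.comp (innerSL ℝ e)) : Space d →L[ℝ] Space d →L[ℝ] ℂ)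
        w w =
      -(κ : ℂ) ^ 2 * incidentWave d κ e z * (((inner ℝ e w) ^ 2 : ℝ) : ℂ) := fun w => by
    simp
    linear_combination (κ : ℂ) ^ 2 * incidentWave d κ e z *
      ((inner ℝ e w : ℝ) : ℂ) ^ 2 * Complex.I_sq
  rw [Finset.sum_congr rfl fun j _ => h3 (stdVec j), ← Finset.mul_sum, ← Complex.ofReal_sum,
    sum_stdVec_sq, he]
  simp

lemma HelmholtzOn.sub {κ : ℝ} {u v : Space d → ℂ} {U : Set (Space d)} (hU : IsOpen U)
    (hu : HelmholtzOn κ u U) (hv : HelmholtzOn κ v U) :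
    HelmholtzOn κ (fun z => u z - v z) U := by
  refine ⟨hu.contDiffOn.sub hv.contDiffOn, fun z hz => ?_⟩
  have hu' : ContDiffOn ℝ 1 (fderiv ℝ u) U := hu.contDiffOn.fderiv_of_isOpen hU (by norm_num)
  have hv' : ContDiffOn ℝ 1 (fderiv ℝ v) U := hv.contDiffOn.fderiv_of_isOpen hU (by norm_num)
  have h1 : fderiv ℝ (fun z => u z - v z) =ᶠ[𝓝 z] fun y => fderiv ℝ u y - fderiv ℝ v y := by
    filter_upwards [hU.mem_nhds hz] with y hy
    exact fderiv_fun_sub ((hu.contDiffOn.contDiffAt (hU.mem_nhds hy)).differentiableAt two_ne_zero)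
      ((hv.contDiffOn.contDiffAt (hU.mem_nhds hy)).differentiableAt two_ne_zero)
  rw [h1.fderiv_eq, fderiv_fun_sub
    ((hu'.contDiffAt (hU.mem_nhds hz)).differentiableAt one_ne_zero)
    ((hv'.contDiffAt (hU.mem_nhds hz)).differentiableAt one_ne_zero)]
  simp only [sub_apply, Finset.sum_sub_distrib]
  rw [hu.trace_eq z hz, hv.trace_eq z hz]
  ring

/-- The equation is postulated for the total wave; the plane wave is an entire solution and can be
subtracted. -/
lemma IsScatteredWave.helmholtzOn {κ : ℝ} {e : Space d} (he : ‖e‖ = 1) {D : Set (Space d)}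
    {us : Space d → ℂ} (h : IsScatteredWave d κ e D us) : HelmholtzOn κ us (closure D)ᶜ := by
  have htot : HelmholtzOn κ (fun x => incidentWave d κ e x + us x) (closure D)ᶜ := by
    refine ⟨h.contDiffOn, fun z hz => ?_⟩
    have h1 := h.helmholtz z hz
    rw [InnerProductSpace.laplacian_eq_iteratedFDeriv_orthonormalBasis _
      (EuclideanSpace.basisFun (Fin d) ℝ)] at h1
    rw [← sub_eq_zero, ← h1, sub_eq_add_neg]
    congr 1
    · refine Finset.sum_congr rfl fun j _ => ?_
      rw [iteratedFDeriv_two_apply]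
      rfl
    · ring
  have h2 := htot.sub isClosed_closure.isOpen_compl (helmholtzOn_incidentWave κ he _)
  simpa using h2

/-! ### The artificial interface -/

lemma measurableEmbedding_smul_sphere {R : ℝ} (hR : R ≠ 0) :
    MeasurableEmbedding fun s : sphere (0 : Space d) 1 => R • (s : Space d) :=
  (measurableEmbedding_const_smul₀ hR).comp
    (MeasurableEmbedding.subtype_coe isClosed_sphere.measurableSet)

instance (R : ℝ) : IsFiniteMeasure (surfaceMeasure d R) := by
  rw [surfaceMeasure]
  have := Measure.isFiniteMeasure_map (volume : Measure (Space d)).toSphere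
    (fun s : sphere (0 : Space d) 1 => R • (s : Space d))
  exact Measure.smul_finite _ ENNReal.ofReal_ne_top

lemma integral_surfaceMeasure {R : ℝ} (hR : 0 < R) (f : Space d → ℂ) :
    ∫ z, f z ∂surfaceMeasure d R = ∫ s : sphere (0 : Space d) 1,
      (R ^ (d - 1)) • f (R • (s : Space d)) ∂(volume : Measure (Space d)).toSphere := by
  rw [surfaceMeasure, integral_smul_measure,
    (measurableEmbedding_smul_sphere hR.ne').integral_map, integral_smul,
    ENNReal.toReal_ofReal (by positivity)]

lemma memLp_top_surfaceMeasure {R : ℝ} (hR : 0 < R) {f : Space d → ℂ}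
    (hf : Continuous fun s : sphere (0 : Space d) 1 => f (R • (s : Space d))) :
    MemLp f ⊤ (surfaceMeasure d R) := by
  rw [surfaceMeasure]
  refine MemLp.smul_measure ?_ ENNReal.ofReal_ne_top
  rw [(measurableEmbedding_smul_sphere hR.ne').memLp_map_measure_iff]
  obtain ⟨C, hC⟩ := (isCompact_range hf).isBounded.exists_norm_le
  exact memLp_top_of_bound hf.aestronglyMeasurable C
    (Eventually.of_forall fun s => hC _ (mem_range_self s))

/-! ### The fundamental solution -/

lemma exists_isOutgoingProfile (hd : d = 2 ∨ d = 3) {κ : ℝ} (hκ : 0 < κ) :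
    ∃ ψ ψ' : ℝ → ℂ, IsOutgoingProfile d κ ψ ψ' ∧ ∀ x : Space d, Phi d κ x = fun z => ψ ‖x - z‖ := by
  rcases hd with rfl | rfl
  · refine ⟨_, _, isOutgoingProfile_two hκ, fun x => funext fun z => ?_⟩
    rw [Phi, if_pos rfl, profileTwo]
  · refine ⟨_, _, isOutgoingProfile_three κ, fun x => funext fun z => ?_⟩
    rw [Phi, if_neg (by norm_num), profileThree]

lemma helmholtzOn_Phi (hd : d = 2 ∨ d = 3) {κ : ℝ} (hκ : 0 < κ) (x : Space d) :
    HelmholtzOn κ (Phi d κ x) {x}ᶜ := by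
  obtain ⟨ψ, ψ', hψ, hΦ⟩ := exists_isOutgoingProfile hd hκ
  rw [hΦ]
  exact hψ.helmholtzOn_radial x

lemma memLp_top_Phi (hd : d = 2 ∨ d = 3) {κ : ℝ} (hκ : 0 < κ) {R : ℝ} (hR : 0 < R) {x : Space d}
    (hx : R < ‖x‖) :
    MemLp (Phi d κ x) ⊤ (surfaceMeasure d R) ∧ MemLp (dPhi d κ x) ⊤ (surfaceMeasure d R) := by
  have h := (helmholtzOn_Phi hd hκ x).contDiffOn
  have hs : {z : Space d | ‖z‖ = R} ⊆ {x}ᶜ := by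
    rintro z hz rfl
    exact hx.ne' hz
  exact ⟨memLp_top_surfaceMeasure hR (continuous_comp_smul_sphere h.continuousOn hs hR),
    memLp_top_surfaceMeasure hR
      (continuous_normalDeriv_sphere isClosed_singleton.isOpen_compl h hs hR)⟩

/-- Green's representation of the scattered wave in terms of its Cauchy data on `Σ`. -/
theorem IsScatteredWave.representation (hd : d = 2 ∨ d = 3) {κ : ℝ} (hκ : 0 < κ) {e : Space d}
    (he : ‖e‖ = 1) {D : Set (Space d)} {us : Space d → ℂ} (h : IsScatteredWave d κ e D us) {R : ℝ}
    (hR : 0 < R) (hD : closure D ⊆ ball 0 R) {x : Space d} (hx : R < ‖x‖) :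
    us x = ∫ z, (dPhi d κ x z * us z - Phi d κ x z * normalDeriv us z) ∂surfaceMeasure d R := by
  obtain ⟨ψ, ψ', hψ, hΦ⟩ := exists_isOutgoingProfile hd hκ
  -- The closed exterior of the ball lies in the open set where the equation holds, so the wave is
  -- smooth across Σ and its Cauchy data are classical.
  have hRU : {z : Space d | R ≤ ‖z‖} ⊆ (closure D)ᶜ := fun z hz hzD =>
    absurd (mem_ball_zero_iff.1 (hD hzD)) (not_lt.2 hz)
  rw [hψ.exterior_representation (by rcases hd with rfl | rfl <;> norm_num) hκ
    isClosed_closure.isOpen_compl (h.helmholtzOn he) hR hRU h.sommerfeld hx, ← hΦ,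
    flux_greenField_eq _ _ hR, integral_surfaceMeasure hR]
  refine integral_congr_ae (Eventually.of_forall fun s => ?_)
  simp only [dPhi]
  ring_nf

end Scattering

end RandomScattering

/-! ### The second order statistics of the scattered wave -/

theorem mainTheorem2 {d : ℕ} (hd : d = 2 ∨ d = 3)
    -- wavenumber and direction of incidence
    (κ : ℝ) (hκ : 0 < κ) (e : Space d) (he : ‖e‖ = 1)
    -- probability space
    {Ω : Type*} [MeasurableSpace Ω] (P : Measure Ω) [IsProbabilityMeasure P]
    -- the random obstacle, with realizations `V ω '' D₀`, enclosed by the sphere of radius `R`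
    (D₀ : Set (Space d)) (hD₀ : IsNominalObstacle D₀)
    (V : Ω → Space d → Space d) (hV : IsUniformC1Diffeo P D₀ V)
    (R : ℝ) (hR : 0 < R) (hVR : ∀ᵐ ω ∂P, closure (V ω '' D₀) ⊆ ball 0 R)
    -- the random scattered wave, whose Cauchy data on the sphere have finite second moments
    (us : Ω → Space d → ℂ) (hus : ∀ᵐ ω ∂P, IsScatteredWave d κ e (V ω '' D₀) (us ω))
    (hDir : IsL2RandomField P (surfaceMeasure d R) us)
    (hNeu : IsL2RandomField P (surfaceMeasure d R) (fun ω => normalDeriv (us ω))) :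
    -- second moments exist outside of the closed ball
    (∀ x : Space d, R < ‖x‖ → MemLp (fun ω => us ω x) 2 P) ∧
    -- the deterministic expression for the two-point correlation
    (∀ x x' : Space d, R < ‖x‖ → R < ‖x'‖ →
      Integrable (fun p : Space d × Space d => corIntegrand P κ us x x' p.1 p.2)
          ((surfaceMeasure d R).prod (surfaceMeasure d R)) ∧
        correlation P us us x x' =
          ∫ z, ∫ z', corIntegrand P κ us x x' z z' ∂(surfaceMeasure d R) ∂(surfaceMeasure d R)) ∧
    -- covariance and variance
    (∀ x x' : Space d, R < ‖x‖ → R < ‖x'‖ →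
      covariance P us x x' =
        correlation P us us x x' - expectation P us x * conj (expectation P us x')) ∧
    (∀ x : Space d, R < ‖x‖ →
      (variance P us x : ℂ) = covariance P us x x ∧
      (variance P us x : ℂ) =
        correlation P us us x x - (‖expectation P us x‖ : ℂ) ^ 2) := by
  have hrep : ∀ x : Space d, R < ‖x‖ → ∀ᵐ ω ∂P, us ω x = ∫ z,
      (dPhi d κ x z * us ω z - Phi d κ x z * normalDeriv (us ω) z) ∂surfaceMeasure d R := by
    intro x hx
    filter_upwards [hus, hVR] with ω h1 h2 using h1.representation hd hκ he hR h2 hx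
  -- The representation holds for almost every ω separately at each of the two points, which is all
  -- that the expectations see.
  have key : ∀ x x' : Space d, R < ‖x‖ → R < ‖x'‖ → _ := fun x x' hx hx' =>
    correlation_of_layer_representation hDir hNeu (memLp_top_Phi hd hκ hR hx).1
      (memLp_top_Phi hd hκ hR hx).2 (memLp_top_Phi hd hκ hR hx').1
      (memLp_top_Phi hd hκ hR hx').2 (hrep x hx) (hrep x' hx')
  have hL2 : ∀ x : Space d, R < ‖x‖ → MemLp (fun ω => us ω x) 2 P := fun x hx =>
    (key x x hx hx).1
  have hcov : ∀ x x' : Space d, R < ‖x‖ → R < ‖x'‖ → covariance P us x x' =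
      correlation P us us x x' - expectation P us x * conj (expectation P us x') :=
    fun x x' hx hx' => covariance_eq (hL2 x hx) (hL2 x' hx')
  refine ⟨hL2, fun x x' hx hx' => (key x x' hx hx').2, hcov,
    fun x hx => ⟨variance_eq_covariance us x, ?_⟩⟩
  rw [variance_eq_covariance, hcov x x hx hx, Complex.mul_conj, Complex.normSq_eq_norm_sq]
  push_cast
  rfl
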